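/- **Setting.** Let $M$ be a (Hausdorff) complex curve with a smooth foliation $\mathcal F$ of real codimension one. A transversal section is an embedded real curve in $M$ everywhere transverse to the leaves; a holonomy embedding $U\hookrightarrow U'$ of transversal sections is an embedding given by transport along leafwise paths. Let $\mathcal U$ be a transversal basis: a family of transversal sections such that for every transversal section $U'$ and $p\in U'$ there are $U\in\mathcal U$ and a holonomy embedding $h:U\hookrightarrow U'$ with $p\in h(U)$. Every $U\in\mathcal U$ carries a coordinate $t_U$, the restriction of a holomorphic chart of $M$ whose domain contains $U$. Let $V=\coprod_{n\in\mathbb Z}V_{(n)}$ be a quasi-conformal grading-restricted vertex algebra and $W=\coprod_{\alpha\in\mathbb C}W_{(\alpha)}$ a grading-restricted generalized $V$-module ($L_W(-1)$ being of weight one), $W'=\coprod W_{(\alpha)}^*$, $\overline W=\prod W_{(\alpha)}$, with projections $P_\alpha$. Matrix elements of products of vertex operators are understood as the rational functions to which the series converge. In particular $E_V(v_1,x_1;\ldots;v_k,x_k;\mathbf 1)\in\overline V$ and $E_W(v_1,x_1;\ldots;v_k,x_k;w)\in\overline W$ denote the elements with matrix elements given by the rational extensions of $\langle\,\cdot\,,Y(v_1,x_1)\cdots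 Y(v_k,x_k)\mathbf 1\rangle$, respectively $\langle\,\cdot\,,Y_W(v_1,x_1)\cdots Y_W(v_k,x_k)w\rangle$, from $|x_1|>\cdots>|x_k|>0$. **Cochains.** Consider linear maps $v\mapsto\Phi(v,\cdot)$ from $V$ to functions $\mathbb C\to\overline W$ such that every $\langle w',\Phi(v,z)\rangle$ is a polynomial in $z$, $\partial_z\langle w',\Phi(v,z)\rangle=\langle w',\Phi(L_V(-1)v,z)\rangle=\langle w',L_W(-1)\Phi(v,z)\rangle$, and $e^{aL_W(0)}\Phi(v,z)=\Phi(e^{aL_V(0)}v,e^az)$ for $a\in\mathbb C$. Such a $\Phi$ is *composable with $m$ vertex operators* for parameters in a set $D\subset\mathbb C^{m+1}$ if there are positive integers $N(u,v)$, depending only on $u,v\in V$, such that for all $v_1,\ldots,v_{m+1}\in V$, $w'\in W'$ each of the series $$\sum_{r}\langle w',\Phi(P_rE_V(v_1,z_1-\zeta;\ldots;v_{m+1},z_{m+1}-\zeta;\mathbf 1),\zeta)\rangle\quad(\zeta\in\mathbb C),$$ $$\sum_{q}\langle w',E_W(v_1,z_1;\ldots;v_m,z_m;P_q\Phi(v_{m+1},z_{m+1}))\rangle\quad(|z_i|>|z_{m+1}|>0,\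 i\le m)$$ converges absolutely, for all $z\in D$ with distinct entries, to a rational function of $z$ (independent of $\zeta$) whose only possible poles are at $z_i=z_j$, of order at most $N(v_i,v_j)$. Let $C^1_m(V,\mathcal W,\mathcal F)$, $m\ge 0$, consist of the $\Phi$ that, for every sequence $U_1\hookrightarrow\cdots\hookrightarrow U_m$ of holonomy embeddings between sections of $\mathcal U$ and every $1\le j\le m$, are composable with $m$ vertex operators for the parameters $(t_{U_1}(p'_1),\ldots,t_{U_m}(p'_m),t_{U_j}(p))$ with $p'_i\in U_i$, $p\in U_j$. For a section $U_r\in\mathcal U$ and $p'_r\in U_r$, the space $C^1_m(p'_r;V,\mathcal W,\mathcal F)$ is defined in the same way, using only sequences whose $r$-th section is the given $U_r$ and only parameters whose $r$-th entry is $t_{U_r}(p'_r)$. For $m=0$ there is no composability condition in either definition. **Cohomology and connections.** The two-point connection form of $\Phi$ is $$(\delta^1\Phi)(v_1,z_1;v_2,z_2)=Y_W(v_1,z_1)\Phi(v_2,z_2)-\Phi(Y_V(v_1,z_1-z_2)v_2,z_2)+Y_W(v_2,z_2)\Phi(v_1,z_1),$$ where each term stands for the rational function to which its matrix elements converge (in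 $|z_1|>|z_2|>0$, in $z_1\ne z_2$, and in $|z_2|>|z_1|>0$, respectively). Let $\ker\delta^1_m$ be the space of all $\Phi\in C^1_m(V,\mathcal W,\mathcal F)$ for which this form is defined and vanishes for all $z_1\neq z_2$; let $(\delta^0w)(v,z)=Y_W(v,z)w-Y_W(v,z)w$ on $C^0_{m+1}=W$, and $H^1_m(V,\mathcal W,\mathcal F)=\ker\delta^1_m/\operatorname{im}\delta^0_{m+1}$. Let $\mathcal Con_{p'_r}(m;V,\mathcal W)$ be the space of all $\Phi\in C^1_m(p'_r;V,\mathcal W,\mathcal F)$ whose form is defined and vanishes at $z_1=c(p'_r)$, $z_2=c(p)$, i.e. $$\Phi(Y_V(v_1,c(p'_r)-c(p))v_2,c(p))=Y_W(v_1,c(p'_r))\Phi(v_2,c(p))+Y_W(v_2,c(p))\Phi(v_1,c(p'_r)),$$ for all $v_1,v_2\in V$ and all points $p\ne p'_r$ in the domain of the holomorphic chart $c=t_{U_r}$. **Proposition.** For every $m\ge 0$, every $1\le r\le \max(m,1)$, every section $U_r\in\mathcal U$ and every point $p'_r\in U_r$, the map $[\Phi]\mapsto\Phi$ is a well-defined linear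 isomorphism $$H^1_m(V,\mathcal W,\mathcal F)\;\cong\;\mathcal Con_{p'_r}(m;V,\mathcal W).$$ -/

import Mathlib

open scoped Manifold ContDiff

noncomputable section

namespace FoliationVertex

/-! ## Graded spaces, restricted duals and algebraic completions -/

section Graded

variable {ι W : Type*} [AddCommGroup W] [Module ℂ W]

/-- The restricted dual `W' = ∐ W_(α)^*`: linear functionals on `W = ∐ W_(α)` that vanish on all
but finitely many of the homogeneous subspaces. -/
def restrictedDual (gr : ι → Submodule ℂ W) : Submodule ℂ (Module.Dual ℂ W) where
  carrier := {f | {α | ∃ w ∈ gr α, f w ≠ 0}.Finite}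
  zero_mem' := by simp
  add_mem' := by
    intro f g hf hg
    refine (hf.union hg).subset ?_
    rintro α ⟨w, hw, h⟩
    by_cases h1 : f w = 0
    · exact Or.inr ⟨w, hw, by simpa [h1] using h⟩
    · exact Or.inl ⟨w, hw, h1⟩
  smul_mem' := by
    intro c f hf
    refine hf.subset ?_
    rintro α ⟨w, hw, h⟩
    exact ⟨w, hw, fun h0 => h (by simp [h0])⟩

/-- The algebraic completion `∏ W_(α)`. For `x` in it, `x.1 α` is the projection `P_α x`. -/
def Completion (gr : ι → Submodule ℂ W) : Type _ := ↥(Submodule.pi Set.univ gr)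

instance (gr : ι → Submodule ℂ W) : AddCommGroup (Completion gr) :=
  inferInstanceAs (AddCommGroup ↥(Submodule.pi Set.univ gr))

instance (gr : ι → Submodule ℂ W) : Module ℂ (Completion gr) :=
  inferInstanceAs (Module ℂ ↥(Submodule.pi Set.univ gr))

@[simp]
theorem Completion.zero_val {gr : ι → Submodule ℂ W} : (0 : Completion gr).1 = 0 := rfl

@[simp]
theorem Completion.add_val {gr : ι → Submodule ℂ W} (x y : Completion gr) :
    (x + y).1 = x.1 + y.1 := rfl

@[simp]
theorem Completion.smul_val {gr : ι → Submodule ℂ W} (c : ℂ) (x : Completion gr) :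
    (c • x).1 = c • x.1 := rfl

/-- The evaluation pairing between `W'` and the algebraic completion of `W` (a finite sum). -/
def pair {gr : ι → Submodule ℂ W} (w' : restrictedDual gr) (x : Completion gr) : ℂ :=
  ∑ᶠ α, (w' : Module.Dual ℂ W) (x.1 α)

theorem pair_finite {gr : ι → Submodule ℂ W} (w' : restrictedDual gr) (x : Completion gr) :
    (Function.support fun α => (w' : Module.Dual ℂ W) (x.1 α)).Finite :=
  w'.2.subset fun α h => ⟨x.1 α, x.2 α (Set.mem_univ α), h⟩

theorem pair_add {gr : ι → Submodule ℂ W} (w' : restrictedDual gr) (x y : Completion gr) :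
    pair w' (x + y) = pair w' x + pair w' y := by
  unfold pair
  rw [← finsum_add_distrib (pair_finite w' x) (pair_finite w' y)]
  simp

theorem pair_smul {gr : ι → Submodule ℂ W} (w' : restrictedDual gr) (c : ℂ) (x : Completion gr) :
    pair w' (c • x) = c * pair w' x := by
  unfold pair
  rw [← smul_eq_mul, smul_finsum]
  simp

theorem pair_zero {gr : ι → Submodule ℂ W} (w' : restrictedDual gr) :
    pair w' (0 : Completion gr) = 0 := by
  simp [pair]

/-- The homogeneous component of index `i` of an element of `W = ∐ W_(i)`. -/
def homComponent [DecidableEq ι] {gr : ι → Submodule ℂ W} (h : DirectSum.IsInternal gr) (i : ι) :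
    W →ₗ[ℂ] W :=
  (gr i).subtype ∘ₗ DirectSum.component ℂ ι (fun i => gr i) i ∘ₗ
    (LinearEquiv.ofBijective (DirectSum.coeLinearMap gr) h).symm.toLinearMap

end Graded

/-! ## Rational functions and values of rational extensions -/

/-- `c = R(f)(z)`: the series `∑ i, s i x` converges absolutely for every `x` in `U` to one and the
same rational function of `x`, this rational function is regular at `z`, and `c` is its value
there. (Summability in `ℂ` is absolute summability.) -/
def RationalValue {κ : Type*} {k : ℕ} (U : Set (Fin k → ℂ)) (s : κ → (Fin k → ℂ) → ℂ)
    (z : Fin k → ℂ) (c : ℂ) : Prop :=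
  ∃ P Q : MvPolynomial (Fin k) ℂ,
    (∀ x ∈ U, MvPolynomial.eval x Q ≠ 0 ∧
      HasSum (fun i => s i x) (MvPolynomial.eval x P / MvPolynomial.eval x Q)) ∧
    MvPolynomial.eval z Q ≠ 0 ∧ c = MvPolynomial.eval z P / MvPolynomial.eval z Q

theorem RationalValue.add {κ : Type*} {k : ℕ} {U : Set (Fin k → ℂ)}
    {s t r : κ → (Fin k → ℂ) → ℂ} {z : Fin k → ℂ} {c d : ℂ}
    (h : RationalValue U s z c) (h' : RationalValue U t z d)
    (hr : ∀ i x, r i x = s i x + t i x) : RationalValue U r z (c + d) := by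
  obtain ⟨P, Q, h1, h2, h3⟩ := h
  obtain ⟨P', Q', h1', h2', h3'⟩ := h'
  refine ⟨P * Q' + P' * Q, Q * Q', fun x hx => ⟨?_, ?_⟩, ?_, ?_⟩
  · simpa using ⟨(h1 x hx).1, (h1' x hx).1⟩
  · have a := (h1 x hx).1
    have b := (h1' x hx).1
    convert (h1 x hx).2.add (h1' x hx).2 using 1
    · funext i; exact hr i x
    · simp only [map_add, map_mul]; field_simp
  · simpa using ⟨h2, h2'⟩
  · rw [h3, h3']; simp only [map_add, map_mul]; field_simp

theorem RationalValue.smul {κ : Type*} {k : ℕ} {U : Set (Fin k → ℂ)}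
    {s r : κ → (Fin k → ℂ) → ℂ} {z : Fin k → ℂ} {c : ℂ} (a : ℂ)
    (h : RationalValue U s z c) (hr : ∀ i x, r i x = a * s i x) :
    RationalValue U r z (a * c) := by
  obtain ⟨P, Q, h1, h2, h3⟩ := h
  refine ⟨MvPolynomial.C a * P, Q, fun x hx => ⟨(h1 x hx).1, ?_⟩, h2, ?_⟩
  · have h := (h1 x hx).2.mul_left a
    simp only [← hr] at h
    simpa [mul_div_assoc] using h
  · rw [h3]; simp [mul_div_assoc]

theorem RationalValue.zero {κ : Type*} {k : ℕ} {U : Set (Fin k → ℂ)}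
    {r : κ → (Fin k → ℂ) → ℂ} {z : Fin k → ℂ} (hr : ∀ i x, r i x = 0) :
    RationalValue U r z 0 :=
  ⟨0, 1, fun x _ => ⟨by simp, by simp [hr, hasSum_zero]⟩, by simp, by simp⟩

/-- The region `|x_1| > |x_2| > ⋯ > |x_k| > 0`. -/
def orderedRegion (k : ℕ) : Set (Fin k → ℂ) :=
  {x | (∀ i j, i < j → ‖x j‖ < ‖x i‖) ∧ ∀ i, 0 < ‖x i‖}

/-- The denominator `∏_{i<j} (z_i - z_j)^{N(v_i, v_j)}`. -/
def poleDenominator {V : Type*} {k : ℕ} (N : V → V → ℕ+) (v : Fin k → V) (z : Fin k → ℂ) : ℂ :=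
  ∏ i, ∏ j ∈ Finset.Ioi i, (z i - z j) ^ (N (v i) (v j) : ℕ)

/-! ## Grading-restricted vertex algebras and their modules -/

section Vertex


variable {V W : Type*} [AddCommGroup V] [Module ℂ V] [AddCommGroup W] [Module ℂ W]

/-- The mode `v(n)` in `Y(v, z) = ∑ v(n) z^{-n-1}`. -/
abbrev mode (Y : V →ₗ[ℂ] VertexOperator ℂ W) (v : V) (n : ℤ) : Module.End ℂ W :=
  VertexOperator.ncoeff (Y v) n

/-- Duality: the products in both orders and the iterate of two vertex operators converge
absolutely, in their regions, to a common rational function with poles at most at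
`z_1 = 0`, `z_2 = 0`, `z_1 = z_2`. -/
def Duality {ι : Type*} (YV : V →ₗ[ℂ] VertexOperator ℂ V) (YW : V →ₗ[ℂ] VertexOperator ℂ W)
    (gr : ι → Submodule ℂ W) : Prop :=
  ∀ (u₁ u₂ : V) (w : W), ∀ w' ∈ restrictedDual gr,
    ∃ (P : MvPolynomial (Fin 2) ℂ) (k : ℕ), ∀ z₁ z₂ : ℂ,
      (0 < ‖z₂‖ → ‖z₂‖ < ‖z₁‖ →
        HasSum (fun n : ℤ × ℤ =>
            w' (mode YW u₁ n.1 (mode YW u₂ n.2 w)) * z₁ ^ (-n.1 - 1) * z₂ ^ (-n.2 - 1))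
          (MvPolynomial.eval ![z₁, z₂] P / (z₁ * z₂ * (z₁ - z₂)) ^ k)) ∧
      (0 < ‖z₁‖ → ‖z₁‖ < ‖z₂‖ →
        HasSum (fun n : ℤ × ℤ =>
            w' (mode YW u₂ n.2 (mode YW u₁ n.1 w)) * z₁ ^ (-n.1 - 1) * z₂ ^ (-n.2 - 1))
          (MvPolynomial.eval ![z₁, z₂] P / (z₁ * z₂ * (z₁ - z₂)) ^ k)) ∧
      (0 < ‖z₁ - z₂‖ → ‖z₁ - z₂‖ < ‖z₂‖ →
        HasSum (fun n : ℤ × ℤ =>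
            w' (mode YW (mode YV u₁ n.1 u₂) n.2 w) * (z₁ - z₂) ^ (-n.1 - 1) * z₂ ^ (-n.2 - 1))
          (MvPolynomial.eval ![z₁, z₂] P / (z₁ * z₂ * (z₁ - z₂)) ^ k))

variable (V) in
/-- A grading-restricted vertex algebra. Lower truncation is built into `VertexOperator`. -/
structure GradingRestrictedVertexAlgebra where
  /-- the vertex operator map -/
  Y : V →ₗ[ℂ] VertexOperator ℂ V
  /-- the vacuum -/
  one : V
  /-- the homogeneous subspaces `V_(n)` -/
  gr : ℤ → Submodule ℂ V
  internal : DirectSum.IsInternal gr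
  finite_dim : ∀ n, FiniteDimensional ℂ (gr n)
  bounded_below : ∃ N : ℤ, ∀ n < N, gr n = ⊥
  identity : ∀ (n : ℤ) (v : V), mode Y one n v = if n = -1 then v else 0
  creation : ∀ (u : V) (n : ℤ), 0 ≤ n → mode Y u n one = 0
  creation_limit : ∀ u : V, mode Y u (-1) one = u
  duality : Duality Y Y gr
  /-- the grading operator `L(0)` -/
  L0 : Module.End ℂ V
  L0_apply : ∀ (n : ℤ), ∀ v ∈ gr n, L0 v = (n : ℂ) • v
  L0_bracket : ∀ (u v : V) (n : ℤ),
    L0 (mode Y u n v) - mode Y u n (L0 v) = mode Y (L0 u) n v + (-(n : ℂ) - 1) • mode Y u n v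
  /-- `d/dz Y(u, z) = Y(L(-1)u, z)` with `L(-1)u = u(-2)1` -/
  derivative : ∀ (u v : V) (n : ℤ),
    mode Y (mode Y u (-2) one) n v = (-(n : ℂ)) • mode Y u (n - 1) v
  /-- `d/dz Y(u, z) = [L(-1), Y(u, z)]` -/
  derivative_bracket : ∀ (u v : V) (n : ℤ),
    mode Y (mode Y u n v) (-2) one - mode Y u n (mode Y v (-2) one) =
      (-(n : ℂ)) • mode Y u (n - 1) v

namespace GradingRestrictedVertexAlgebra

variable (A : GradingRestrictedVertexAlgebra V)

/-- `L(-1)v = v(-2)1`. -/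
def Lm1 (v : V) : V := mode A.Y v (-2) A.one

/-- `e^{a L(0)} v`, that is `z^{L(0)} v` for `z = e^a`. -/
def expL0 (a : ℂ) (v : V) : V :=
  ∑ᶠ n : ℤ, Complex.exp (a * n) • homComponent A.internal n v

/-- Quasi-conformality: an action of the Lie algebra of vector fields `β(z)∂_z` on the formal disc,
with `L n` the operator of `-z^n ∂_z` (usually called `L_{n-1}`), such that
`[L_{n-1}, Y(u, z)] = ∑_i binom(n, i) z^{n-i} Y(L_{i-1} u, z)`, the operator `L_{-1}` is the
translation operator, `L_0` is the grading operator, and the subalgebra spanned by the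
`L_n` with `n > 0` acts locally nilpotently. -/
def IsQuasiConformal : Prop :=
  ∃ L : ℕ → Module.End ℂ V,
    (∀ v, L 0 v = A.Lm1 v) ∧ L 1 = A.L0 ∧
    (∀ m n, L m * L n - L n * L m = ((m : ℂ) - n) • L (m + n - 1)) ∧
    (∀ (n : ℕ) (u v : V) (k : ℤ),
      L n (mode A.Y u k v) - mode A.Y u k (L n v) =
        ∑ i ∈ Finset.range (n + 1), (n.choose i : ℂ) • mode A.Y (L i u) (k + n - i) v) ∧
    ∀ v, ∃ K : ℕ, ∀ l : List ℕ, K ≤ l.sum → (l.map fun n => if n = 0 then 1 else L (n + 1)).prod v = 0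

variable (W) in
/-- A grading-restricted generalized module. -/
structure GeneralizedModule where
  /-- the vertex operator map -/
  Y : V →ₗ[ℂ] VertexOperator ℂ W
  /-- the operator `L_W(0)` -/
  L0 : Module.End ℂ W
  /-- the operator `L_W(-1)` -/
  Lm1 : Module.End ℂ W
  /-- the homogeneous subspaces `W_(α)` -/
  gr : ℂ → Submodule ℂ W
  internal : DirectSum.IsInternal gr
  bounded_below : ∃ N : ℝ, ∀ α : ℂ, α.re < N → gr α = ⊥
  identity : ∀ (n : ℤ) (w : W), mode Y A.one n w = if n = -1 then w else 0
  duality : Duality A.Y Y gr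
  L0_bracket : ∀ (u : V) (w : W) (n : ℤ),
    L0 (mode Y u n w) - mode Y u n (L0 w) = mode Y (A.L0 u) n w + (-(n : ℂ) - 1) • mode Y u n w
  L0_grading : ∀ (α : ℂ), ∀ w ∈ gr α, ∃ N : ℕ, ((L0 - α • (1 : Module.End ℂ W)) ^ N) w = 0
  /-- `L_W(-1)` is an operator of weight one -/
  Lm1_weight : ∀ (α : ℂ), ∀ w ∈ gr α, Lm1 w ∈ gr (α + 1)
  derivative : ∀ (u : V) (w : W) (n : ℤ),
    mode Y (A.Lm1 u) n w = (-(n : ℂ)) • mode Y u (n - 1) w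
  derivative_bracket : ∀ (u : V) (w : W) (n : ℤ),
    Lm1 (mode Y u n w) - mode Y u n (Lm1 w) = (-(n : ℂ)) • mode Y u (n - 1) w

end GradingRestrictedVertexAlgebra

open GradingRestrictedVertexAlgebra

variable {A : GradingRestrictedVertexAlgebra V}

namespace GradingRestrictedVertexAlgebra.GeneralizedModule

variable (B : A.GeneralizedModule W)

/-- The action of `L_W(-1)` on the algebraic completion. -/
def Lm1Bar (x : Completion B.gr) : Completion B.gr :=
  ⟨fun α => B.Lm1 (x.1 (α - 1)), fun α _ => by
    simpa using B.Lm1_weight (α - 1) _ (x.2 (α - 1) (Set.mem_univ _))⟩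

/-- The component of index `α` of `e^{a L_W(0)} x`, where `x` has the component `w ∈ W_(α)`:
`e^{aα} ∑_k a^k / k! (L_W(0) - α)^k w`, a finite sum. -/
def expL0Component (a α : ℂ) (w : W) : W :=
  Complex.exp (a * α) •
    ∑ᶠ k : ℕ, (a ^ k / (k.factorial : ℂ)) • ((B.L0 - α • (1 : Module.End ℂ W)) ^ k) w

/-- `Y_W(v, z)w` as an element of the algebraic completion, for `z ≠ 0`. -/
def actBar (v : V) (z : ℂ) (w : W) : Completion B.gr :=
  ⟨fun α => ∑ᶠ n : ℤ, z ^ (-n - 1) • homComponent B.internal α (mode B.Y v n w), fun α _ =>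
    finsum_induction (fun x => x ∈ B.gr α) (Submodule.zero_mem _)
      (fun _ _ => Submodule.add_mem _)
      (fun _ => Submodule.smul_mem _ _ (by simp [homComponent]))⟩

/-! ## Cochains with one entry -/

/-- Linear maps `v ↦ Φ(v, ·)` from `V` to functions on `F_1 ℂ = ℂ` with values in the completion of
`W`; here `Φ z v` stands for `Φ(v, z)`. A form `Φ(dz^{wt v} ⊗ v, z)` is represented by its
coefficient function. -/
abbrev Cochain : Type _ := ℂ → V →ₗ[ℂ] Completion B.gr

/-- `Φ` takes values in the space `𝒲_z`: it is rational in `z` without poles (for one variable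
there is no diagonal `z_i = z_j`) and has the two `L(-1)`-derivative properties and the
`L(0)`-conjugation property. With one entry the shuffle condition is empty. -/
structure IsWValued (Φ : Cochain B) : Prop where
  rational : ∀ (v : V) (w' : restrictedDual B.gr), ∃ p : Polynomial ℂ, ∀ z, pair w' (Φ z v) = p.eval z
  derivative_V : ∀ (v : V) (w' : restrictedDual B.gr) (z : ℂ),
    HasDerivAt (fun x => pair w' (Φ x v)) (pair w' (Φ z (A.Lm1 v))) z
  derivative_W : ∀ (v : V) (w' : restrictedDual B.gr) (z : ℂ),
    HasDerivAt (fun x => pair w' (Φ x v)) (pair w' (B.Lm1Bar (Φ z v))) z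
  conjugation : ∀ (a : ℂ) (v : V) (z α : ℂ),
    B.expL0Component a α ((Φ z v).1 α) = (Φ (Complex.exp a * z) (A.expL0 a v)).1 α

/-- `x = E_V(v_1, y_1; …; v_k, y_k; 1)`: the element of the completion of `V` whose matrix elements
are the values at `y` of the rational functions to which the series
`⟨v', Y(v_1, x_1) ⋯ Y(v_k, x_k) 1⟩` converge for `|x_1| > ⋯ > |x_k| > 0`. -/
def IsVacuumCorrelator (A : GradingRestrictedVertexAlgebra V) {k : ℕ} (v : Fin k → V)
    (y : Fin k → ℂ) (x : Completion A.gr) : Prop :=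
  ∀ v' : restrictedDual A.gr,
    RationalValue (orderedRegion k)
      (fun (n : Fin k → ℤ) y' => (v' : Module.Dual ℂ V)
        ((List.ofFn fun i => mode A.Y (v i) (n i)).prod A.one) * ∏ i, y' i ^ (-n i - 1))
      y (pair v' x)

/-- `c = ⟨w', E_W(v_1, y_1; …; v_k, y_k; w)⟩`: the value at `y` of the rational function to which
`⟨w', Y_W(v_1, x_1) ⋯ Y_W(v_k, x_k) w⟩` converges for `|x_1| > ⋯ > |x_k| > 0`. -/
def IsCorrelatorValue {k : ℕ} (v : Fin k → V) (w : W) (w' : restrictedDual B.gr)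
    (y : Fin k → ℂ) (c : ℂ) : Prop :=
  RationalValue (orderedRegion k)
    (fun (n : Fin k → ℤ) y' => (w' : Module.Dual ℂ W)
      ((List.ofFn fun i => mode B.Y (v i) (n i)).prod w) * ∏ i, y' i ^ (-n i - 1))
    y c

/-- For all parameters `z ∈ D` with distinct entries, the value `c` with `rel v w' z c` is given by
a rational function of `z` (depending on `v` and `w'`), whose only possible poles are at
`z_i = z_j`, of order at most `N(v_i, v_j)` with positive integers depending only on
`v_i` and `v_j`. -/
def GivenByRationalFunction {k : ℕ} (D : Set (Fin k → ℂ))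
    (rel : (Fin k → V) → restrictedDual B.gr → (Fin k → ℂ) → ℂ → Prop) : Prop :=
  ∃ N : V → V → ℕ+, ∀ (v : Fin k → V) (w' : restrictedDual B.gr),
    ∃ P : MvPolynomial (Fin k) ℂ, ∀ z ∈ D, Function.Injective z →
      rel v w' z (MvPolynomial.eval z P / poleDenominator N v z)

/-- `c = ∑_r ⟨w', Φ(P_r E_V(v_1, z_1 - ζ; …; v_k, z_k - ζ; 1), ζ)⟩`, absolutely convergent, for
all `ζ`. -/
def IsSumI {k : ℕ} (Φ : Cochain B) (v : Fin k → V) (w' : restrictedDual B.gr) (z : Fin k → ℂ)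
    (c : ℂ) : Prop :=
  ∀ (ζ : ℂ) (x : Completion A.gr), IsVacuumCorrelator A v (fun i => z i - ζ) x →
    HasSum (fun r : ℤ => pair w' (Φ ζ (x.1 r))) c

/-- If `|z_i| > |z_{m+1}| > 0` for `i ≤ m`, then
`c = ∑_q ⟨w', E_W(v_1, z_1; …; v_m, z_m; P_q Φ(v_{m+1}, z_{m+1}))⟩`, absolutely convergent. -/
def IsSumJ {m : ℕ} (Φ : Cochain B) (v : Fin (m + 1) → V) (w' : restrictedDual B.gr)
    (z : Fin (m + 1) → ℂ) (c : ℂ) : Prop :=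
  (∀ i : Fin m, ‖z (Fin.last m)‖ < ‖z i.castSucc‖) → 0 < ‖z (Fin.last m)‖ →
    ∃ e : ℂ → ℂ,
      (∀ q : ℂ, IsCorrelatorValue B (fun i : Fin m => v i.castSucc)
        ((Φ (z (Fin.last m)) (v (Fin.last m))).1 q) w' (fun i => z i.castSucc) (e q)) ∧
      HasSum e c

/-- `Φ` is composable with `m` vertex operators, where the parameters `z_1, …, z_m` of the vertex
operators and `z_{m+1}` of `Φ` are restricted to `D`. -/
def ComposableOn {m : ℕ} (D : Set (Fin (m + 1) → ℂ)) (Φ : Cochain B) : Prop :=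
  GivenByRationalFunction B D (IsSumI B Φ) ∧ GivenByRationalFunction B D (IsSumJ B Φ)

/-! ### Linearity of these conditions -/

theorem poleDenominator_ne_zero {k : ℕ} (N : V → V → ℕ+) (v : Fin k → V) {z : Fin k → ℂ}
    (hz : Function.Injective z) : poleDenominator N v z ≠ 0 := by
  refine Finset.prod_ne_zero_iff.2 fun i _ => Finset.prod_ne_zero_iff.2 fun j hj => ?_
  exact pow_ne_zero _ (sub_ne_zero.2 fun h => (Finset.mem_Ioi.1 hj).ne (hz h))

/-- The denominator as a polynomial. -/
def polePolynomial {k : ℕ} (N : V → V → ℕ+) (v : Fin k → V) : MvPolynomial (Fin k) ℂ :=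
  ∏ i, ∏ j ∈ Finset.Ioi i, (MvPolynomial.X i - MvPolynomial.X j) ^ (N (v i) (v j) : ℕ)

theorem eval_polePolynomial {k : ℕ} (N : V → V → ℕ+) (v : Fin k → V) (z : Fin k → ℂ) :
    MvPolynomial.eval z (polePolynomial N v) = poleDenominator N v z := by
  simp [polePolynomial, poleDenominator]

theorem poleDenominator_add {k : ℕ} (N N' : V → V → ℕ+) (v : Fin k → V) (z : Fin k → ℂ) :
    poleDenominator (fun a b => N a b + N' a b) v z =
      poleDenominator N v z * poleDenominator N' v z := by
  simp [poleDenominator, pow_add, Finset.prod_mul_distrib]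

variable {B}

theorem GivenByRationalFunction.add {k : ℕ} {D : Set (Fin k → ℂ)}
    {r s t : (Fin k → V) → restrictedDual B.gr → (Fin k → ℂ) → ℂ → Prop}
    (hr : GivenByRationalFunction B D r) (hs : GivenByRationalFunction B D s)
    (h : ∀ v w' z c d, r v w' z c → s v w' z d → t v w' z (c + d)) :
    GivenByRationalFunction B D t := by
  obtain ⟨N, hN⟩ := hr
  obtain ⟨N', hN'⟩ := hs
  refine ⟨fun a b => N a b + N' a b, fun v w' => ?_⟩
  obtain ⟨P, hP⟩ := hN v w'
  obtain ⟨P', hP'⟩ := hN' v w'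
  refine ⟨P * polePolynomial N' v + P' * polePolynomial N v, fun z hz hi => ?_⟩
  have a := poleDenominator_ne_zero N v hi
  have b := poleDenominator_ne_zero N' v hi
  convert h v w' z _ _ (hP z hz hi) (hP' z hz hi) using 1
  rw [poleDenominator_add]
  simp only [map_add, map_mul, eval_polePolynomial]
  field_simp

theorem GivenByRationalFunction.smul {k : ℕ} {D : Set (Fin k → ℂ)} (a : ℂ)
    {r t : (Fin k → V) → restrictedDual B.gr → (Fin k → ℂ) → ℂ → Prop}
    (hr : GivenByRationalFunction B D r)
    (h : ∀ v w' z c, r v w' z c → t v w' z (a * c)) :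
    GivenByRationalFunction B D t := by
  obtain ⟨N, hN⟩ := hr
  refine ⟨N, fun v w' => ?_⟩
  obtain ⟨P, hP⟩ := hN v w'
  refine ⟨MvPolynomial.C a * P, fun z hz hi => ?_⟩
  convert h v w' z _ (hP z hz hi) using 1
  simp [mul_div_assoc]

theorem GivenByRationalFunction.zero {k : ℕ} {D : Set (Fin k → ℂ)}
    {t : (Fin k → V) → restrictedDual B.gr → (Fin k → ℂ) → ℂ → Prop}
    (h : ∀ v w' z, t v w' z 0) : GivenByRationalFunction B D t :=
  ⟨fun _ _ => 1, fun v w' => ⟨0, fun z _ _ => by simpa using h v w' z⟩⟩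

theorem IsSumI.add {k : ℕ} {Φ Ψ : Cochain B} {v : Fin k → V} {w' : restrictedDual B.gr}
    {z : Fin k → ℂ} {c d : ℂ} (h : IsSumI B Φ v w' z c) (h' : IsSumI B Ψ v w' z d) :
    IsSumI B (Φ + Ψ) v w' z (c + d) := fun ζ x hx => by
  simpa [pair_add] using (h ζ x hx).add (h' ζ x hx)

theorem IsSumI.smul {k : ℕ} {Φ : Cochain B} {v : Fin k → V} {w' : restrictedDual B.gr}
    {z : Fin k → ℂ} {c : ℂ} (a : ℂ) (h : IsSumI B Φ v w' z c) :
    IsSumI B (a • Φ) v w' z (a * c) := fun ζ x hx => by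
  simpa [pair_smul] using (h ζ x hx).mul_left a

theorem IsSumJ.add {m : ℕ} {Φ Ψ : Cochain B} {v : Fin (m + 1) → V} {w' : restrictedDual B.gr}
    {z : Fin (m + 1) → ℂ} {c d : ℂ} (h : IsSumJ B Φ v w' z c) (h' : IsSumJ B Ψ v w' z d) :
    IsSumJ B (Φ + Ψ) v w' z (c + d) := fun h1 h2 => by
  obtain ⟨e, he, hs⟩ := h h1 h2
  obtain ⟨e', he', hs'⟩ := h' h1 h2
  exact ⟨fun q => e q + e' q,
    fun q => RationalValue.add (he q) (he' q) fun n y => by simp [add_mul], hs.add hs'⟩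

theorem IsSumJ.smul {m : ℕ} {Φ : Cochain B} {v : Fin (m + 1) → V} {w' : restrictedDual B.gr}
    {z : Fin (m + 1) → ℂ} {c : ℂ} (a : ℂ) (h : IsSumJ B Φ v w' z c) :
    IsSumJ B (a • Φ) v w' z (a * c) := fun h1 h2 => by
  obtain ⟨e, he, hs⟩ := h h1 h2
  exact ⟨fun q => a * e q,
    fun q => RationalValue.smul a (he q) fun n y => by simp [mul_assoc], hs.mul_left a⟩

theorem ComposableOn.add {m : ℕ} {D : Set (Fin (m + 1) → ℂ)} {Φ Ψ : Cochain B}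
    (h : ComposableOn B D Φ) (h' : ComposableOn B D Ψ) : ComposableOn B D (Φ + Ψ) :=
  ⟨h.1.add h'.1 fun _ _ _ _ _ => IsSumI.add, h.2.add h'.2 fun _ _ _ _ _ => IsSumJ.add⟩

theorem ComposableOn.smul {m : ℕ} {D : Set (Fin (m + 1) → ℂ)} {Φ : Cochain B} (a : ℂ)
    (h : ComposableOn B D Φ) : ComposableOn B D (a • Φ) :=
  ⟨h.1.smul a fun _ _ _ _ => IsSumI.smul a, h.2.smul a fun _ _ _ _ => IsSumJ.smul a⟩

theorem ComposableOn.zero {m : ℕ} {D : Set (Fin (m + 1) → ℂ)} :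
    ComposableOn B D (0 : Cochain B) :=
  ⟨GivenByRationalFunction.zero fun v w' z ζ x _ => by simp [pair_zero, hasSum_zero],
    GivenByRationalFunction.zero fun v w' z _ _ =>
      ⟨fun _ => 0, fun q => RationalValue.zero fun n y => by simp, hasSum_zero⟩⟩

theorem expL0_finite (a α : ℂ) {w : W} (hw : w ∈ B.gr α) :
    (Function.support fun k : ℕ =>
      (a ^ k / (k.factorial : ℂ)) • ((B.L0 - α • (1 : Module.End ℂ W)) ^ k) w).Finite := by
  obtain ⟨N, hN⟩ := B.L0_grading α w hw
  refine (Set.finite_lt_nat N).subset fun k hk => ?_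
  by_contra hlt
  apply hk
  obtain ⟨j, rfl⟩ := Nat.exists_eq_add_of_le (not_lt.1 hlt)
  have h0 : ((B.L0 - α • (1 : Module.End ℂ W)) ^ (N + j)) w = 0 := by
    rw [add_comm N j, pow_add (B.L0 - α • (1 : Module.End ℂ W)), Module.End.mul_apply, hN, map_zero]
  simp only [h0, smul_zero]

theorem Lm1Bar_add (x y : Completion B.gr) : B.Lm1Bar (x + y) = B.Lm1Bar x + B.Lm1Bar y :=
  Subtype.ext (funext fun _ => map_add B.Lm1 _ _)

theorem Lm1Bar_smul (a : ℂ) (x : Completion B.gr) : B.Lm1Bar (a • x) = a • B.Lm1Bar x :=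
  Subtype.ext (funext fun _ => map_smul B.Lm1 _ _)

variable (B)

/-- The cochains with values in `𝒲_z`, as a subspace. -/
def wCochains : Submodule ℂ (Cochain B) where
  carrier := {Φ | IsWValued B Φ}
  zero_mem' :=
    { rational := fun v w' => ⟨0, by simp [pair_zero]⟩
      derivative_V := fun v w' z => by simpa [pair_zero] using hasDerivAt_const z (0 : ℂ)
      derivative_W := fun v w' z => by
        have h : B.Lm1Bar 0 = 0 := by refine Subtype.ext (funext fun α => ?_); simp [Lm1Bar]
        simpa [pair_zero, h] using hasDerivAt_const z (0 : ℂ)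
      conjugation := fun a v z α => by simp [expL0Component] }
  add_mem' := fun {Φ Ψ} h h' =>
    { rational := fun v w' => by
        obtain ⟨p, hp⟩ := h.rational v w'
        obtain ⟨q, hq⟩ := h'.rational v w'
        exact ⟨p + q, fun z => by simp [pair_add, hp, hq]⟩
      derivative_V := fun v w' z => by
        simpa [pair_add] using (h.derivative_V v w' z).fun_add (h'.derivative_V v w' z)
      derivative_W := fun v w' z => by
        simpa [pair_add, Lm1Bar_add] using
          (h.derivative_W v w' z).fun_add (h'.derivative_W v w' z)
      conjugation := fun a v z α => by
        have e1 := h.conjugation a v z α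
        have e2 := h'.conjugation a v z α
        simp only [LinearMap.add_apply, Pi.add_apply, Completion.add_val] at *
        rw [← e1, ← e2]
        unfold expL0Component
        rw [← smul_add, ← finsum_add_distrib
          (expL0_finite a α ((Φ z v).2 α (Set.mem_univ _)))
          (expL0_finite a α ((Ψ z v).2 α (Set.mem_univ _)))]
        simp }
  smul_mem' := fun c Φ h =>
    { rational := fun v w' => by
        obtain ⟨p, hp⟩ := h.rational v w'
        exact ⟨Polynomial.C c * p, fun z => by simp [pair_smul, hp]⟩
      derivative_V := fun v w' z => by
        simpa [pair_smul] using (h.derivative_V v w' z).const_mul c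
      derivative_W := fun v w' z => by
        simpa [pair_smul, Lm1Bar_smul] using (h.derivative_W v w' z).const_mul c
      conjugation := fun a v z α => by
        have e1 := h.conjugation a v z α
        simp only [LinearMap.smul_apply, Pi.smul_apply, Completion.smul_val] at *
        rw [← e1]
        unfold expL0Component
        rw [smul_comm c, smul_finsum c]
        congr 2
        funext k
        rw [map_smul, smul_comm] }

/-! ## The two-point connection form -/

/-- The term `⟨w', ω_W(v_1, z_1) Φ(v_2, z_2)⟩` has the value `c` at `(z_1, z_2)`: it is the value
of the rational function to which `∑_q ⟨w', Y_W(v_1, x_1) P_q Φ(v_2, x_2)⟩` converges for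
`|x_1| > |x_2| > 0`. -/
def IsLeftTerm (Φ : Cochain B) (v₁ v₂ : V) (w' : restrictedDual B.gr) (z₁ z₂ c : ℂ) : Prop :=
  RationalValue (orderedRegion 2)
    (fun (i : ℂ × ℤ) x =>
      (w' : Module.Dual ℂ W) (mode B.Y v₁ i.2 ((Φ (x 1) v₂).1 i.1)) * x 0 ^ (-i.2 - 1))
    ![z₁, z₂] c

/-- The term `⟨w', Φ(ω_V(v_1, z_1 - z_2)v_2, z_2)⟩` has the value `c` at `(z_1, z_2)`. -/
def IsMiddleTerm (Φ : Cochain B) (v₁ v₂ : V) (w' : restrictedDual B.gr) (z₁ z₂ c : ℂ) : Prop :=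
  RationalValue {x : Fin 2 → ℂ | x 0 ≠ x 1}
    (fun (n : ℤ) x => pair w' (Φ (x 1) (mode A.Y v₁ n v₂)) * (x 0 - x 1) ^ (-n - 1))
    ![z₁, z₂] c

/-- The matrix element `⟨w', (δ^1 Φ)(v_1, z_1; v_2, z_2)⟩` of the two-point connection form
`ω_W(v_1, z_1)Φ(v_2, z_2) - Φ(ω_V(v_1, z_1 - z_2)v_2, z_2) + ω_W(v_2, z_2)Φ(v_1, z_1)` is defined
and vanishes. -/
def FormVanishes (Φ : Cochain B) (v₁ v₂ : V) (w' : restrictedDual B.gr) (z₁ z₂ : ℂ) : Prop :=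
  ∃ c₁ c₂ c₃ : ℂ, IsLeftTerm B Φ v₁ v₂ w' z₁ z₂ c₁ ∧ IsMiddleTerm B Φ v₁ v₂ w' z₁ z₂ c₂ ∧
    IsLeftTerm B Φ v₂ v₁ w' z₂ z₁ c₃ ∧ c₁ - c₂ + c₃ = 0

variable {B}

theorem FormVanishes.add {Φ Ψ : Cochain B} {v₁ v₂ : V} {w' : restrictedDual B.gr} {z₁ z₂ : ℂ}
    (h : FormVanishes B Φ v₁ v₂ w' z₁ z₂) (h' : FormVanishes B Ψ v₁ v₂ w' z₁ z₂) :
    FormVanishes B (Φ + Ψ) v₁ v₂ w' z₁ z₂ := by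
  obtain ⟨a, b, c, h1, h2, h3, h4⟩ := h
  obtain ⟨a', b', c', h1', h2', h3', h4'⟩ := h'
  exact ⟨a + a', b + b', c + c', RationalValue.add h1 h1' fun i x => by simp [add_mul],
    RationalValue.add h2 h2' fun i x => by simp [pair_add, add_mul],
    RationalValue.add h3 h3' fun i x => by simp [add_mul], by linear_combination h4 + h4'⟩

theorem FormVanishes.smul (s : ℂ) {Φ : Cochain B} {v₁ v₂ : V} {w' : restrictedDual B.gr}
    {z₁ z₂ : ℂ} (h : FormVanishes B Φ v₁ v₂ w' z₁ z₂) :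
    FormVanishes B (s • Φ) v₁ v₂ w' z₁ z₂ := by
  obtain ⟨a, b, c, h1, h2, h3, h4⟩ := h
  exact ⟨s * a, s * b, s * c, RationalValue.smul s h1 fun i x => by simp [mul_assoc],
    RationalValue.smul s h2 fun i x => by simp [pair_smul, mul_assoc],
    RationalValue.smul s h3 fun i x => by simp [mul_assoc], by linear_combination s * h4⟩

theorem FormVanishes.zero {v₁ v₂ : V} {w' : restrictedDual B.gr} {z₁ z₂ : ℂ} :
    FormVanishes B 0 v₁ v₂ w' z₁ z₂ :=
  ⟨0, 0, 0, RationalValue.zero fun i x => by simp, RationalValue.zero fun i x => by simp [pair_zero],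
    RationalValue.zero fun i x => by simp, by simp⟩

variable (B)

/-- The coboundary operator on cochains without entries, `C^0_{m+1} = W`:
`(δ^0 w)(v, z) = ω_W(v, z)w - ω_W(v, z)w`. -/
def delta0 : W →ₗ[ℂ] Cochain B where
  toFun w := fun z =>
    { toFun := fun v => B.actBar v z w - B.actBar v z w
      map_add' := fun v v' => by simp
      map_smul' := fun c v => by simp }
  map_add' w w' := by funext z; exact LinearMap.ext fun v => by simp
  map_smul' c w := by funext z; exact LinearMap.ext fun v => by simp

end GradingRestrictedVertexAlgebra.GeneralizedModule

end Vertex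

/-! ## Codimension one foliations of a complex curve -/

section Foliation

variable (M : Type*) [TopologicalSpace M] [ChartedSpace ℂ M]

/-- A smooth foliation of real codimension one on the real surface underlying a complex curve,
given by foliation charts with values in `ℝ × ℝ`. The plaques are the level sets of the second
coordinate. -/
structure CodimOneFoliation where
  /-- the foliation charts -/
  charts : Set (OpenPartialHomeomorph M (ℝ × ℝ))
  cover : ∀ p : M, ∃ φ ∈ charts, p ∈ φ.source
  smooth : ∀ φ ∈ charts, ∀ e ∈ atlas ℂ M,
    ContDiffOn ℝ ∞ (fun x => φ (e.symm x)) (e.symm.trans φ).source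
  smooth_symm : ∀ φ ∈ charts, ∀ e ∈ atlas ℂ M,
    ContDiffOn ℝ ∞ (fun x => e (φ.symm x)) (φ.symm.trans e).source
  /-- Changes of charts locally map plaques into plaques. -/
  plaques : ∀ φ ∈ charts, ∀ ψ ∈ charts, ∀ p ∈ φ.source ∩ ψ.source,
    ∃ g : ℝ → ℝ, ∀ᶠ q in nhds p, (ψ q).2 = g (φ q).2

variable {M}

namespace CodimOneFoliation

variable (F : CodimOneFoliation M)

/-- A transversal section: an embedded curve which is everywhere transverse to the leaves, that is,
in foliation charts it is locally the graph of a smooth function of the transverse coordinate. -/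
def IsTransversalSection (U : Set M) : Prop :=
  ∀ p ∈ U, ∃ φ ∈ F.charts, ∃ O : Set M, IsOpen O ∧ p ∈ O ∧ O ⊆ φ.source ∧
    ∃ (I : Set ℝ) (s : ℝ → ℝ), IsOpen I ∧ ContDiffOn ℝ ∞ s I ∧
      φ '' (U ∩ O) = (fun y => (s y, y)) '' I

/-- A path that stays in a leaf and is continuous there: locally its transverse coordinate is
constant. -/
def IsLeafwise (γ : unitInterval → M) : Prop :=
  ∀ t, ∃ φ ∈ F.charts, γ t ∈ φ.source ∧ ∀ᶠ s in nhds t, (φ (γ s)).2 = (φ (γ t)).2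

/-- A holonomy embedding `h : U ↪ U'`: transport along the leaves (along a continuous family of
leafwise paths that starts at the points of `U`), defined on all of `U` and embedding `U`
into `U'`. -/
def IsHolonomyEmbedding (U U' : Set M) (h : U → U') : Prop :=
  Topology.IsOpenEmbedding h ∧
    ∃ H : unitInterval × U → M, Continuous H ∧ (∀ x : U, H (0, x) = x) ∧
      (∀ x : U, H (1, x) = h x) ∧ ∀ x : U, F.IsLeafwise fun t => H (t, x)

/-- A transversal basis for the leaf space, where each section carries a coordinate induced by a
holomorphic coordinate of the curve that is defined on the whole section. -/
structure TransversalBasis where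
  /-- the sections of the basis -/
  sections : Set (Set M)
  transversal : ∀ U ∈ sections, F.IsTransversalSection U
  basis : ∀ U' : Set M, F.IsTransversalSection U' → ∀ p ∈ U',
    ∃ U ∈ sections, ∃ h : U → U', F.IsHolonomyEmbedding U U' h ∧ ∃ x : U, (h x : M) = p
  /-- the coordinates -/
  coord : sections → OpenPartialHomeomorph M ℂ
  coord_holomorphic : ∀ U, coord U ∈ IsManifold.maximalAtlas 𝓘(ℂ, ℂ) ω M
  coord_covers : ∀ U : sections, (U : Set M) ⊆ (coord U).source

end CodimOneFoliation

namespace CodimOneFoliation.TransversalBasis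

variable {F : CodimOneFoliation M} (T : F.TransversalBasis)

/-- A sequence `U_1 ↪ U_2 ↪ ⋯ ↪ U_m` of holonomy embeddings between sections of the basis. -/
def IsChain {m : ℕ} (U : Fin m → T.sections) : Prop :=
  ∀ i j : Fin m, (i : ℕ) + 1 = j →
    ∃ h : ↥(U i).1 → ↥(U j).1, F.IsHolonomyEmbedding (U i) (U j) h

/-- The parameters `(t_1(p'_1), …, t_m(p'_m), t_j(p))` with points `p'_i ∈ U_i`, `p ∈ U_j`. -/
def parameters {m : ℕ} (U : Fin m → T.sections) (j : Fin m) : Set (Fin (m + 1) → ℂ) :=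
  {z | (∀ i : Fin m, z i.castSucc ∈ T.coord (U i) '' (U i)) ∧
    z (Fin.last m) ∈ T.coord (U j) '' (U j)}

end CodimOneFoliation.TransversalBasis

end Foliation

/-! ## Cochain spaces, first cohomology and fixed-point connections of a foliation -/

section Cohomology

open GradingRestrictedVertexAlgebra GeneralizedModule

variable {M : Type*} [TopologicalSpace M] [ChartedSpace ℂ M] {F : CodimOneFoliation M}
  (T : F.TransversalBasis) {V W : Type*} [AddCommGroup V] [Module ℂ V] [AddCommGroup W]
  [Module ℂ W] {A : GradingRestrictedVertexAlgebra V} (B : A.GeneralizedModule W)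

/-- `C^1_m(V, 𝒲, ℱ)`: the maps `Φ : V → 𝒲_z` composable with `m` vertex operators on the sections
of every sequence `U_1 ↪ ⋯ ↪ U_m` of holonomy embeddings. -/
def cochains (m : ℕ) : Submodule ℂ (Cochain B) where
  carrier := {Φ | Φ ∈ wCochains B ∧ ∀ U : Fin m → T.sections, T.IsChain U → ∀ j : Fin m,
    ComposableOn B (T.parameters U j) Φ}
  zero_mem' := ⟨zero_mem _, fun _ _ _ => ComposableOn.zero⟩
  add_mem' := fun h h' =>
    ⟨add_mem h.1 h'.1, fun U hU j => (h.2 U hU j).add (h'.2 U hU j)⟩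
  smul_mem' := fun c _ h =>
    ⟨Submodule.smul_mem _ c h.1, fun U hU j => (h.2 U hU j).smul c⟩

/-- The kernel of `δ^1_m`, that is, the closed connections in `C^1_m(V, 𝒲, ℱ)`. -/
def closedCochains (m : ℕ) : Submodule ℂ (Cochain B) where
  carrier := {Φ | Φ ∈ cochains T B m ∧ ∀ (v₁ v₂ : V) (w' : restrictedDual B.gr) (z₁ z₂ : ℂ),
    z₁ ≠ z₂ → FormVanishes B Φ v₁ v₂ w' z₁ z₂}
  zero_mem' := ⟨zero_mem _, fun _ _ _ _ _ _ => FormVanishes.zero⟩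
  add_mem' := fun h h' =>
    ⟨add_mem h.1 h'.1, fun v₁ v₂ w' z₁ z₂ hz => (h.2 v₁ v₂ w' z₁ z₂ hz).add (h'.2 v₁ v₂ w' z₁ z₂ hz)⟩
  smul_mem' := fun c _ h =>
    ⟨Submodule.smul_mem _ c h.1, fun v₁ v₂ w' z₁ z₂ hz => (h.2 v₁ v₂ w' z₁ z₂ hz).smul c⟩

/-- `H^1_m(V, 𝒲, ℱ) = ker δ^1_m / im δ^0_{m+1}`, where `C^0_{m+1} = W`. -/
abbrev FirstCohomology (m : ℕ) : Type _ :=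
  closedCochains T B m ⧸ (LinearMap.range (delta0 B)).submoduleOf (closedCochains T B m)

/-- `C^1_m(p'_r; V, 𝒲, ℱ)`: the maps `Φ : V → 𝒲_z` composable with `m` vertex operators on the
sections of every sequence of holonomy embeddings whose `r`-th section is `S`, where the
parameter of the `r`-th vertex operator is the coordinate of the fixed point `p' ∈ S`. -/
def fixedPointCochains (m r : ℕ) (S : T.sections) (p' : M) : Submodule ℂ (Cochain B) where
  carrier := {Φ | Φ ∈ wCochains B ∧ ∀ U : Fin m → T.sections, T.IsChain U →
    ∀ i : Fin m, (i : ℕ) + 1 = r → U i = S → ∀ j : Fin m,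
      ComposableOn B {z ∈ T.parameters U j | z i.castSucc = T.coord S p'} Φ}
  zero_mem' := ⟨zero_mem _, fun _ _ _ _ _ _ => ComposableOn.zero⟩
  add_mem' := fun h h' => ⟨add_mem h.1 h'.1,
    fun U hU i hi hS j => (h.2 U hU i hi hS j).add (h'.2 U hU i hi hS j)⟩
  smul_mem' := fun c _ h => ⟨Submodule.smul_mem _ c h.1,
    fun U hU i hi hS j => (h.2 U hU i hi hS j).smul c⟩

/-- `Con_{p'_r}(m; V, 𝒲)`: the elements `Φ` of `C^1_m(p'_r; V, 𝒲, ℱ)` that satisfy the two-point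
connection formula
`Φ(ω_V(v₁, c(p') - c(p))v₂, c(p)) = ω_W(v₁, c(p'))Φ(v₂, c(p)) + ω_W(v₂, c(p))Φ(v₁, c(p'))`
with the fixed point `p'` for all points `p ≠ p'` in the domain of the coordinate `c`. -/
def fixedPointConnections (m r : ℕ) (S : T.sections) (p' : M) : Submodule ℂ (Cochain B) where
  carrier := {Φ | Φ ∈ fixedPointCochains T B m r S p' ∧
    ∀ (v₁ v₂ : V) (w' : restrictedDual B.gr), ∀ p ∈ (T.coord S).source, p ≠ p' →
      FormVanishes B Φ v₁ v₂ w' (T.coord S p') (T.coord S p)}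
  zero_mem' := ⟨zero_mem _, fun _ _ _ _ _ _ => FormVanishes.zero⟩
  add_mem' := fun h h' => ⟨add_mem h.1 h'.1,
    fun v₁ v₂ w' p hp hne => (h.2 v₁ v₂ w' p hp hne).add (h'.2 v₁ v₂ w' p hp hne)⟩
  smul_mem' := fun c _ h => ⟨Submodule.smul_mem _ c h.1,
    fun v₁ v₂ w' p hp hne => (h.2 v₁ v₂ w' p hp hne).smul c⟩

end Cohomology

end FoliationVertex

end

/-!
Pairing `Φ` with `f ∈ W'` gives `⟨f, Φ(v, z)⟩ = ⟨e^{z L(-1)ᵗ} f, φ(v)⟩` with `φ = Φ(·, 0) : V → W`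
graded and commuting with `L(-1)`; the exponential is a finite sum, because the transpose `L(-1)ᵗ`
is locally nilpotent on `W'`. Hence `Φ` is composable with any number of vertex operators for every
set of parameters: the first series is a correlation function of `V`, paired with the pullback of
`f` along `φ`, and the second is the Taylor expansion of a translated correlation function of `W`;
both are rational by weak commutativity and the truncation of fields and of matrix elements.

The matrix elements of the two-point connection form are rational in `(z₁, z₂)` with poles only on
the diagonal, and a simultaneous translation of `z₁` and `z₂` amounts to replacing `f` by
`e^{t L(-1)ᵗ} f`. So, if the form vanishes for one `z₁` and all `z₂ ≠ z₁` in an open set, then it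
vanishes for all `z₁ ≠ z₂`. Since `δ⁰ = 0`, no quotient is left to take.
-/

noncomputable section

namespace FoliationVertex

/-! ## Formal series in several variables -/

section Formal

variable {G : Type*} [AddCommGroup G]

section ShiftDiff

variable {R : Type*} [CommRing R]

/-- Multiplication of a formal series `∑ f a e x^{-a-1} χ(e)` by `x - y`, acting on the
coefficients: `x` is the outer variable, and `y` is the variable with `χ(e) = y χ(e + d)`. -/
def shiftDiff (d : G) : Module.End R (ℤ → G → R) where
  toFun f := fun a e => f (a + 1) e - f a (e + d)
  map_add' f g := by funext a e; simp only [Pi.add_apply]; ring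
  map_smul' c f := by funext a e; simp only [Pi.smul_apply, smul_eq_mul, RingHom.id_apply]; ring

theorem shiftDiff_apply (d : G) (f : ℤ → G → R) (a : ℤ) (e : G) :
    shiftDiff d f a e = f (a + 1) e - f a (e + d) := rfl

theorem shiftDiff_commute (d d' : G) :
    Commute (shiftDiff d : Module.End R (ℤ → G → R)) (shiftDiff d') := by
  refine LinearMap.ext fun f => ?_
  funext a e
  simp only [Module.End.mul_apply, shiftDiff_apply, add_right_comm e d' d]
  ring

theorem shiftDiff_pow_eq_zero (d : G) {f : ℤ → G → R} (S : ℕ → ℤ → G → Prop)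
    (h : ∀ a e, S 0 a e → f a e = 0)
    (hS : ∀ n a e, S (n + 1) a e → S n (a + 1) e ∧ S n a (e + d)) (n : ℕ) (a : ℤ) (e : G)
    (hn : S n a e) : ((shiftDiff d ^ n) f) a e = 0 := by
  induction n generalizing a e with
  | zero => exact h a e hn
  | succ n ih =>
    rw [pow_succ', Module.End.mul_apply, shiftDiff_apply, ih _ _ (hS n a e hn).1,
      ih _ _ (hS n a e hn).2, sub_zero]

theorem sum_range_shiftDiff (d : G) (f : ℤ → G → R) (n : ℕ) (a : ℤ) (e : G) :
    ∑ l ∈ Finset.range n, shiftDiff d f (a - 1 - l) (e + l • d) =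
      f a e - f (a - n) (e + n • d) := by
  have h := Finset.sum_range_sub' (fun l : ℕ => f (a - l) (e + l • d)) n
  rw [Nat.cast_zero, sub_zero, zero_smul, add_zero] at h
  rw [← h]
  refine Finset.sum_congr rfl fun l _ => ?_
  rw [shiftDiff_apply, succ_nsmul, ← add_assoc, Nat.cast_add_one, sub_right_comm, sub_add_cancel,
    sub_add_eq_sub_sub]

theorem finite_support_shiftDiff_diagonal (d : G) {f : ℤ → G → R} {lo : ℤ}
    (hf : ∀ a < lo, ∀ e, f a e = 0) (a : ℤ) (e : G) :
    ∀ l ∉ Finset.range (a - lo + 1).toNat, shiftDiff d f (a - 1 - l) (e + l • d) = 0 := by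
  intro l hl
  rw [Finset.mem_range, not_lt, Int.toNat_le] at hl
  rw [shiftDiff_apply, hf _ (by lia), hf _ (by lia), sub_zero]

end ShiftDiff

theorem hasSum_shiftDiff_diagonal (d : G) {f : ℤ → G → ℂ} {lo : ℤ}
    (hf : ∀ a < lo, ∀ e, f a e = 0) (a : ℤ) (e : G) :
    HasSum (fun l : ℕ => shiftDiff d f (a - 1 - l) (e + l • d)) (f a e) := by
  have h : HasSum (fun l : ℕ => shiftDiff d f (a - 1 - l) (e + l • d)) _ :=
    hasSum_sum_of_ne_finset_zero (finite_support_shiftDiff_diagonal d hf a e)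
  rwa [sum_range_shiftDiff, hf (a - ((a - lo + 1).toNat : ℤ)) (by lia), sub_zero] at h

theorem hasSum_shiftDiff {d : G} {x y : ℂ} (hx : x ≠ 0) {χ : G → ℂ}
    (hχ : ∀ e, χ e = y * χ (e + d)) {f : ℤ → G → ℂ} {τ : ℂ}
    (h : HasSum (fun p : ℤ × G => f p.1 p.2 * (x ^ (-p.1 - 1) * χ p.2)) τ) :
    HasSum (fun p : ℤ × G => shiftDiff d f p.1 p.2 * (x ^ (-p.1 - 1) * χ p.2))
      ((x - y) * τ) := by
  have h1 : HasSum (fun p : ℤ × G => x * (f (p.1 + 1) p.2 * (x ^ (-(p.1 + 1) - 1) * χ p.2)))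
      (x * τ) :=
    (((Equiv.addRight (1 : ℤ)).prodCongr (Equiv.refl G)).hasSum_iff.2 h).mul_left x
  have h2 : HasSum (fun p : ℤ × G => y * (f p.1 (p.2 + d) * (x ^ (-p.1 - 1) * χ (p.2 + d))))
      (y * τ) :=
    (((Equiv.refl ℤ).prodCongr (Equiv.addRight d)).hasSum_iff.2 h).mul_left y
  rw [sub_mul]
  refine (h1.sub h2).congr_fun fun p => ?_
  have hxpow : x ^ (-p.1 - 1) = x ^ (-(p.1 + 1) - 1) * x := by
    rw [← zpow_add_one₀ hx]
    congr 1
    ring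
  rw [shiftDiff_apply, hxpow]
  linear_combination -f p.1 (p.2 + d) * x ^ (-(p.1 + 1) - 1) * x * hχ p.2

theorem hasSum_shiftDiff_pow {d : G} {x y : ℂ} (hx : x ≠ 0) {χ : G → ℂ}
    (hχ : ∀ e, χ e = y * χ (e + d)) {f : ℤ → G → ℂ} {τ : ℂ}
    (h : HasSum (fun p : ℤ × G => f p.1 p.2 * (x ^ (-p.1 - 1) * χ p.2)) τ) (n : ℕ) :
    HasSum (fun p : ℤ × G => ((shiftDiff d ^ n) f) p.1 p.2 *
      (x ^ (-p.1 - 1) * χ p.2)) ((x - y) ^ n * τ) := by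
  induction n with
  | zero => simpa using h
  | succ n ih =>
    rw [pow_succ' (shiftDiff d), Module.End.mul_apply, pow_succ', mul_assoc]
    exact hasSum_shiftDiff hx hχ ih

theorem eq_pow_mul_of_eq_mul {d : G} {y : ℂ} {χ : G → ℂ} (hχ : ∀ e, χ e = y * χ (e + d)) (l : ℕ)
    (e : G) : χ e = y ^ l * χ (e + l • d) := by
  induction l with
  | zero => simp
  | succ l ih => rw [ih, hχ (e + l • d), succ_nsmul, add_assoc, pow_succ, mul_assoc]

/-- The shear `((a, e), l) ↦ ((a - 1 - l, e + l d), l)`, along which the product of a series with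
the expansion of `1 / (x - y)` in powers of `y / x` is collected. -/
def shearEquiv (d : G) : (ℤ × G) × ℕ ≃ (ℤ × G) × ℕ where
  toFun q := ((q.1.1 - 1 - q.2, q.1.2 + q.2 • d), q.2)
  invFun q := ((q.1.1 + 1 + q.2, q.1.2 - q.2 • d), q.2)
  left_inv q := Prod.ext (Prod.ext (by dsimp only; ring) (add_sub_cancel_right _ _)) rfl
  right_inv q := Prod.ext (Prod.ext (by dsimp only; ring) (sub_add_cancel _ _)) rfl

theorem hasSum_mul_comp_shearEquiv (d : G) {g : ℤ × G → ℂ} {r : ℕ → ℂ} {τ ρ : ℂ}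
    (hg : HasSum g τ) (hr : HasSum r ρ) :
    HasSum (fun q : (ℤ × G) × ℕ => g (q.1.1 - 1 - q.2, q.1.2 + q.2 • d) * r q.2) (τ * ρ) :=
  (shearEquiv d).hasSum_iff.2
    (hg.mul hr (summable_mul_of_summable_norm hg.summable.norm hr.summable.norm))

theorem hasSum_inv_mul_div_pow {x y : ℂ} (hxy : ‖y‖ < ‖x‖) :
    HasSum (fun l : ℕ => x⁻¹ * (y / x) ^ l) (1 / (x - y)) := by
  have hx : x ≠ 0 := norm_pos_iff.1 ((norm_nonneg y).trans_lt hxy)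
  have hq : ‖y / x‖ < 1 := by rwa [norm_div, div_lt_one (norm_pos_iff.2 hx)]
  have h := (hasSum_geometric_of_norm_lt_one hq).mul_left x⁻¹
  rwa [← mul_inv, mul_sub, mul_one, mul_div_cancel₀ y hx, inv_eq_one_div (x - y)] at h

/-- Multiply the convergent product by the geometric series of `1 / (x - y)`: truncation in `x`
makes the coefficients of the result telescope. -/
theorem hasSum_of_shiftDiff {d : G} {x y : ℂ} (hy : y ≠ 0) (hxy : ‖y‖ < ‖x‖) {χ : G → ℂ}
    (hχ : ∀ e, χ e = y * χ (e + d)) {f : ℤ → G → ℂ} {lo : ℤ} (hf : ∀ a < lo, ∀ e, f a e = 0)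
    {τ : ℂ}
    (h : HasSum (fun p : ℤ × G => shiftDiff d f p.1 p.2 * (x ^ (-p.1 - 1) * χ p.2)) τ) :
    HasSum (fun p : ℤ × G => f p.1 p.2 * (x ^ (-p.1 - 1) * χ p.2)) (τ / (x - y)) := by
  have hx : x ≠ 0 := norm_pos_iff.1 ((norm_nonneg y).trans_lt hxy)
  set g : ℤ × G → ℂ := fun p => shiftDiff d f p.1 p.2 * (x ^ (-p.1 - 1) * χ p.2) with hg
  have hterm : ∀ (p : ℤ × G) (l : ℕ), g (p.1 - 1 - l, p.2 + l • d) * (x⁻¹ * (y / x) ^ l) =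
      shiftDiff d f (p.1 - 1 - l) (p.2 + l • d) * (x ^ (-p.1 - 1) * χ p.2) := by
    intro p l
    simp only [hg]
    rw [eq_pow_mul_of_eq_mul hχ l p.2, div_pow,
      show -(p.1 - 1 - (l : ℤ)) - 1 = (-p.1 - 1) + 1 + l by ring, zpow_add₀ hx, zpow_add_one₀ hx,
      zpow_natCast]
    field_simp
  rw [div_eq_mul_one_div]
  refine (hasSum_mul_comp_shearEquiv d h (hasSum_inv_mul_div_pow hxy)).prod_fiberwise fun p => ?_
  exact ((hasSum_shiftDiff_diagonal d hf p.1 p.2).mul_right _).congr_fun fun l => hterm p l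

end Formal

/-! ## Laurent series: uniqueness of coefficients and order of the pole -/

theorem eq_zero_of_hasSum_smul_of_orthonormal {ι E : Type*} [NormedAddCommGroup E]
    [InnerProductSpace ℂ E] {v : ι → E} (hv : Orthonormal ℂ v) {c : ι → ℂ}
    (h : HasSum (fun i => c i • v i) 0) : c = 0 := by
  classical
  funext j
  have hinner := (innerSL ℂ (v j)).hasSum h
  simp only [map_smul, innerSL_apply_apply, map_zero, smul_eq_mul] at hinner
  refine (hasSum_ite_eq j (c j)).unique (hinner.congr_fun fun i => ?_)
  rw [orthonormal_iff_ite.1 hv j i]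
  aesop

theorem eq_zero_of_hasSum_mul_fourier {ι : Type*} {e : ι → ℤ} (he : Function.Injective e)
    {c : ι → ℂ} (h : ∀ t : UnitAddCircle, HasSum (fun i => c i * fourier (e i) t) 0) : c = 0 := by
  have hc : Summable fun i => c i • (fourier (e i) : C(UnitAddCircle, ℂ)) :=
    Summable.of_norm (by simpa [norm_smul, fourier_norm] using (h 0).summable.norm)
  have hsum : HasSum (fun i => c i • (fourier (e i) : C(UnitAddCircle, ℂ))) 0 := by
    convert hc.hasSum
    ext t
    exact (h t).unique ((ContinuousMap.evalCLM ℂ t).hasSum hc.hasSum)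
  refine eq_zero_of_hasSum_smul_of_orthonormal
    ((orthonormal_fourier (T := (1 : ℝ))).comp e he) ?_
  simpa [Function.comp_def] using
    (ContinuousMap.toLp 2 AddCircle.haarAddCircle ℂ : C(UnitAddCircle, ℂ) →L[ℂ] _).hasSum hsum

theorem coeff_eq_zero_of_hasSum_zpow {ι : Type*} {e : ι → ℤ} (he : Function.Injective e)
    {c : ι → ℂ} {r : ℝ} (hr : 0 < r)
    (h : ∀ s : ℂ, ‖s‖ = r → HasSum (fun i => c i * s ^ e i) 0) : c = 0 := by
  have hr' : (r : ℂ) ≠ 0 := by exact_mod_cast hr.ne'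
  have hzero : (fun i => c i * (r : ℂ) ^ e i) = 0 := by
    refine eq_zero_of_hasSum_mul_fourier he fun t => ?_
    have ht : ‖(r : ℂ) * AddCircle.toCircle t‖ = r := by
      rw [norm_mul, Circle.norm_coe, mul_one, Complex.norm_real, Real.norm_of_nonneg hr.le]
    refine (h _ ht).congr_fun fun i => ?_
    rw [fourier_apply, AddCircle.toCircle_zsmul, Circle.coe_zpow, mul_zpow, mul_assoc]
  funext i
  exact (mul_eq_zero.1 (congrFun hzero i)).resolve_right (zpow_ne_zero _ hr')

theorem coeff_eq_zero_of_hasSum_zpow_mul_zpow {ι κ : Type*} {d : ι → ℤ} {e : κ → ℤ}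
    (hd : Function.Injective d) (he : Function.Injective e) {c : ι → κ → ℂ} {r s : ℝ} (hr : 0 < r)
    (hs : 0 < s) (h : ∀ x y : ℂ, ‖x‖ = r → ‖y‖ = s →
      HasSum (fun p : ι × κ => c p.1 p.2 * (x ^ d p.1 * y ^ e p.2)) 0) : c = 0 := by
  have hr' : (r : ℂ) ≠ 0 := by exact_mod_cast hr.ne'
  have hrow : ∀ y : ℂ, ‖y‖ = s → ∀ i, Summable fun j => c i j * y ^ e j := by
    intro y hy i
    refine (((h r y (by simp [abs_of_pos hr]) hy).summable.prod_factor i).mul_left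
      ((r : ℂ) ^ d i)⁻¹).congr fun j => ?_
    have := zpow_ne_zero (d i) hr'
    field_simp
  have hrow_zero : ∀ y : ℂ, ‖y‖ = s → (fun i => ∑' j, c i j * y ^ e j) = 0 := fun y hy =>
    coeff_eq_zero_of_hasSum_zpow hd hr fun x hx =>
      (h x y hx hy).prod_fiberwise fun i =>
        ((hrow y hy i).hasSum.mul_right (x ^ d i)).congr_fun fun j => by ring
  funext i
  refine coeff_eq_zero_of_hasSum_zpow he hs fun y hy => ?_
  rw [show (0 : ℂ) = _ from (congrFun (hrow_zero y hy) i).symm]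
  exact (hrow y hy i).hasSum

open Filter Topology in
theorem tendsto_zero_of_hasSum_zpow {ι : Type*} {c : ι → ℂ} {e : ι → ℤ}
    (he : ∀ i, c i ≠ 0 → 0 < e i) {F : ℂ → ℂ}
    (h : ∀ᶠ s in 𝓝[≠] 0, HasSum (fun i => c i * s ^ e i) (F s)) : Tendsto F (𝓝[≠] 0) (𝓝 0) := by
  obtain ⟨s₀, hs₀, hsum⟩ := (h.and self_mem_nhdsWithin).exists
  have hs₀' : ∀ᶠ s : ℂ in 𝓝[≠] 0, ‖s‖ < ‖s₀‖ := by
    filter_upwards [nhdsWithin_le_nhds (Metric.ball_mem_nhds (0 : ℂ) (norm_pos_iff.2 hsum))]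
      with s hs
    simpa using hs
  have hterm : ∀ i, Tendsto (fun s => c i * s ^ e i) (𝓝[≠] 0) (𝓝 0) := by
    intro i
    by_cases hc : c i = 0
    · simp [hc]
    · obtain ⟨n, hn⟩ := Int.eq_ofNat_of_zero_le (he i hc).le
      have hn0 : n ≠ 0 := by have := he i hc; lia
      rw [hn]
      refine Tendsto.mono_left ?_ nhdsWithin_le_nhds
      simpa [hn0] using (by fun_prop : Continuous fun s : ℂ => c i * s ^ n).tendsto 0
  have hbound : ∀ᶠ s in 𝓝[≠] 0, ∀ i, ‖c i * s ^ e i‖ ≤ ‖c i * s₀ ^ e i‖ := by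
    filter_upwards [hs₀'] with s hs i
    by_cases hc : c i = 0
    · simp [hc]
    · obtain ⟨n, hn⟩ := Int.eq_ofNat_of_zero_le (he i hc).le
      rw [hn, zpow_natCast, zpow_natCast, norm_mul, norm_mul, norm_pow,
        norm_pow]
      gcongr
  have := tendsto_tsum_of_dominated_convergence hs₀.summable.norm hterm hbound
  rw [tsum_zero] at this
  exact this.congr' (h.mono fun s hs => hs.tsum_eq)

/-! ## Order of the pole on the diagonal -/

theorem X_zero_sub_X_succ_dvd {R : Type*} [CommRing R] [IsDomain R] {S : Set R} (hS : S.Infinite)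
    {n : ℕ} {i : Fin n} {P : MvPolynomial (Fin (n + 1)) R}
    (h : ∀ s : Fin n → R, (∀ j, s j ∈ S) → MvPolynomial.eval (Fin.cons (s i) s) P = 0) :
    (MvPolynomial.X 0 - MvPolynomial.X i.succ : MvPolynomial (Fin (n + 1)) R) ∣ P := by
  rw [← map_dvd_iff (MvPolynomial.finSuccEquiv R n), map_sub, MvPolynomial.finSuccEquiv_X_zero,
    MvPolynomial.finSuccEquiv_X_succ, Polynomial.dvd_iff_isRoot]
  refine MvPolynomial.funext_set (fun _ => S) (fun _ => hS) fun s hs => ?_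
  rw [map_zero, ← h s fun j => hs j (Set.mem_univ j), MvPolynomial.eval_eq_eval_mv_eval',
    Polynomial.eval_map, ← Polynomial.eval₂_hom, MvPolynomial.eval_X]

open Filter Topology in
theorem eval_diagonal_eq_zero {P : MvPolynomial (Fin 2) ℂ} {k l N : ℕ} (hl : N < l)
    {c : ℤ × ℤ → ℂ} (hc : ∀ n : ℤ × ℤ, (N : ℤ) ≤ n.1 → c n = 0)
    (h : ∀ x y : ℂ, 0 < ‖x - y‖ → ‖x - y‖ < ‖y‖ →
      HasSum (fun n : ℤ × ℤ => c n * (x - y) ^ (-n.1 - 1) * y ^ (-n.2 - 1))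
        (MvPolynomial.eval ![x, y] P / ((x * y) ^ k * (x - y) ^ l)))
    {y : ℂ} (hy : y ≠ 0) : MvPolynomial.eval ![y, y] P = 0 := by
  set F : ℂ → ℂ := fun t => MvPolynomial.eval ![y + t, y] P / ((y + t) * y) ^ k with hF
  have hzero : Tendsto F (𝓝[≠] 0) (𝓝 0) := by
    refine tendsto_zero_of_hasSum_zpow (c := fun n : ℤ × ℤ => c n * y ^ (-n.2 - 1))
      (e := fun n => l - n.1 - 1) (fun n hn => ?_) ?_
    · by_contra hle
      exact hn (by rw [hc n (by lia), zero_mul])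
    · filter_upwards [self_mem_nhdsWithin,
        nhdsWithin_le_nhds (Metric.ball_mem_nhds (0 : ℂ) (norm_pos_iff.2 hy))] with t ht hty
      have ht : t ≠ 0 := ht
      have hsum := (h (y + t) y (by simpa using ht) (by simpa using hty)).mul_left (t ^ l)
      rw [add_sub_cancel_left, ← mul_div_assoc, mul_comm (t ^ l),
        mul_div_mul_right _ _ (pow_ne_zero l ht)] at hsum
      refine hsum.congr_fun fun n => ?_
      rw [show (l : ℤ) - n.1 - 1 = l + (-n.1 - 1) by ring, zpow_add₀ ht, zpow_natCast]
      ring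
  have hcont : ContinuousAt F 0 := by
    refine ContinuousAt.div ?_ (by fun_prop) (by simp [hy])
    refine (MvPolynomial.continuous_eval P).continuousAt.comp (continuousAt_pi.2 fun i => ?_)
    fin_cases i <;> dsimp <;> fun_prop
  have hF0 : F 0 = 0 := tendsto_nhds_unique (hcont.tendsto.mono_left nhdsWithin_le_nhds) hzero
  simpa [hF, hy] using hF0

theorem X_zero_sub_X_one_pow_dvd {P : MvPolynomial (Fin 2) ℂ} {k N : ℕ} {c : ℤ × ℤ → ℂ}
    (hc : ∀ n : ℤ × ℤ, (N : ℤ) ≤ n.1 → c n = 0) (d : ℕ)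
    (h : ∀ x y : ℂ, 0 < ‖x - y‖ → ‖x - y‖ < ‖y‖ →
      HasSum (fun n : ℤ × ℤ => c n * (x - y) ^ (-n.1 - 1) * y ^ (-n.2 - 1))
        (MvPolynomial.eval ![x, y] P / ((x * y) ^ k * (x - y) ^ (N + d)))) :
    (MvPolynomial.X 0 - MvPolynomial.X 1 : MvPolynomial (Fin 2) ℂ) ^ d ∣ P := by
  induction d generalizing P with
  | zero => exact one_dvd P
  | succ d ih =>
    obtain ⟨Q, rfl⟩ : (MvPolynomial.X 0 - MvPolynomial.X (Fin.succ 0)) ∣ P :=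
      X_zero_sub_X_succ_dvd (Set.finite_singleton (0 : ℂ)).infinite_compl fun s hs => by
        rw [show (Fin.cons (s 0) s : Fin 2 → ℂ) = ![s 0, s 0] by ext i; fin_cases i <;> rfl]
        exact eval_diagonal_eq_zero (by lia) hc h (hs 0)
    rw [pow_succ']
    refine mul_dvd_mul_left _ (ih fun x y hxy hlt => ?_)
    have hsum := h x y hxy hlt
    rwa [map_mul, map_sub, MvPolynomial.eval_X, MvPolynomial.eval_X, ← add_assoc, pow_succ',
      mul_left_comm ((x * y) ^ k), Matrix.cons_val_zero, Fin.succ_zero_eq_one,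
      Matrix.cons_val_one, Matrix.cons_val_zero, mul_div_mul_left _ _ (norm_pos_iff.1 hxy)]
      at hsum

theorem exists_pow_mul_eq_div {P : MvPolynomial (Fin 2) ℂ} {k N : ℕ} {c : ℤ × ℤ → ℂ}
    (hc : ∀ n : ℤ × ℤ, (N : ℤ) ≤ n.1 → c n = 0)
    (h : ∀ x y : ℂ, 0 < ‖x - y‖ → ‖x - y‖ < ‖y‖ →
      HasSum (fun n : ℤ × ℤ => c n * (x - y) ^ (-n.1 - 1) * y ^ (-n.2 - 1))
        (MvPolynomial.eval ![x, y] P / (x * y * (x - y)) ^ k)) :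
    ∃ Q : MvPolynomial (Fin 2) ℂ, ∀ x y : ℂ, x ≠ y →
      (x - y) ^ N * (MvPolynomial.eval ![x, y] P / (x * y * (x - y)) ^ k) =
        MvPolynomial.eval ![x, y] Q / (x * y) ^ k := by
  simp only [mul_pow _ (_ - _)] at h ⊢
  rcases le_total k N with hk | hk
  · obtain ⟨d, rfl⟩ := Nat.exists_eq_add_of_le hk
    refine ⟨(MvPolynomial.X 0 - MvPolynomial.X 1) ^ d * P, fun x y hxy => ?_⟩
    have hxy' := sub_ne_zero.2 hxy
    simp only [map_mul, map_pow, map_sub, MvPolynomial.eval_X, Matrix.cons_val_zero,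
      Matrix.cons_val_one]
    rw [pow_add, ← mul_div_assoc, mul_assoc, mul_comm (_ ^ k), mul_div_mul_right _ _
      (pow_ne_zero k hxy')]
  · obtain ⟨d, rfl⟩ := Nat.exists_eq_add_of_le hk
    obtain ⟨Q, rfl⟩ := X_zero_sub_X_one_pow_dvd hc d h
    refine ⟨Q, fun x y hxy => ?_⟩
    have hxy' := sub_ne_zero.2 hxy
    simp only [map_mul, map_pow, map_sub, MvPolynomial.eval_X, Matrix.cons_val_zero,
      Matrix.cons_val_one]
    rw [← mul_div_assoc, ← mul_assoc, ← pow_add, mul_comm _ (MvPolynomial.eval _ Q),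
      mul_div_mul_right _ _ (pow_ne_zero _ hxy')]

theorem exists_laurent_coeff (P : MvPolynomial (Fin 2) ℂ) (k : ℕ) :
    ∃ g : ℤ → ℤ → ℂ, ∀ x y : ℂ, x ≠ 0 → y ≠ 0 →
      HasSum (fun p : ℤ × ℤ => g p.1 p.2 * (x ^ (-p.1 - 1) * y ^ (-p.2 - 1)))
        (MvPolynomial.eval ![x, y] P / (x * y) ^ k) := by
  induction P using MvPolynomial.induction_on' with
  | monomial u a =>
    refine ⟨fun i j => if i = k - 1 - u 0 ∧ j = k - 1 - u 1 then a else 0, fun x y hx hy => ?_⟩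
    have hpow : ∀ s : ℂ, s ≠ 0 → ∀ n : ℕ, s ^ (-((k : ℤ) - 1 - n) - 1) = s ^ n / s ^ k := by
      intro s hs n
      rw [show -((k : ℤ) - 1 - n) - 1 = n - k by ring, zpow_sub₀ hs, zpow_natCast, zpow_natCast]
    convert hasSum_single ((k : ℤ) - 1 - u 0, (k : ℤ) - 1 - u 1) fun p hp => ?_ using 1
    · simp only [and_self, if_true]
      rw [hpow x hx, hpow y hy, MvPolynomial.eval_monomial, Finsupp.prod_fintype _ _ (by simp),
        Fin.prod_univ_two, Matrix.cons_val_zero, Matrix.cons_val_one, Matrix.cons_val_zero,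
        mul_pow, div_mul_div_comm, mul_div_assoc]
    · exact mul_eq_zero_of_left (if_neg fun h => hp (Prod.ext h.1 h.2)) _
  | add p q hp hq =>
    obtain ⟨g, hg⟩ := hp
    obtain ⟨g', hg'⟩ := hq
    refine ⟨g + g', fun x y hx hy => ?_⟩
    rw [map_add, add_div]
    refine ((hg x y hx hy).add (hg' x y hx hy)).congr_fun fun p => ?_
    rw [Pi.add_apply, Pi.add_apply, add_mul]

theorem shiftDiff_one_pow_eq_of_hasSum {f g : ℤ → ℤ → ℂ} {N : ℕ} {F : ℂ → ℂ → ℂ} {r s : ℝ}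
    (hr : 0 < r) (hs : 0 < s)
    (hf : ∀ x y : ℂ, ‖x‖ = r → ‖y‖ = s →
      HasSum (fun p : ℤ × ℤ => f p.1 p.2 * (x ^ (-p.1 - 1) * y ^ (-p.2 - 1))) (F x y))
    (hg : ∀ x y : ℂ, ‖x‖ = r → ‖y‖ = s →
      HasSum (fun p : ℤ × ℤ => g p.1 p.2 * (x ^ (-p.1 - 1) * y ^ (-p.2 - 1)))
        ((x - y) ^ N * F x y)) :
    (shiftDiff (1 : ℤ) ^ N) f = g := by
  have hinj : Function.Injective fun a : ℤ => -a - 1 := fun a b h => by simpa using h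
  refine sub_eq_zero.1 (coeff_eq_zero_of_hasSum_zpow_mul_zpow hinj hinj hr hs fun x y hx hy => ?_)
  have hx0 : x ≠ 0 := norm_pos_iff.1 (hx ▸ hr)
  have hy0 : y ≠ 0 := norm_pos_iff.1 (hy ▸ hs)
  have hχ : ∀ e : ℤ, y ^ (-e - 1) = y * y ^ (-(e + 1) - 1) := fun e => by
    rw [← zpow_one_add₀ hy0]
    congr 1
    ring
  have h := (hasSum_shiftDiff_pow hx0 (χ := fun e : ℤ => y ^ (-e - 1)) hχ (hf x y hx hy) N).sub
    (hg x y hx hy)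
  rw [sub_self] at h
  exact h.congr_fun fun p => sub_mul _ _ _

/-! ## Weights -/

variable {V W : Type*} [AddCommGroup V] [Module ℂ V] [AddCommGroup W] [Module ℂ W]

theorem mode_add (Y : V →ₗ[ℂ] VertexOperator ℂ W) (u v : V) (n : ℤ) :
    mode Y (u + v) n = mode Y u n + mode Y v n := by
  simp [mode]

theorem mode_smul (Y : V →ₗ[ℂ] VertexOperator ℂ W) (c : ℂ) (v : V) (n : ℤ) :
    mode Y (c • v) n = c • mode Y v n := by
  simp [mode]

theorem mode_zero (Y : V →ₗ[ℂ] VertexOperator ℂ W) (n : ℤ) : mode Y 0 n = 0 := by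
  simp [mode]

/-- A bound for the modes of `Y(u, z)` that do not annihilate `x`. -/
def truncOrder (Y : V →ₗ[ℂ] VertexOperator ℂ W) (u : V) (x : W) : ℕ :=
  (-((HahnModule.of ℂ).symm (Y u x)).order).toNat

theorem mode_eq_zero_of_truncOrder_le (Y : V →ₗ[ℂ] VertexOperator ℂ W) (u : V) (x : W) {n : ℤ}
    (hn : (truncOrder Y u x : ℤ) ≤ n) : mode Y u n x = 0 := by
  refine VertexOperator.ncoeff_eq_zero_of_lt_order _ _ _ ?_
  have := Int.self_le_toNat (-((HahnModule.of ℂ).symm (Y u x)).order)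
  unfold truncOrder at hn
  lia

theorem mode_mem_maxGenEigenspace {Y : V →ₗ[ℂ] VertexOperator ℂ W} {LV : Module.End ℂ V}
    {LW : Module.End ℂ W}
    (hL : ∀ (u : V) (w : W) (n : ℤ),
      LW (mode Y u n w) - mode Y u n (LW w) = mode Y (LV u) n w + (-(n : ℂ) - 1) • mode Y u n w)
    {a α : ℂ} {u : V} (hu : LV u = a • u) {x : W} (hx : x ∈ LW.maxGenEigenspace α) (n : ℤ) :
    mode Y u n x ∈ LW.maxGenEigenspace (α + a - n - 1) := by
  rw [Module.End.mem_maxGenEigenspace] at hx ⊢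
  obtain ⟨k, hk⟩ := hx
  refine ⟨k, ?_⟩
  have h1 : ∀ y, (LW - (α + a - n - 1) • (1 : Module.End ℂ W)) (mode Y u n y) =
      mode Y u n ((LW - α • (1 : Module.End ℂ W)) y) := by
    intro y
    have := hL u y n
    rw [hu, mode_smul, LinearMap.smul_apply, sub_eq_iff_eq_add] at this
    simp only [LinearMap.sub_apply, LinearMap.smul_apply, Module.End.one_apply, map_sub, map_smul]
    rw [this]
    module
  have h2 : ∀ (j : ℕ) y, ((LW - (α + a - n - 1) • (1 : Module.End ℂ W)) ^ j) (mode Y u n y) =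
      mode Y u n (((LW - α • (1 : Module.End ℂ W)) ^ j) y) := by
    intro j
    induction j with
    | zero => simp
    | succ j ih =>
      intro y
      rw [pow_succ, pow_succ, Module.End.mul_apply, Module.End.mul_apply, h1, ih]
  rw [h2, hk, map_zero]

open GradingRestrictedVertexAlgebra

namespace GradingRestrictedVertexAlgebra

variable (A : GradingRestrictedVertexAlgebra V)

theorem induction_homogeneous {motive : V → Prop} (v : V)
    (hom : ∀ (n : ℤ), ∀ u ∈ A.gr n, motive u)
    (add : ∀ u u', motive u → motive u' → motive (u + u')) : motive v := by
  have hv : v ∈ ⨆ n, A.gr n := by rw [A.internal.submodule_iSup_eq_top]; trivial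
  exact Submodule.iSup_induction A.gr (motive := motive) hv hom (hom 0 0 (zero_mem _)) add

theorem L0_one : A.L0 A.one = 0 := by
  have h := A.L0_bracket A.one A.one (-1)
  rw [A.creation_limit, A.identity, if_pos rfl, A.creation_limit] at h
  simpa using h.symm

theorem gr_complex_eq (α : ℂ) :
    ⨆ (n : ℤ) (_ : (n : ℂ) = α), A.gr n = A.L0.maxGenEigenspace α := by
  refine congrFun (((Module.End.independent_maxGenEigenspace A.L0).le_iff_eq_of_iSup_eq_top
    (f := fun α : ℂ => ⨆ (n : ℤ) (_ : (n : ℂ) = α), A.gr n) ?_).1 fun α => ?_) α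
  · rw [eq_top_iff, ← A.internal.submodule_iSup_eq_top]
    exact iSup_le fun n => le_iSup_of_le (n : ℂ) (le_iSup₂_of_le n rfl le_rfl)
  · refine iSup₂_le fun n hn v hv => ?_
    rw [Module.End.mem_maxGenEigenspace]
    refine ⟨1, ?_⟩
    rw [pow_one, LinearMap.sub_apply, A.L0_apply n v hv]
    simp [hn]

theorem gr_le_maxGenEigenspace (n : ℤ) : A.gr n ≤ A.L0.maxGenEigenspace n := by
  rw [← A.gr_complex_eq]
  exact le_iSup₂_of_le n rfl le_rfl

theorem isInternal_maxGenEigenspace :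
    DirectSum.IsInternal fun α : ℂ => A.L0.maxGenEigenspace α := by
  refine DirectSum.isInternal_submodule_of_iSupIndep_of_iSup_eq_top
    (Module.End.independent_maxGenEigenspace _) ?_
  rw [eq_top_iff, ← A.internal.submodule_iSup_eq_top]
  exact iSup_le fun n => le_iSup_of_le (n : ℂ) (A.gr_le_maxGenEigenspace n)

theorem exists_maxGenEigenspace_eq_bot :
    ∃ N : ℝ, ∀ α : ℂ, α.re < N → A.L0.maxGenEigenspace α = ⊥ := by
  obtain ⟨N, hN⟩ := A.bounded_below
  refine ⟨N, fun α hα => ?_⟩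
  rw [← A.gr_complex_eq, eq_bot_iff]
  refine iSup₂_le fun n hn => ?_
  rw [hN n]
  rw [← hn, Complex.intCast_re] at hα
  exact_mod_cast hα

theorem mem_restrictedDual_complex_iff (f : Module.Dual ℂ V) :
    f ∈ restrictedDual (fun α => A.L0.maxGenEigenspace α) ↔ f ∈ restrictedDual A.gr := by
  constructor
  · intro h
    refine Set.Finite.subset (h.preimage Int.cast_injective.injOn) ?_
    rintro n ⟨v, hv, hf⟩
    exact ⟨v, A.gr_le_maxGenEigenspace n hv, hf⟩
  · intro h
    refine Set.Finite.subset (h.image ((↑) : ℤ → ℂ)) ?_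
    rintro α ⟨v, hv, hf⟩
    by_contra hα
    refine hf ?_
    have hle : ⨆ (n : ℤ) (_ : (n : ℂ) = α), A.gr n ≤ LinearMap.ker f := by
      refine iSup₂_le fun n hn u hu => ?_
      by_contra hne
      exact hα ⟨n, ⟨u, hu, hne⟩, hn⟩
    rw [A.gr_complex_eq] at hle
    exact hle hv

/-- The operator `L(-1)` as a linear map. -/
def Lm1End : Module.End ℂ V where
  toFun := A.Lm1
  map_add' u v := by simp [Lm1, mode_add]
  map_smul' c v := by simp [Lm1, mode_smul]

theorem Lm1_mem_maxGenEigenspace {α : ℂ} {v : V} (hv : v ∈ A.L0.maxGenEigenspace α) :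
    A.Lm1 v ∈ A.L0.maxGenEigenspace (α + 1) := by
  have hone : A.one ∈ A.L0.maxGenEigenspace 0 := by
    rw [Module.End.mem_maxGenEigenspace]
    exact ⟨1, by simp [A.L0_one]⟩
  rw [← A.gr_complex_eq] at hv
  suffices hle : ⨆ (n : ℤ) (_ : (n : ℂ) = α), A.gr n ≤
      (A.L0.maxGenEigenspace (α + 1)).comap A.Lm1End from hle hv
  refine iSup₂_le fun n hn u hu => ?_
  have h := mode_mem_maxGenEigenspace A.L0_bracket (A.L0_apply n u hu) hone (-2)
  rwa [hn, show 0 + α - ((-2 : ℤ) : ℂ) - 1 = α + 1 by push_cast; ring] at h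

/-- The vertex algebra as a module over itself, graded by the generalized eigenspaces of `L(0)`,
so that the index set `ℤ` of the grading becomes `ℂ`. -/
def toModule : A.GeneralizedModule V where
  Y := A.Y
  L0 := A.L0
  Lm1 := A.Lm1End
  gr := fun α => A.L0.maxGenEigenspace α
  internal := A.isInternal_maxGenEigenspace
  bounded_below := A.exists_maxGenEigenspace_eq_bot
  identity := A.identity
  duality := fun u₁ u₂ w w' hw' =>
    A.duality u₁ u₂ w w' ((A.mem_restrictedDual_complex_iff w').1 hw')
  L0_bracket := A.L0_bracket
  L0_grading := fun _ _ hw => (Module.End.mem_maxGenEigenspace _ _ _).1 hw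
  Lm1_weight := fun _ _ => A.Lm1_mem_maxGenEigenspace
  derivative := A.derivative
  derivative_bracket := A.derivative_bracket

namespace GeneralizedModule

variable {A} (B : A.GeneralizedModule W)

theorem gr_eq_maxGenEigenspace (α : ℂ) : B.gr α = B.L0.maxGenEigenspace α :=
  congrFun (((Module.End.independent_maxGenEigenspace B.L0).le_iff_eq_of_iSup_eq_top
    B.internal.submodule_iSup_eq_top).1 fun α w hw =>
      (Module.End.mem_maxGenEigenspace _ _ _).2 (B.L0_grading α w hw)) α

theorem mode_mem_gr {n : ℤ} {u : V} (hu : u ∈ A.gr n) {α : ℂ} {x : W} (hx : x ∈ B.gr α) (k : ℤ) :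
    mode B.Y u k x ∈ B.gr (α + n - k - 1) := by
  rw [gr_eq_maxGenEigenspace] at hx ⊢
  exact mode_mem_maxGenEigenspace B.L0_bracket (A.L0_apply n u hu) hx k

theorem induction_homogeneous {motive : W → Prop} (w : W)
    (hom : ∀ (α : ℂ), ∀ x ∈ B.gr α, motive x)
    (add : ∀ x y, motive x → motive y → motive (x + y)) : motive w := by
  have hw : w ∈ ⨆ α, B.gr α := by rw [B.internal.submodule_iSup_eq_top]; trivial
  exact Submodule.iSup_induction B.gr (motive := motive) hw hom (hom 0 0 (zero_mem _)) add

theorem restrictedDual_comp_mode (v : V) (n : ℤ) {f : Module.Dual ℂ W}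
    (hf : f ∈ restrictedDual B.gr) : f ∘ₗ mode B.Y v n ∈ restrictedDual B.gr := by
  induction v using A.induction_homogeneous with
  | hom k u hu =>
    refine Set.Finite.subset (Set.Finite.image (s := {α | ∃ w ∈ B.gr α, f w ≠ 0})
      (fun β => β - k + n + 1) hf) ?_
    rintro α ⟨x, hx, hne⟩
    exact ⟨_, ⟨_, B.mode_mem_gr hu hx n, hne⟩, by ring⟩
  | add u u' hu hu' =>
    have : f ∘ₗ mode B.Y (u + u') n = f ∘ₗ mode B.Y u n + f ∘ₗ mode B.Y u' n := by
      ext x; simp [mode_add]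
    rw [this]
    exact add_mem hu hu'

theorem exists_forall_le_re : ∃ N : ℝ, ∀ α, ∀ x ∈ B.gr α, x ≠ 0 → N ≤ α.re := by
  obtain ⟨N, hN⟩ := B.bounded_below
  refine ⟨N, fun α x hx hne => not_lt.1 fun hlt => hne ?_⟩
  rwa [hN α hlt, Submodule.mem_bot] at hx

theorem exists_forall_re_le {f : Module.Dual ℂ W} (hf : f ∈ restrictedDual B.gr) :
    ∃ R : ℝ, ∀ α, ∀ x ∈ B.gr α, f x ≠ 0 → α.re ≤ R := by
  obtain ⟨R, hR⟩ := (hf.image Complex.re).bddAbove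
  exact ⟨R, fun α x hx hne => hR ⟨α, ⟨x, hx, hne⟩, rfl⟩⟩

theorem exists_dual_mode_eq_zero (v : V) {f : Module.Dual ℂ W} (hf : f ∈ restrictedDual B.gr) :
    ∃ lo : ℤ, ∀ n < lo, ∀ x, f (mode B.Y v n x) = 0 := by
  induction v using A.induction_homogeneous with
  | hom k u hu =>
    obtain ⟨N, hN⟩ := B.exists_forall_le_re
    obtain ⟨R, hR⟩ := B.exists_forall_re_le hf
    obtain ⟨lo, hlo⟩ := exists_int_lt (N + k - 1 - R)
    refine ⟨lo, fun n hn x => ?_⟩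
    induction x using B.induction_homogeneous with
    | hom α x hx =>
      by_contra hne
      have hx0 : x ≠ 0 := fun h0 => hne (by rw [h0, map_zero, map_zero])
      have hlow := hN α x hx hx0
      have hupp := hR _ _ (B.mode_mem_gr hu hx n) hne
      have hn' : (n : ℝ) < lo := by exact_mod_cast hn
      simp only [Complex.sub_re, Complex.add_re, Complex.intCast_re, Complex.one_re] at hupp
      linarith
    | add x y hx hy => rw [map_add, map_add, hx, hy, add_zero]
  | add u u' hu hu' =>
    obtain ⟨lo, h⟩ := hu
    obtain ⟨lo', h'⟩ := hu'
    refine ⟨min lo lo', fun n hn x => ?_⟩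
    rw [mode_add, LinearMap.add_apply, map_add, h n (by lia), h' n (by lia), add_zero]

theorem pow_Lm1_mem_gr {α : ℂ} {x : W} (hx : x ∈ B.gr α) (j : ℕ) :
    (B.Lm1 ^ j) x ∈ B.gr (α + j) := by
  induction j with
  | zero => simpa using hx
  | succ j ih =>
    rw [pow_succ', Module.End.mul_apply]
    have := B.Lm1_weight _ _ ih
    push_cast
    rwa [← add_assoc]

/-- The transpose of `L_W(-1)` on the restricted dual. -/
def dualLm1 : Module.End ℂ (restrictedDual B.gr) where
  toFun f := ⟨(f : Module.Dual ℂ W) ∘ₗ B.Lm1, by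
    refine Set.Finite.subset (f.2.image fun β => β - 1) ?_
    rintro α ⟨x, hx, hne⟩
    exact ⟨_, ⟨_, B.Lm1_weight α x hx, hne⟩, by ring⟩⟩
  map_add' f g := by ext; simp
  map_smul' c f := by ext; simp

theorem dualLm1_apply (f : restrictedDual B.gr) (x : W) :
    (B.dualLm1 f : Module.Dual ℂ W) x = (f : Module.Dual ℂ W) (B.Lm1 x) := rfl

theorem dualLm1_pow_apply (f : restrictedDual B.gr) (j : ℕ) (x : W) :
    ((B.dualLm1 ^ j) f : Module.Dual ℂ W) x = (f : Module.Dual ℂ W) ((B.Lm1 ^ j) x) := by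
  induction j generalizing x with
  | zero => simp
  | succ j ih =>
    rw [pow_succ', Module.End.mul_apply, dualLm1_apply, ih, pow_succ, Module.End.mul_apply]

/-- Applying `L_W(-1)` raises the weight, and a functional in `W'` sees only bounded weights. -/
theorem exists_dualLm1_pow_eq_zero (f : restrictedDual B.gr) : ∃ K : ℕ, (B.dualLm1 ^ K) f = 0 := by
  obtain ⟨N, hN⟩ := B.exists_forall_le_re
  obtain ⟨R, hR⟩ := B.exists_forall_re_le f.2
  obtain ⟨K, hK⟩ := exists_nat_gt (R - N)
  refine ⟨K, Subtype.ext (LinearMap.ext fun x => ?_)⟩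
  rw [dualLm1_pow_apply]
  induction x using B.induction_homogeneous with
  | hom α x hx =>
    by_contra hne
    have hx0 : x ≠ 0 := fun h0 => hne (by rw [h0, map_zero, map_zero]; rfl)
    have hlow := hN α x hx hx0
    have hupp := hR _ _ (B.pow_Lm1_mem_gr hx K) hne
    simp only [Complex.add_re, Complex.natCast_re] at hupp
    linarith
  | add x y hx hy => rw [map_add, map_add, hx, hy, ← map_add]

/-! ## Weak commutativity -/

theorem weak_commutativity (u₁ u₂ : V) (x : W) {f : Module.Dual ℂ W}
    (hf : f ∈ restrictedDual B.gr) :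
    (shiftDiff (1 : ℤ) ^ truncOrder A.Y u₁ u₂)
        (fun m n => f (mode B.Y u₁ m (mode B.Y u₂ n x))) =
      (shiftDiff (1 : ℤ) ^ truncOrder A.Y u₁ u₂)
        (fun m n => f (mode B.Y u₂ n (mode B.Y u₁ m x))) := by
  obtain ⟨P, k, hP⟩ := B.duality u₁ u₂ x f hf
  obtain ⟨Q, hQ⟩ := exists_pow_mul_eq_div (P := P) (k := k) (N := truncOrder A.Y u₁ u₂)
    (c := fun n : ℤ × ℤ => f (mode B.Y (mode A.Y u₁ n.1 u₂) n.2 x))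
    (fun n hn => by simp [mode_eq_zero_of_truncOrder_le A.Y u₁ u₂ hn, mode_zero])
    (fun z₁ z₂ => (hP z₁ z₂).2.2)
  obtain ⟨g, hg⟩ := exists_laurent_coeff Q k
  have hg' : ∀ z₁ z₂ : ℂ, z₁ ≠ 0 → z₂ ≠ 0 → z₁ ≠ z₂ →
      HasSum (fun p : ℤ × ℤ => g p.1 p.2 * (z₁ ^ (-p.1 - 1) * z₂ ^ (-p.2 - 1)))
        ((z₁ - z₂) ^ truncOrder A.Y u₁ u₂ *
          (MvPolynomial.eval ![z₁, z₂] P / (z₁ * z₂ * (z₁ - z₂)) ^ k)) := fun z₁ z₂ h₁ h₂ h => by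
    rw [hQ z₁ z₂ h]
    exact hg z₁ z₂ h₁ h₂
  have hne : ∀ {r : ℝ} {z : ℂ}, 0 < r → ‖z‖ = r → z ≠ 0 := fun hr hz => norm_pos_iff.1 (hz ▸ hr)
  have h₁₂ := shiftDiff_one_pow_eq_of_hasSum (g := g) two_pos one_pos
    (f := fun m n => f (mode B.Y u₁ m (mode B.Y u₂ n x)))
    (fun z₁ z₂ h₁ h₂ => by
      simpa only [mul_assoc] using (hP z₁ z₂).1 (by rw [h₂]; norm_num) (by rw [h₁, h₂]; norm_num))
    (fun z₁ z₂ h₁ h₂ => hg' z₁ z₂ (hne two_pos h₁) (hne one_pos h₂) fun h => by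
      rw [h, h₂] at h₁; norm_num at h₁)
  have h₂₁ := shiftDiff_one_pow_eq_of_hasSum (g := g) one_pos two_pos
    (f := fun m n => f (mode B.Y u₂ n (mode B.Y u₁ m x)))
    (fun z₁ z₂ h₁ h₂ => by
      simpa only [mul_assoc] using (hP z₁ z₂).2.1 (by rw [h₁]; norm_num) (by rw [h₁, h₂]; norm_num))
    (fun z₁ z₂ h₁ h₂ => hg' z₁ z₂ (hne one_pos h₁) (hne two_pos h₂) fun h => by
      rw [h, h₂] at h₁; norm_num at h₁)
  exact h₁₂.trans h₂₁.symm

end GeneralizedModule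

end GradingRestrictedVertexAlgebra

/-! ## Rationality of products of vertex operators -/

theorem hasSum_prod_of_ne_finset_zero {ι κ : Type*} {s : Finset ι} {f : ι × κ → ℂ} {g : ι → ℂ}
    (hf : ∀ a ∉ s, ∀ e, f (a, e) = 0) (hg : ∀ a ∈ s, HasSum (fun e => f (a, e)) (g a)) :
    HasSum f (∑ a ∈ s, g a) := by
  classical
  have hslice : ∀ a ∈ s, HasSum (fun p : ι × κ => if p.1 = a then f p else 0) (g a) := by
    intro a ha
    refine ((Prod.mk_right_injective a).hasSum_iff fun p hp =>
      if_neg fun h => hp ⟨p.2, by rw [← h]⟩).1 ?_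
    exact (hg a ha).congr_fun fun e => if_pos rfl
  refine (hasSum_sum hslice).congr_fun fun p => ?_
  rw [Finset.sum_ite_eq]
  split_ifs with hp
  · rfl
  · exact hf p.1 hp p.2

theorem hasSum_shiftDiff_slice {G : Type*} [AddCommGroup G] {d : G} {y : ℂ} {χ : G → ℂ}
    (hχ : ∀ e, χ e = y * χ (e + d)) {f : ℤ → G → ℂ} {a : ℤ} {σ τ : ℂ}
    (hσ : HasSum (fun e => f (a + 1) e * χ e) σ) (hτ : HasSum (fun e => f a e * χ e) τ) :
    HasSum (fun e => shiftDiff d f a e * χ e) (σ - y * τ) := by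
  refine (hσ.sub (((Equiv.addRight d).hasSum_iff.2 hτ).mul_left y)).congr_fun fun e => ?_
  simp only [Function.comp_apply, Equiv.coe_addRight]
  rw [shiftDiff_apply, sub_mul, hχ e]
  ring

section ShiftProd

variable {k : ℕ}

/-- Multiplication of a formal series by the product of the differences of the outer variable and
the variables with indices in a list. -/
def shiftProd (L : List (Fin k)) : Module.End ℂ (ℤ → (Fin k → ℤ) → ℂ) :=
  (L.map fun j => shiftDiff (Pi.single j (1 : ℤ))).prod

theorem shiftProd_commute (d : Fin k → ℤ) (L : List (Fin k)) :
    Commute (shiftDiff d) (shiftProd L) := by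
  refine Commute.list_prod_right _ _ fun x hx => ?_
  obtain ⟨j, -, rfl⟩ := List.mem_map.1 hx
  exact shiftDiff_commute _ _

theorem shiftProd_cons (j : Fin k) (L : List (Fin k)) (f : ℤ → (Fin k → ℤ) → ℂ) :
    shiftProd (j :: L) f = shiftProd L (shiftDiff (Pi.single j 1) f) := by
  have h := shiftProd_commute (Pi.single j 1) L
  rw [shiftProd, List.map_cons, List.prod_cons]
  exact LinearMap.congr_fun h f

theorem shiftProd_replicate_append (n : ℕ) (j : Fin k) (L : List (Fin k))
    (f : ℤ → (Fin k → ℤ) → ℂ) :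
    shiftProd (List.replicate n j ++ L) f = shiftProd L ((shiftDiff (Pi.single j 1) ^ n) f) := by
  induction n generalizing f with
  | zero => rfl
  | succ n ih =>
    rw [List.replicate_succ, List.cons_append, shiftProd_cons, ih, pow_succ, Module.End.mul_apply]

theorem cons_add_single_succ (b : ℤ) (e : Fin k → ℤ) (j : Fin k) :
    (Fin.cons b e : Fin (k + 1) → ℤ) + Pi.single j.succ 1 = Fin.cons b (e + Pi.single j 1) := by
  funext i
  refine Fin.cases ?_ (fun i => ?_) i
  · simp
  · simp [Pi.single_apply]

theorem cons_add_single_zero (b : ℤ) (e : Fin k → ℤ) :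
    (Fin.cons b e : Fin (k + 1) → ℤ) + Pi.single 0 1 = Fin.cons (b + 1) e := by
  funext i
  refine Fin.cases ?_ (fun i => ?_) i <;> simp

theorem shiftProd_map_succ (L : List (Fin k)) (f : ℤ → (Fin (k + 1) → ℤ) → ℂ) (a b : ℤ)
    (e : Fin k → ℤ) :
    shiftProd (L.map Fin.succ) f a (Fin.cons b e) =
      shiftProd L (fun a e => f a (Fin.cons b e)) a e := by
  induction L generalizing f with
  | nil => rfl
  | cons j L ih =>
    rw [List.map_cons, shiftProd_cons, shiftProd_cons, ih]
    have h : (fun a e => shiftDiff (Pi.single j.succ 1) f a (Fin.cons b e)) =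
        shiftDiff (Pi.single j 1) fun a e => f a (Fin.cons b e) := by
      funext a e
      rw [shiftDiff_apply, shiftDiff_apply, cons_add_single_succ]
    rw [h]

theorem shiftDiff_single_zero_pow (n : ℕ) (f : ℤ → (Fin (k + 1) → ℤ) → ℂ) (a b : ℤ)
    (e : Fin k → ℤ) :
    ((shiftDiff (Pi.single 0 1) ^ n) f) a (Fin.cons b e) =
      ((shiftDiff (1 : ℤ) ^ n) fun a b => f a (Fin.cons b e)) a b := by
  induction n generalizing f with
  | zero => rfl
  | succ n ih =>
    rw [pow_succ, pow_succ, Module.End.mul_apply, Module.End.mul_apply, ih]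
    have h : (fun a b => shiftDiff (Pi.single 0 1) f a (Fin.cons b e)) =
        shiftDiff (1 : ℤ) fun a b => f a (Fin.cons b e) := by
      funext a b
      rw [shiftDiff_apply, shiftDiff_apply, cons_add_single_zero]
    rw [h]

/-- The list in which the index `i` is repeated `N i` times. -/
def replicateIndices (N : Fin k → ℕ) : List (Fin k) :=
  (List.finRange k).flatMap fun i => List.replicate (N i) i

theorem replicateIndices_succ (N : Fin (k + 1) → ℕ) :
    replicateIndices N =
      List.replicate (N 0) 0 ++ (replicateIndices fun i => N i.succ).map Fin.succ := by
  simp [replicateIndices, List.finRange_succ, List.flatMap_map, List.map_flatMap]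

theorem prod_map_replicateIndices (N : Fin k → ℕ) (g : Fin k → ℂ) :
    ((replicateIndices N).map g).prod = ∏ i, g i ^ N i := by
  induction k with
  | zero => rfl
  | succ k ih =>
    rw [replicateIndices_succ, List.map_append, List.prod_append, List.map_replicate,
      List.prod_replicate, List.map_map, Fin.prod_univ_succ, ← ih _ fun i => g i.succ]
    rfl

theorem prod_zpow_eq_mul_prod_zpow_add_single {z : Fin k → ℂ} (hz : ∀ i, z i ≠ 0) (j : Fin k)
    (e : Fin k → ℤ) :
    ∏ i, z i ^ (-e i - 1) = z j * ∏ i, z i ^ (-(e + Pi.single j 1 : Fin k → ℤ) i - 1) := by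
  rw [Fintype.prod_eq_mul_prod_compl j, Fintype.prod_eq_mul_prod_compl j, ← mul_assoc]
  congr 1
  · rw [Pi.add_apply, Pi.single_eq_same, ← zpow_one_add₀ (hz j)]
    congr 1
    ring
  · refine Finset.prod_congr rfl fun i hi => ?_
    rw [Finset.mem_compl, Finset.mem_singleton] at hi
    rw [Pi.add_apply, Pi.single_eq_of_ne hi, add_zero]

theorem tail_mem_orderedRegion {z : Fin (k + 1) → ℂ} (hz : z ∈ orderedRegion (k + 1)) :
    (fun i : Fin k => z i.succ) ∈ orderedRegion k :=
  ⟨fun _ _ hij => hz.1 _ _ (Fin.succ_lt_succ_iff.2 hij), fun _ => hz.2 _⟩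

theorem exists_hasSum_of_bounded (q : (Fin k → ℂ) → ℂ) {f : ℤ → (Fin k → ℤ) → ℂ} {lo : ℤ}
    {M : ℕ} (hlo : ∀ a < lo, ∀ e, f a e = 0) (hhi : ∀ a, (M : ℤ) ≤ a → ∀ e, f a e = 0)
    (hs : ∀ a, ∃ P : MvPolynomial (Fin k) ℂ, ∀ z ∈ orderedRegion k,
      HasSum (fun e => f a e * ∏ i, z i ^ (-e i - 1)) (MvPolynomial.eval z P / q z)) :
    ∃ P : MvPolynomial (Fin (k + 1)) ℂ, ∀ z ∈ orderedRegion (k + 1),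
      HasSum (fun p : ℤ × (Fin k → ℤ) =>
          f p.1 p.2 * (z 0 ^ (-p.1 - 1) * ∏ i, z (Fin.succ i) ^ (-p.2 i - 1)))
        (MvPolynomial.eval z P / (z 0 ^ M * q fun i => z i.succ)) := by
  choose P hP using hs
  refine ⟨∑ a ∈ Finset.Ico lo (M : ℤ), MvPolynomial.X 0 ^ ((M : ℤ) - 1 - a).toNat *
    MvPolynomial.rename Fin.succ (P a), fun z hz => ?_⟩
  have hz0 : z 0 ≠ 0 := norm_pos_iff.1 (hz.2 0)
  rw [map_sum, Finset.sum_div]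
  refine hasSum_prod_of_ne_finset_zero (fun a ha e => ?_) fun a ha => ?_
  · rw [Finset.mem_Ico, not_and_or] at ha
    rcases ha with ha | ha
    · rw [hlo _ (by lia), zero_mul]
    · rw [hhi _ (by lia), zero_mul]
  · have hpow : z 0 ^ (-a - 1) = z 0 ^ ((M : ℤ) - 1 - a).toNat / z 0 ^ M := by
      rw [eq_div_iff (pow_ne_zero _ hz0), ← zpow_natCast, ← zpow_natCast, ← zpow_add₀ hz0,
        Int.toNat_of_nonneg (by have := (Finset.mem_Ico.1 ha).2; lia)]
      congr 1
      ring
    have hterm := (hP a _ (tail_mem_orderedRegion hz)).mul_left (z 0 ^ (-a - 1))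
    rw [map_mul, map_pow, MvPolynomial.eval_X, MvPolynomial.eval_rename, ← div_mul_div_comm, ← hpow]
    exact hterm.congr_fun fun e => mul_left_comm _ _ _

theorem exists_hasSum_of_shiftProd (L : List (Fin k)) (q : (Fin k → ℂ) → ℂ)
    {f : ℤ → (Fin k → ℤ) → ℂ} {lo : ℤ} {M : ℕ} (hlo : ∀ a < lo, ∀ e, f a e = 0)
    (hhi : ∀ a, (M : ℤ) ≤ a → ∀ e, shiftProd L f a e = 0)
    (hs : ∀ a, ∃ P : MvPolynomial (Fin k) ℂ, ∀ z ∈ orderedRegion k,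
      HasSum (fun e => f a e * ∏ i, z i ^ (-e i - 1)) (MvPolynomial.eval z P / q z)) :
    ∃ P : MvPolynomial (Fin (k + 1)) ℂ, ∀ z ∈ orderedRegion (k + 1),
      HasSum (fun p : ℤ × (Fin k → ℤ) =>
          f p.1 p.2 * (z 0 ^ (-p.1 - 1) * ∏ i, z (Fin.succ i) ^ (-p.2 i - 1)))
        (MvPolynomial.eval z P /
          ((L.map fun j => z 0 - z (Fin.succ j)).prod * (z 0 ^ M * q fun i => z i.succ))) := by
  induction L generalizing f lo with
  | nil => simpa using exists_hasSum_of_bounded q hlo hhi hs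
  | cons j L ih =>
    have hslice : ∀ a, ∃ P : MvPolynomial (Fin k) ℂ, ∀ z ∈ orderedRegion k,
        HasSum (fun e => shiftDiff (Pi.single j 1) f a e * ∏ i, z i ^ (-e i - 1))
          (MvPolynomial.eval z P / q z) := by
      intro a
      obtain ⟨P₁, h₁⟩ := hs (a + 1)
      obtain ⟨P₀, h₀⟩ := hs a
      refine ⟨P₁ - MvPolynomial.X j * P₀, fun z hz => ?_⟩
      rw [map_sub, map_mul, MvPolynomial.eval_X, sub_div, mul_div_assoc]
      exact hasSum_shiftDiff_slice (χ := fun e : Fin k → ℤ => ∏ i, z i ^ (-e i - 1))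
        (prod_zpow_eq_mul_prod_zpow_add_single (fun i => norm_pos_iff.1 (hz.2 i)) j)
        (h₁ z hz) (h₀ z hz)
    obtain ⟨P, hP⟩ := ih (f := shiftDiff (Pi.single j 1) f) (lo := lo - 1)
      (fun a ha e => by rw [shiftDiff_apply, hlo _ (by lia), hlo _ (by lia), sub_zero])
      (fun a ha e => by rw [← shiftProd_cons]; exact hhi a ha e) hslice
    refine ⟨P, fun z hz => ?_⟩
    have hz0 : ∀ i, z i ≠ 0 := fun i => norm_pos_iff.1 (hz.2 i)
    have hsum := hasSum_of_shiftDiff (hz0 j.succ) (hz.1 0 j.succ (Fin.succ_pos j))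
      (χ := fun e : Fin k → ℤ => ∏ i, z (Fin.succ i) ^ (-e i - 1))
      (prod_zpow_eq_mul_prod_zpow_add_single (z := fun i => z i.succ) (fun i => hz0 i.succ) j)
      hlo (hP z hz)
    rwa [div_div, mul_comm _ (z 0 - z j.succ), ← mul_assoc] at hsum

end ShiftProd

theorem poleDenominator_succ {V : Type*} {k : ℕ} (N : V → V → ℕ+) (v : Fin (k + 1) → V)
    (z : Fin (k + 1) → ℂ) :
    poleDenominator N v z = (∏ j : Fin k, (z 0 - z j.succ) ^ (N (v 0) (v j.succ) : ℕ)) *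
      poleDenominator N (fun i => v i.succ) (fun i => z i.succ) := by
  unfold poleDenominator
  rw [Fin.prod_univ_succ, Fin.prod_Ioi_zero]
  simp only [Fin.prod_Ioi_succ]

/-- The product of modes `v_1(n_1) ⋯ v_k(n_k)`. -/
abbrev modeProd (Y : V →ₗ[ℂ] VertexOperator ℂ W) {k : ℕ} (v : Fin k → V) (n : Fin k → ℤ) :
    Module.End ℂ W :=
  (List.ofFn fun i => mode Y (v i) (n i)).prod

theorem modeProd_succ (Y : V →ₗ[ℂ] VertexOperator ℂ W) {k : ℕ} (v : Fin (k + 1) → V)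
    (n : Fin (k + 1) → ℤ) (w : W) :
    modeProd Y v n w = mode Y (v 0) (n 0)
      (modeProd Y (fun i => v i.succ) (fun i => n i.succ) w) := by
  rw [modeProd, List.ofFn_succ, List.prod_cons, Module.End.mul_apply]

namespace GradingRestrictedVertexAlgebra.GeneralizedModule

variable {A : GradingRestrictedVertexAlgebra V} (B : A.GeneralizedModule W)

theorem weak_commutativity_of_le (u₁ u₂ : V) (x : W) {f : Module.Dual ℂ W}
    (hf : f ∈ restrictedDual B.gr) {N : ℕ} (hN : truncOrder A.Y u₁ u₂ ≤ N) :
    (shiftDiff (1 : ℤ) ^ N) (fun m n => f (mode B.Y u₁ m (mode B.Y u₂ n x))) =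
      (shiftDiff (1 : ℤ) ^ N) (fun m n => f (mode B.Y u₂ n (mode B.Y u₁ m x))) := by
  obtain ⟨d, rfl⟩ := Nat.exists_eq_add_of_le' hN
  rw [pow_add, Module.End.mul_apply, Module.End.mul_apply, B.weak_commutativity u₁ u₂ x hf]

theorem shiftProd_mode_eq_zero {N : V → V → ℕ} (hN : ∀ u v, truncOrder A.Y u v ≤ N u v) {u : V}
    {w : W} {M : ℤ} (hM : ∀ n, M ≤ n → mode B.Y u n w = 0) {k : ℕ} (v : Fin k → V)
    {f : Module.Dual ℂ W} (hf : f ∈ restrictedDual B.gr) (a : ℤ) (ha : M ≤ a) (e : Fin k → ℤ) :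
    shiftProd (replicateIndices fun i => N u (v i))
      (fun a e => f (mode B.Y u a (modeProd B.Y v e w))) a e = 0 := by
  induction k generalizing f a with
  | zero =>
    simp only [replicateIndices, shiftProd, modeProd, List.finRange_zero, List.flatMap_nil,
      List.map_nil, List.ofFn_zero, List.prod_nil, Module.End.one_apply, hM a ha, map_zero]
  | succ k ih =>
    have hcomm : (shiftDiff (Pi.single 0 1) ^ N u (v 0))
        (fun a e => f (mode B.Y u a (modeProd B.Y v e w))) =
        (shiftDiff (Pi.single 0 1) ^ N u (v 0)) (fun a e => f (mode B.Y (v 0) (e 0)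
          (mode B.Y u a (modeProd B.Y (fun i => v i.succ) (fun i => e i.succ) w)))) := by
      funext a e
      rw [← Fin.cons_self_tail e, shiftDiff_single_zero_pow, shiftDiff_single_zero_pow]
      simp only [modeProd_succ B.Y v, Fin.cons_zero, Fin.cons_succ]
      rw [B.weak_commutativity_of_le u (v 0) _ hf (hN u (v 0))]
    rw [replicateIndices_succ, shiftProd_replicate_append, hcomm, ← Module.End.mul_apply,
      ← ((shiftProd_commute (Pi.single 0 1) _).pow_left _).eq, Module.End.mul_apply]
    refine shiftDiff_pow_eq_zero _ (fun _ a _ => M ≤ a) (fun a e ha => ?_)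
      (fun _ a _ ha => ⟨by linarith, ha⟩) _ a e ha
    rw [← Fin.cons_self_tail e, shiftProd_map_succ]
    simp only [Fin.cons_zero, Fin.cons_succ]
    exact ih (fun i => v i.succ) (B.restrictedDual_comp_mode (v 0) (e 0) hf) a ha _

theorem exists_hasSum_modeProd {N : V → V → ℕ+} (hN : ∀ u v, truncOrder A.Y u v ≤ N u v) {w : W}
    {M : V → ℕ} (hM : ∀ (u : V) (n : ℤ), (M u : ℤ) ≤ n → mode B.Y u n w = 0) {k : ℕ}
    (v : Fin k → V) {f : Module.Dual ℂ W} (hf : f ∈ restrictedDual B.gr) :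
    ∃ P : MvPolynomial (Fin k) ℂ, ∀ z ∈ orderedRegion k,
      HasSum (fun n : Fin k → ℤ => f (modeProd B.Y v n w) * ∏ i, z i ^ (-n i - 1))
        (MvPolynomial.eval z P / ((∏ i, z i ^ M (v i)) * poleDenominator N v z)) := by
  induction k generalizing f with
  | zero =>
    refine ⟨MvPolynomial.C (f w), fun z _ => ?_⟩
    convert hasSum_unique (fun n : Fin 0 → ℤ => f (modeProd B.Y v n w) * ∏ i, z i ^ (-n i - 1))
      using 1
    simp [poleDenominator, modeProd]
  | succ k ih =>
    obtain ⟨lo, hlo⟩ := B.exists_dual_mode_eq_zero (v 0) hf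
    obtain ⟨P, hP⟩ := exists_hasSum_of_shiftProd
      (replicateIndices fun i => (N (v 0) (v i.succ) : ℕ))
      (fun z : Fin k → ℂ => (∏ i, z i ^ M (v i.succ)) * poleDenominator N (fun i => v i.succ) z)
      (f := fun a e => f (mode B.Y (v 0) a (modeProd B.Y (fun i => v i.succ) e w)))
      (fun a ha e => hlo a ha _)
      (B.shiftProd_mode_eq_zero (N := fun u v => (N u v : ℕ)) hN (hM (v 0)) _ hf)
      (fun a => by
        have hih := ih (fun i => v i.succ) (B.restrictedDual_comp_mode (v 0) a hf)
        simpa only [LinearMap.comp_apply] using hih)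
    refine ⟨P, fun z hz => ?_⟩
    have hsum := hP z hz
    rw [prod_map_replicateIndices] at hsum
    refine (Fin.consEquiv fun _ => ℤ).hasSum_iff.1 ?_
    have hden : (∏ i, z i ^ M (v i)) * poleDenominator N v z =
        (∏ i : Fin k, (z 0 - z i.succ) ^ (N (v 0) (v i.succ) : ℕ)) * (z 0 ^ M (v 0) *
          ((∏ i : Fin k, z i.succ ^ M (v i.succ)) *
            poleDenominator N (fun i => v i.succ) fun i => z i.succ)) := by
      rw [poleDenominator_succ, Fin.prod_univ_succ]
      ring
    rw [hden]
    refine hsum.congr_fun fun p => ?_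
    simp only [Function.comp, Fin.consEquiv_apply]
    rw [modeProd_succ B.Y v, Fin.prod_univ_succ]
    simp only [Fin.cons_zero, Fin.cons_succ]
    rfl

end GradingRestrictedVertexAlgebra.GeneralizedModule

/-! ## Uniqueness of rational extensions -/

theorem eq_of_eval_eq_on_orderedRegion {k : ℕ} {P Q : MvPolynomial (Fin k) ℂ}
    (h : ∀ z ∈ orderedRegion k, MvPolynomial.eval z P = MvPolynomial.eval z Q) : P = Q := by
  refine MvPolynomial.funext_set
    (fun i : Fin k => ((↑) : ℝ → ℂ) '' Set.Ioo ((k : ℝ) - i) (k - i + 1)) (fun i => ?_)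
    fun z hz => h z ⟨fun i j hij => ?_, fun i => ?_⟩
  · exact (Set.Ioo_infinite (by linarith)).image Complex.ofReal_injective.injOn
  · obtain ⟨s, hs, hsz⟩ := hz i (Set.mem_univ _)
    obtain ⟨t, ht, htz⟩ := hz j (Set.mem_univ _)
    have hj : ((j : ℕ) : ℝ) + 1 ≤ k := by exact_mod_cast j.2
    have hij' : ((i : ℕ) : ℝ) + 1 ≤ (j : ℕ) := by exact_mod_cast hij
    rw [← hsz, ← htz, Complex.norm_real, Complex.norm_real,
      Real.norm_of_nonneg (by linarith [ht.1] : (0 : ℝ) ≤ t),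
      Real.norm_of_nonneg (by linarith [hs.1] : (0 : ℝ) ≤ s)]
    linarith [hs.1, ht.2]
  · obtain ⟨s, hs, hsz⟩ := hz i (Set.mem_univ _)
    have hi : ((i : ℕ) : ℝ) + 1 ≤ k := by exact_mod_cast i.2
    rw [← hsz, Complex.norm_real, Real.norm_of_nonneg (by linarith [hs.1])]
    linarith [hs.1]

theorem RationalValue.unique {κ : Type*} {k : ℕ} {s : κ → (Fin k → ℂ) → ℂ} {z : Fin k → ℂ}
    {c d : ℂ} (h : RationalValue (orderedRegion k) s z c)
    (h' : RationalValue (orderedRegion k) s z d) : c = d := by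
  obtain ⟨P, Q, hsum, hQ, hc⟩ := h
  obtain ⟨P', Q', hsum', hQ', hd⟩ := h'
  have hcross : P * Q' = P' * Q := eq_of_eval_eq_on_orderedRegion fun x hx => by
    have hlimit := (hsum x hx).2.unique (hsum' x hx).2
    rw [div_eq_div_iff (hsum x hx).1 (hsum' x hx).1] at hlimit
    simpa using hlimit
  rw [hc, hd, div_eq_div_iff hQ hQ']
  simpa using congrArg (MvPolynomial.eval z) hcross

/-! ## Derivatives of rational functions and of their expansions -/

section Derivative

theorem hasDerivAt_eval_curve {σ : Type*} [Fintype σ] (P : MvPolynomial σ ℂ) {γ : ℂ → σ → ℂ}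
    {γ' : σ → ℂ} {s : ℂ} (hγ : ∀ i, HasDerivAt (fun t => γ t i) (γ' i) s) :
    HasDerivAt (fun t => MvPolynomial.eval (γ t) P)
      (∑ i, γ' i * MvPolynomial.eval (γ s) (MvPolynomial.pderiv i P)) s := by
  classical
  induction P using MvPolynomial.induction_on with
  | C a => simpa using hasDerivAt_const s a
  | add p q hp hq => simpa [mul_add, Finset.sum_add_distrib] using hp.fun_add hq
  | mul_X p j hp =>
    simp only [map_mul, MvPolynomial.eval_X, Derivation.leibniz, MvPolynomial.pderiv_X,
      smul_eq_mul, map_add, mul_add, Finset.sum_add_distrib, Pi.single_apply]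
    refine (hp.fun_mul (hγ j)).congr_deriv ?_
    simp only [Finset.sum_mul, apply_ite (MvPolynomial.eval (γ s)), map_one, map_zero, mul_ite,
      mul_one, mul_zero, Finset.sum_ite_eq, Finset.mem_univ, if_true]
    rw [add_comm, mul_comm (γ' j)]
    exact congrArg _ (Finset.sum_congr rfl fun i _ => by ring)

variable {k : ℕ}

theorem hasDerivAt_eval_update (P : MvPolynomial (Fin k) ℂ) (z : Fin k → ℂ) (i : Fin k) (s : ℂ) :
    HasDerivAt (fun t => MvPolynomial.eval (Function.update z i t) P)
      (MvPolynomial.eval (Function.update z i s) (MvPolynomial.pderiv i P)) s := by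
  refine (hasDerivAt_eval_curve P (hasDerivAt_pi.1 (hasDerivAt_update z i s))).congr_deriv ?_
  simp only [Pi.single_apply, ite_mul, one_mul, zero_mul, Finset.sum_ite_eq', Finset.mem_univ,
    if_true]

theorem hasDerivAt_eval_sub (P : MvPolynomial (Fin k) ℂ) (z : Fin k → ℂ) (s : ℂ) :
    HasDerivAt (fun t => MvPolynomial.eval (fun i => z i - t) P)
      (-∑ i, MvPolynomial.eval (fun i => z i - s) (MvPolynomial.pderiv i P)) s := by
  refine (hasDerivAt_eval_curve (γ := fun t i => z i - t) P
    fun i => (hasDerivAt_id' s).const_sub (z i)).congr_deriv ?_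
  simp only [neg_mul, one_mul, Finset.sum_neg_distrib]

theorem exists_update_mem_orderedRegion {z : Fin k → ℂ} (hz : z ∈ orderedRegion k) (i : Fin k) :
    ∃ ε > 0, ∀ t : ℂ, |‖t‖ - ‖z i‖| < ε → Function.update z i t ∈ orderedRegion k := by
  have hnear : ∀ᶠ s : ℝ in nhds ‖z i‖, (∀ j, j < i → s < ‖z j‖) ∧
      (∀ j, i < j → ‖z j‖ < s) ∧ 0 < s := by
    refine Filter.Eventually.and ?_ (Filter.Eventually.and ?_ (eventually_gt_nhds (hz.2 i)))
    · refine Filter.eventually_all.2 fun j => ?_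
      by_cases hj : j < i
      · filter_upwards [eventually_lt_nhds (hz.1 j i hj)] with s hs _ using hs
      · exact Filter.Eventually.of_forall fun s h => absurd h hj
    · refine Filter.eventually_all.2 fun j => ?_
      by_cases hj : i < j
      · filter_upwards [eventually_gt_nhds (hz.1 i j hj)] with s hs _ using hs
      · exact Filter.Eventually.of_forall fun s h => absurd h hj
  obtain ⟨ε, hε, hball⟩ := Metric.eventually_nhds_iff.1 hnear
  refine ⟨ε, hε, fun t ht => ?_⟩
  obtain ⟨hlt, hgt, hpos⟩ := hball (y := ‖t‖) (by rwa [Real.dist_eq])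
  refine ⟨fun a b hab => ?_, fun a => ?_⟩
  · by_cases hai : a = i
    · subst hai
      rw [Function.update_self, Function.update_of_ne hab.ne']
      exact hgt b hab
    · by_cases hbi : b = i
      · subst hbi
        rw [Function.update_self, Function.update_of_ne hai]
        exact hlt a hab
      · rw [Function.update_of_ne hai, Function.update_of_ne hbi]
        exact hz.1 a b hab
  · by_cases hai : a = i
    · subst hai
      rwa [Function.update_self]
    · rw [Function.update_of_ne hai]
      exact hz.2 a

theorem zpow_le_add_zpow {r₁ r₂ s : ℝ} (h0 : 0 < r₁) (h1 : r₁ ≤ s) (h2 : s ≤ r₂) (m : ℤ) :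
    s ^ m ≤ r₁ ^ m + r₂ ^ m := by
  have hs := h0.trans_le h1
  rcases le_total 0 m with hm | hm
  · exact (zpow_le_zpow_left₀ hm hs.le h2).trans (le_add_of_nonneg_left (zpow_nonneg h0.le m))
  · obtain ⟨n, rfl⟩ := Int.exists_eq_neg_ofNat hm
    have hinv : s ^ (-(n : ℤ)) ≤ r₁ ^ (-(n : ℤ)) := by
      rw [zpow_neg, zpow_neg, zpow_natCast, zpow_natCast]
      gcongr
    exact hinv.trans (le_add_of_nonneg_right (zpow_nonneg (hs.le.trans h2) _))

theorem hasSum_deriv_zpow {κ : Type*} {c : κ → ℂ} {e : κ → ℤ} {F : ℂ → ℂ} {x : ℂ} (hx : x ≠ 0)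
    {ε : ℝ} (hε : 0 < ε)
    (h : ∀ t : ℂ, |‖t‖ - ‖x‖| < ε → HasSum (fun n => c n * t ^ e n) (F t)) :
    HasSum (fun n => c n * (e n * x ^ (e n - 1))) (deriv F x) := by
  have hx0 : 0 < ‖x‖ := norm_pos_iff.2 hx
  set δ : ℝ := min (ε / 2) (‖x‖ / 2)
  have hδ0 : 0 < δ := lt_min (by linarith) (by linarith)
  have hδε : δ < ε := (min_le_left _ _).trans_lt (by linarith)
  have hδx : δ < ‖x‖ := (min_le_right _ _).trans_lt (by linarith)
  have hball : ∀ t ∈ Metric.ball x δ, |‖t‖ - ‖x‖| < δ := fun t ht =>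
    (abs_norm_sub_norm_le t x).trans_lt (by rwa [← dist_eq_norm])
  have hbounds : ∀ t ∈ Metric.ball x δ, ‖x‖ - δ < ‖t‖ ∧ ‖t‖ < ‖x‖ + δ := fun t ht =>
    ⟨by linarith [(abs_lt.1 (hball t ht)).1], by linarith [(abs_lt.1 (hball t ht)).2]⟩
  have hradius : ∀ r : ℝ, 0 < r → |r - ‖x‖| < ε → Summable fun n => ‖c n‖ * r ^ e n := by
    intro r hr hrε
    have hnorm : ‖(r : ℂ)‖ = r := by rw [Complex.norm_real, Real.norm_of_nonneg hr.le]
    simpa only [norm_mul, norm_zpow, hnorm] using (h r (by rwa [hnorm])).summable.norm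
  have hinner := hradius (‖x‖ - δ) (by linarith) (abs_lt.2 ⟨by linarith, by linarith⟩)
  have houter := hradius (‖x‖ + δ) (by linarith) (abs_lt.2 ⟨by linarith, by linarith⟩)
  have hderiv : ∀ n, ∀ t ∈ Metric.ball x δ,
      HasDerivAt (fun t => c n * t ^ e n) (c n * (e n * t ^ (e n - 1))) t := fun n t ht =>
    (hasDerivAt_zpow _ t
      (Or.inl (norm_pos_iff.1 (by linarith [(hbounds t ht).1])))).const_mul _
  have hterms := Complex.hasSum_deriv_of_summable_norm (F := fun n t => c n * t ^ e n)
    (hinner.add houter)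
    (fun n t ht => (hderiv n t ht).differentiableAt.differentiableWithinAt) Metric.isOpen_ball
    (fun n t ht => by
      rw [norm_mul, norm_zpow, ← mul_add]
      gcongr
      exact zpow_le_add_zpow (by linarith) (hbounds t ht).1.le (hbounds t ht).2.le (e n))
    (Metric.mem_ball_self hδ0)
  have hF : (fun t => ∑' n, c n * t ^ e n) =ᶠ[nhds x] F := by
    filter_upwards [Metric.ball_mem_nhds x hδ0] with t ht
    exact (h t ((hball t ht).trans hδε)).tsum_eq
  rw [hF.deriv_eq] at hterms
  exact hterms.congr_fun fun n => (hderiv n x (Metric.mem_ball_self hδ0)).deriv.symm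

theorem deriv_eval_div_eval_update (P : MvPolynomial (Fin k) ℂ) {Q : MvPolynomial (Fin k) ℂ}
    {z : Fin k → ℂ} (hQ : MvPolynomial.eval z Q ≠ 0) (i : Fin k) :
    deriv (fun t => MvPolynomial.eval (Function.update z i t) P /
      MvPolynomial.eval (Function.update z i t) Q) (z i) =
      (MvPolynomial.eval z (MvPolynomial.pderiv i P) * MvPolynomial.eval z Q -
        MvPolynomial.eval z P * MvPolynomial.eval z (MvPolynomial.pderiv i Q)) /
          MvPolynomial.eval z Q ^ 2 := by
  have hupdate : Function.update z i (z i) = z := Function.update_eq_self i z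
  have hquot := (hasDerivAt_eval_update P z i (z i)).fun_div (hasDerivAt_eval_update Q z i (z i))
    (by rwa [hupdate])
  simpa only [hupdate] using hquot.deriv

theorem prod_update_eq_mul_prod_compl (f : Fin k → ℂ → ℂ) (z : Fin k → ℂ) (i : Fin k) (t : ℂ) :
    ∏ j, f j (Function.update z i t j) = f i t * ∏ j ∈ {i}ᶜ, f j (z j) := by
  rw [Fintype.prod_eq_mul_prod_compl i, Function.update_self]
  congr 1
  refine Finset.prod_congr rfl fun j hj => ?_
  rw [Finset.mem_compl, Finset.mem_singleton] at hj
  rw [Function.update_of_ne hj]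

theorem hasSum_pderiv {c : (Fin k → ℤ) → ℂ} {P Q : MvPolynomial (Fin k) ℂ}
    (h : ∀ z ∈ orderedRegion k, MvPolynomial.eval z Q ≠ 0 ∧
      HasSum (fun n => c n * ∏ i, z i ^ (-n i - 1))
        (MvPolynomial.eval z P / MvPolynomial.eval z Q))
    {z : Fin k → ℂ} (hz : z ∈ orderedRegion k) (i : Fin k) :
    HasSum (fun n : Fin k → ℤ => (-(n i : ℂ)) * c (n - Pi.single i 1) * ∏ j, z j ^ (-n j - 1))
      ((MvPolynomial.eval z (MvPolynomial.pderiv i P) * MvPolynomial.eval z Q -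
        MvPolynomial.eval z P * MvPolynomial.eval z (MvPolynomial.pderiv i Q)) /
          MvPolynomial.eval z Q ^ 2) := by
  obtain ⟨ε, hε, hregion⟩ := exists_update_mem_orderedRegion hz i
  set K : (Fin k → ℤ) → ℂ := fun n => ∏ j ∈ {i}ᶜ, z j ^ (-n j - 1)
  have hcurve : ∀ t : ℂ, |‖t‖ - ‖z i‖| < ε → HasSum (fun n => c n * K n * t ^ (-n i - 1))
      (MvPolynomial.eval (Function.update z i t) P /
        MvPolynomial.eval (Function.update z i t) Q) := fun t ht =>
    (h _ (hregion t ht)).2.congr_fun fun n => by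
      rw [prod_update_eq_mul_prod_compl (fun j x => x ^ (-n j - 1)), mul_assoc, mul_comm (K n)]
  have hterms := hasSum_deriv_zpow (norm_pos_iff.1 (hz.2 i)) hε hcurve
  rw [deriv_eval_div_eval_update P (h z hz).1 i] at hterms
  refine (Equiv.addRight (Pi.single i (1 : ℤ))).hasSum_iff.1 (hterms.congr_fun fun n => ?_)
  have hK : ∏ j ∈ {i}ᶜ, z j ^ (-(n j + (Pi.single i 1 : Fin k → ℤ) j) - 1) = K n := by
    refine Finset.prod_congr rfl fun j hj => ?_
    rw [Finset.mem_compl, Finset.mem_singleton] at hj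
    rw [Pi.single_eq_of_ne hj, add_zero]
  simp only [Function.comp_apply, Equiv.coe_addRight, add_sub_cancel_right, Pi.add_apply]
  rw [Fintype.prod_eq_mul_prod_compl i, hK, Pi.single_eq_same,
    show -(n i + 1) - 1 = -n i - 1 - 1 by ring]
  push_cast
  ring

end Derivative

/-! ## Exponentials of locally nilpotent operators -/

section LocallyNilpotentExp

variable {𝕜 M N : Type*} [Field 𝕜] [AddCommGroup M] [Module 𝕜 M] [AddCommGroup N] [Module 𝕜 N]

/-- `e^{tD} x`, for an operator `D` some power of which annihilates `x`; for other `x` the value is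
of no significance. -/
def locallyNilpotentExp (D : Module.End 𝕜 M) (t : 𝕜) (x : M) : M :=
  ∑ᶠ a : ℕ, (t ^ a / (a.factorial : 𝕜)) • (D ^ a) x

variable {D : Module.End 𝕜 M} {K : ℕ} {x : M}

theorem locallyNilpotentExp_eq_sum (hK : (D ^ K) x = 0) (t : 𝕜) :
    locallyNilpotentExp D t x = ∑ a ∈ Finset.range K, (t ^ a / (a.factorial : 𝕜)) • (D ^ a) x := by
  refine finsum_eq_sum_of_support_subset _ fun a ha => ?_
  by_contra haK
  rw [Finset.mem_coe, Finset.mem_range, not_lt] at haK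
  exact ha (by simp only [Module.End.pow_map_zero_of_le haK hK, smul_zero])

theorem map_locallyNilpotentExp (φ : M →ₗ[𝕜] N) {D' : Module.End 𝕜 N}
    (hφ : ∀ y, φ (D y) = D' (φ y)) (hK : (D ^ K) x = 0) (t : 𝕜) :
    φ (locallyNilpotentExp D t x) = locallyNilpotentExp D' t (φ x) := by
  have hpow : ∀ a, φ ((D ^ a) x) = (D' ^ a) (φ x) := by
    intro a
    induction a with
    | zero => rfl
    | succ a ih =>
      rw [pow_succ', pow_succ', Module.End.mul_apply, Module.End.mul_apply, hφ, ih]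
  rw [locallyNilpotentExp_eq_sum hK, map_sum,
    locallyNilpotentExp_eq_sum (by rw [← hpow, hK, map_zero])]
  exact Finset.sum_congr rfl fun a _ => by rw [map_smul, hpow]

theorem locallyNilpotentExp_zero (D : Module.End 𝕜 M) (x : M) : locallyNilpotentExp D 0 x = x := by
  rw [locallyNilpotentExp,
    finsum_eq_single _ 0 fun a ha => by rw [zero_pow ha, zero_div, zero_smul]]
  simp

theorem pow_locallyNilpotentExp (hK : (D ^ K) x = 0) (t : 𝕜) :
    (D ^ K) (locallyNilpotentExp D t x) = 0 := by
  rw [map_locallyNilpotentExp (D ^ K) (D' := D)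
    (LinearMap.congr_fun (Commute.pow_self D _).eq) hK, hK]
  simp [locallyNilpotentExp]

theorem exists_pow_apply_ne_zero_and_pow_succ_eq_zero (hx : x ≠ 0) (hD : ∃ K, (D ^ K) x = 0) :
    ∃ K, (D ^ K) x ≠ 0 ∧ (D ^ (K + 1)) x = 0 := by
  classical
  obtain ⟨K, hK⟩ : ∃ K, Nat.find hD = K + 1 := Nat.exists_eq_succ_of_ne_zero fun h0 => hx (by
    simpa only [h0, pow_zero, Module.End.one_apply] using Nat.find_spec hD)
  exact ⟨K, Nat.find_min hD (by lia), by simpa only [hK] using Nat.find_spec hD⟩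

theorem locallyNilpotentExp_locallyNilpotentExp [CharZero 𝕜] (hK : (D ^ K) x = 0) (s t : 𝕜) :
    locallyNilpotentExp D s (locallyNilpotentExp D t x) = locallyNilpotentExp D (s + t) x := by
  have hdouble : locallyNilpotentExp D s (locallyNilpotentExp D t x) =
      ∑ a ∈ Finset.range K, ∑ b ∈ Finset.range (K - a),
        (s ^ a / (a.factorial : 𝕜) * (t ^ b / (b.factorial : 𝕜))) • (D ^ (a + b)) x := by
    rw [locallyNilpotentExp_eq_sum (pow_locallyNilpotentExp hK t)]
    refine Finset.sum_congr rfl fun a _ => ?_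
    rw [map_locallyNilpotentExp (D ^ a) (D' := D)
      (LinearMap.congr_fun (Commute.pow_self D _).eq) hK,
      locallyNilpotentExp_eq_sum (K := K - a), Finset.smul_sum]
    · refine Finset.sum_congr rfl fun b _ => ?_
      rw [← Module.End.mul_apply, ← pow_add, smul_smul, add_comm b]
    · rw [← Module.End.mul_apply, ← pow_add]
      exact Module.End.pow_map_zero_of_le (by lia) hK
  rw [hdouble, ← Finset.sum_range_diag_flip K fun a b =>
    (s ^ a / (a.factorial : 𝕜) * (t ^ b / (b.factorial : 𝕜))) • (D ^ (a + b)) x,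
    locallyNilpotentExp_eq_sum hK]
  refine Finset.sum_congr rfl fun c _ => ?_
  rw [add_pow, Finset.sum_div, Finset.sum_smul]
  refine Finset.sum_congr rfl fun a ha => ?_
  have hac : a ≤ c := Nat.lt_succ_iff.1 (Finset.mem_range.1 ha)
  have hc : (c.factorial : 𝕜) ≠ 0 := Nat.cast_ne_zero.2 c.factorial_ne_zero
  rw [Nat.add_sub_cancel' hac, Nat.cast_choose 𝕜 hac]
  congr 1
  field_simp

end LocallyNilpotentExp

section Derivative

variable {M : Type*} [AddCommGroup M] [Module ℂ M] {D : Module.End ℂ M} {K : ℕ} {x : M}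

theorem hasDerivAt_apply_locallyNilpotentExp {g : ℂ → M →ₗ[ℂ] ℂ} {g' : M →ₗ[ℂ] ℂ} {s : ℂ}
    (hg : ∀ y, HasDerivAt (fun t => g t y) (g' y - g s (D y)) s) (hK : (D ^ K) x = 0) :
    HasDerivAt (fun t => g t (locallyNilpotentExp D t x)) (g' (locallyNilpotentExp D s x)) s := by
  set T : ℕ → ℂ := fun a => a * s ^ (a - 1) / (a.factorial : ℂ) * g s ((D ^ a) x) with hT
  have hterm : ∀ a ∈ Finset.range K,
      HasDerivAt (fun t : ℂ => t ^ a / (a.factorial : ℂ) * g t ((D ^ a) x))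
        (T a - T (a + 1) + s ^ a / (a.factorial : ℂ) * g' ((D ^ a) x)) s := by
    intro a _
    refine (((hasDerivAt_pow a s).div_const _).fun_mul (hg ((D ^ a) x))).congr_deriv ?_
    have ha : ((a : ℂ) + 1) ≠ 0 := by exact_mod_cast a.succ_ne_zero
    have ha' : (a.factorial : ℂ) ≠ 0 := Nat.cast_ne_zero.2 a.factorial_ne_zero
    simp only [hT, Nat.factorial_succ, Nat.add_sub_cancel, pow_succ' D, Module.End.mul_apply]
    push_cast
    field_simp
    ring
  simp only [locallyNilpotentExp_eq_sum hK, map_sum, map_smul, smul_eq_mul]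
  refine (HasDerivAt.fun_sum hterm).congr_deriv ?_
  rw [Finset.sum_add_distrib, Finset.sum_range_sub' T, add_eq_right]
  simp [hT, hK]

theorem apply_locallyNilpotentExp_eq {g : ℂ → M →ₗ[ℂ] ℂ}
    (hg : ∀ s y, HasDerivAt (fun t => g t y) (-g s (D y)) s) (hK : (D ^ K) x = 0) (t : ℂ) :
    g t (locallyNilpotentExp D t x) = g 0 x := by
  have hderiv : ∀ s, HasDerivAt (fun t => g t (locallyNilpotentExp D t x)) 0 s := fun s =>
    hasDerivAt_apply_locallyNilpotentExp (g' := 0)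
      (fun y => (hg s y).congr_deriv (zero_sub _).symm) hK
  rw [is_const_of_deriv_eq_zero (fun s => (hderiv s).differentiableAt)
    (fun s => (hderiv s).deriv) t 0, locallyNilpotentExp_zero]

theorem apply_eq_apply_zero_locallyNilpotentExp {g : ℂ → M →ₗ[ℂ] ℂ}
    (hg : ∀ s y, HasDerivAt (fun t => g t y) (g s (D y)) s) (hK : (D ^ K) x = 0) (t : ℂ) :
    g t x = g 0 (locallyNilpotentExp D t x) := by
  have hrev := apply_locallyNilpotentExp_eq (g := fun s => g (t - s)) (D := D)
    (fun s y => (hg (t - s) y).comp_const_sub t s) hK t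
  simpa only [sub_self, sub_zero] using hrev.symm

theorem hasSum_taylor_of_hasDerivAt {X : Type*} {F : X → ℂ → ℂ} {L : X → X} {r : ℝ}
    (hF : ∀ x, ∀ s ∈ Metric.ball (0 : ℂ) r, HasDerivAt (F x) (F (L x) s) s) {t : ℂ} (ht : ‖t‖ < r)
    (x : X) : HasSum (fun j : ℕ => t ^ j / (j.factorial : ℂ) * F (L^[j] x) 0) (F x t) := by
  have hiter : ∀ j : ℕ, ∀ s ∈ Metric.ball (0 : ℂ) r,
      iteratedDeriv j (F x) s = F (L^[j] x) s := by
    intro j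
    induction j with
    | zero => exact fun s _ => congrFun iteratedDeriv_zero s
    | succ j ih =>
      intro s hs
      have hnear : iteratedDeriv j (F x) =ᶠ[nhds s] F (L^[j] x) := by
        filter_upwards [Metric.isOpen_ball.mem_nhds hs] with s' hs' using ih s' hs'
      rw [iteratedDeriv_succ, hnear.deriv_eq, (hF _ s hs).deriv, Function.iterate_succ_apply']
  have hdiff : DifferentiableOn ℂ (F x) (Metric.ball 0 r) := fun s hs =>
    (hF x s hs).differentiableAt.differentiableWithinAt
  refine (Complex.hasSum_taylorSeries_on_ball hdiff (mem_ball_zero_iff.2 ht)).congr_fun fun j => ?_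
  rw [hiter j 0 (Metric.mem_ball_self ((norm_nonneg t).trans_lt ht)), sub_zero, smul_eq_mul,
    smul_eq_mul]
  ring

end Derivative

/-! ## Correlation functions and their translation covariance -/

theorem hasDerivAt_eval_div_eval_sub {k : ℕ} {c : (Fin k → ℤ) → ℂ} {P Q : MvPolynomial (Fin k) ℂ}
    (h : ∀ z ∈ orderedRegion k, MvPolynomial.eval z Q ≠ 0 ∧
      HasSum (fun n => c n * ∏ i, z i ^ (-n i - 1))
        (MvPolynomial.eval z P / MvPolynomial.eval z Q))
    {z : Fin k → ℂ} {s d : ℂ} (hQ : MvPolynomial.eval (fun i => z i - s) Q ≠ 0)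
    (hd : RationalValue (orderedRegion k)
      (fun (n : Fin k → ℤ) x => (∑ i, -(n i : ℂ) * c (n - Pi.single i 1)) * ∏ i, x i ^ (-n i - 1))
      (fun i => z i - s) d) :
    HasDerivAt (fun t => MvPolynomial.eval (fun i => z i - t) P /
      MvPolynomial.eval (fun i => z i - t) Q) (-d) s := by
  have hderiv : RationalValue (orderedRegion k)
      (fun (n : Fin k → ℤ) x => (∑ i, -(n i : ℂ) * c (n - Pi.single i 1)) * ∏ i, x i ^ (-n i - 1))
      (fun i => z i - s) _ :=
    ⟨∑ i, (MvPolynomial.pderiv i P * Q - P * MvPolynomial.pderiv i Q), Q ^ 2, fun x hx => by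
      refine ⟨by simpa only [map_pow] using pow_ne_zero 2 (h x hx).1, ?_⟩
      simpa only [map_sum, map_sub, map_mul, map_pow, Finset.sum_mul, Finset.sum_div] using
        hasSum_sum fun i (_ : i ∈ Finset.univ) => hasSum_pderiv h hx i,
      by simpa only [map_pow] using pow_ne_zero 2 hQ, rfl⟩
  refine ((hasDerivAt_eval_sub P z s).fun_div (hasDerivAt_eval_sub Q z s) hQ).congr_deriv ?_
  rw [hd.unique hderiv]
  simp only [map_sum, map_sub, map_mul, map_pow, Finset.sum_sub_distrib, ← Finset.sum_mul,
    ← Finset.mul_sum]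
  ring

theorem injective_of_mem_orderedRegion {k : ℕ} {z : Fin k → ℂ}
    (hz : z ∈ orderedRegion k) : Function.Injective z :=
  .of_lt_imp_ne fun i j hij h => (hz.1 i j hij).ne (by rw [h])

/-- Bounds the orders of the poles `z_i = z_j` of all correlation functions of `A`-modules; the
successor is taken since pole orders are required to be positive. -/
def GradingRestrictedVertexAlgebra.poleOrder (A : GradingRestrictedVertexAlgebra V) (u v : V) :
    ℕ+ :=
  (truncOrder A.Y u v).succPNat

namespace GradingRestrictedVertexAlgebra.GeneralizedModule

variable {A : GradingRestrictedVertexAlgebra V} (B : A.GeneralizedModule W) {k : ℕ}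

theorem Lm1_modeProd (v : Fin k → V) (n : Fin k → ℤ) (w : W) :
    B.Lm1 (modeProd B.Y v n w) = modeProd B.Y v n (B.Lm1 w) +
      ∑ i, (-(n i : ℂ)) • modeProd B.Y v (n - Pi.single i 1) w := by
  induction k with
  | zero => simp [modeProd]
  | succ k ih =>
    have hbracket := B.derivative_bracket (v 0)
      (modeProd B.Y (fun i => v i.succ) (fun i => n i.succ) w) (n 0)
    have htail : (fun i : Fin k => (n - Pi.single 0 1 : Fin (k + 1) → ℤ) i.succ) =
        fun i => n i.succ := by
      funext i; simp
    have htail_succ (i : Fin k) :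
        (fun j : Fin k => (n - Pi.single i.succ 1 : Fin (k + 1) → ℤ) j.succ) =
          (fun i => n i.succ) - Pi.single i 1 := by
      funext j; simp [Pi.single_apply]
    have hhead (i : Fin k) : (n - Pi.single i.succ 1 : Fin (k + 1) → ℤ) 0 = n 0 := by simp
    simp only [modeProd_succ, Fin.sum_univ_succ, htail, htail_succ, hhead]
    rw [sub_eq_iff_eq_add] at hbracket
    simp only [hbracket, ih, map_add, map_sum, map_smul, Pi.sub_apply, Pi.single_eq_same]
    abel

/-- All matrix elements of `E_W(v_1, z_1; …; v_k, z_k; w)` are defined. -/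
def IsRegular (v : Fin k → V) (w : W) (z : Fin k → ℂ) : Prop :=
  ∀ f : restrictedDual B.gr, ∃ c, IsCorrelatorValue B v w f z c

open Classical in
/-- The element `E_W(v_1, z_1; …; v_k, z_k; w)` of the completion of `W`, as the linear functional
`f ↦ ⟨f, E_W(v_1, z_1; …; v_k, z_k; w)⟩` on the restricted dual; `0` where it is not defined. -/
def corr (v : Fin k → V) (w : W) (z : Fin k → ℂ) : restrictedDual B.gr →ₗ[ℂ] ℂ :=
  if h : B.IsRegular v w z then
    { toFun := fun f => (h f).choose
      map_add' := fun f g => RationalValue.unique (h (f + g)).choose_spec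
        (RationalValue.add (h f).choose_spec (h g).choose_spec fun n y => by simp [add_mul])
      map_smul' := fun c f => RationalValue.unique (h (c • f)).choose_spec
        (RationalValue.smul c (h f).choose_spec fun n y => by simp [mul_assoc]) }
  else 0

variable {B} {v : Fin k → V} {w : W} {z : Fin k → ℂ}

theorem IsRegular.isCorrelatorValue (h : B.IsRegular v w z) (f : restrictedDual B.gr) :
    IsCorrelatorValue B v w f z (B.corr v w z f) := by
  rw [corr, dif_pos h]
  exact (h f).choose_spec

theorem IsRegular.corr_eq (h : B.IsRegular v w z) {f : restrictedDual B.gr} {c : ℂ}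
    (hc : IsCorrelatorValue B v w f z c) : B.corr v w z f = c :=
  RationalValue.unique (h.isCorrelatorValue f) hc

theorem isRegular_zero : B.IsRegular v 0 z := fun _ => ⟨0, RationalValue.zero fun n y => by simp⟩

theorem corr_zero : B.corr v 0 z = 0 :=
  LinearMap.ext fun _ => isRegular_zero.corr_eq (RationalValue.zero fun n y => by simp)

theorem corr_add {w' : W} (h : B.IsRegular v w z) (h' : B.IsRegular v w' z) :
    B.corr v (w + w') z = B.corr v w z + B.corr v w' z := by
  have hadd : ∀ f, IsCorrelatorValue B v (w + w') f z (B.corr v w z f + B.corr v w' z f) :=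
    fun f => RationalValue.add (h.isCorrelatorValue f) (h'.isCorrelatorValue f)
      fun n y => by simp [add_mul]
  exact LinearMap.ext fun f => IsRegular.corr_eq (fun f => ⟨_, hadd f⟩) (hadd f)

theorem corr_smul (c : ℂ) (h : B.IsRegular v w z) : B.corr v (c • w) z = c • B.corr v w z := by
  have hsmul : ∀ f, IsCorrelatorValue B v (c • w) f z (c * B.corr v w z f) :=
    fun f => RationalValue.smul c (h.isCorrelatorValue f) fun n y => by simp [mul_assoc]
  exact LinearMap.ext fun f => IsRegular.corr_eq (fun f => ⟨_, hsmul f⟩) (hsmul f)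

theorem exists_corr_eq_div {N : V → V → ℕ+} (hN : ∀ u v, truncOrder A.Y u v ≤ N u v)
    {M : V → ℕ} (hM : ∀ (u : V) (n : ℤ), (M u : ℤ) ≤ n → mode B.Y u n w = 0) (v : Fin k → V)
    (f : restrictedDual B.gr) :
    ∃ P : MvPolynomial (Fin k) ℂ, ∀ z : Fin k → ℂ, Function.Injective z →
      (∀ i, M (v i) = 0 ∨ z i ≠ 0) → IsCorrelatorValue B v w f z
        (MvPolynomial.eval z P / ((∏ i, z i ^ M (v i)) * poleDenominator N v z)) := by
  obtain ⟨P, hP⟩ := B.exists_hasSum_modeProd hN hM v f.2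
  have hne : ∀ z : Fin k → ℂ, Function.Injective z → (∀ i, M (v i) = 0 ∨ z i ≠ 0) →
      (∏ i, z i ^ M (v i)) * poleDenominator N v z ≠ 0 := fun z hz hz0 =>
    mul_ne_zero (Finset.prod_ne_zero_iff.2 fun i _ => (hz0 i).elim
      (fun h => by rw [h, pow_zero]; exact one_ne_zero) (pow_ne_zero _))
      (poleDenominator_ne_zero N v hz)
  refine ⟨P, fun z hz hz0 => ⟨P, (∏ i, MvPolynomial.X i ^ M (v i)) * polePolynomial N v, ?_⟩⟩
  simp only [map_mul, map_prod, map_pow, MvPolynomial.eval_X, eval_polePolynomial]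
  exact ⟨fun x hx => ⟨hne x (injective_of_mem_orderedRegion hx) fun i =>
    Or.inr (norm_pos_iff.1 (hx.2 i)), hP x hx⟩, hne z hz hz0, trivial⟩

variable (B) in
theorem isRegular_of_ne_zero (v : Fin k → V) (w : W) (hz : Function.Injective z)
    (hz0 : ∀ i, z i ≠ 0) : B.IsRegular v w z := by
  intro f
  obtain ⟨P, hP⟩ := exists_corr_eq_div (B := B) (N := A.poleOrder) (fun u v => Nat.le_succ _)
    (fun u n hn => mode_eq_zero_of_truncOrder_le B.Y u w hn) v f
  exact ⟨_, hP z hz fun i => Or.inr (hz0 i)⟩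

theorem hasDerivAt_corr {s : ℂ} (h : ∀ᶠ t in nhds s, B.IsRegular v w fun i => z i - t)
    (hL : B.IsRegular v (B.Lm1 w) fun i => z i - s) (f : restrictedDual B.gr) :
    HasDerivAt (fun t => B.corr v w (fun i => z i - t) f)
      (B.corr v (B.Lm1 w) (fun i => z i - s) f -
        B.corr v w (fun i => z i - s) (B.dualLm1 f)) s := by
  obtain ⟨-, P, Q, hPQ, hQ, -⟩ := h.self_of_nhds f
  have hd := RationalValue.add (h.self_of_nhds.isCorrelatorValue (B.dualLm1 f))
    (RationalValue.smul (-1) (hL.isCorrelatorValue f) fun _ _ => rfl)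
    (r := fun n x => (∑ i, -(n i : ℂ) * (f : Module.Dual ℂ W)
      (modeProd B.Y v (n - Pi.single i 1) w)) * ∏ i, x i ^ (-n i - 1)) fun n x => by
    have hcomm := congrArg (f : Module.Dual ℂ W) (B.Lm1_modeProd v n w)
    rw [map_add, map_sum, ← dualLm1_apply] at hcomm
    simp only [map_smul, smul_eq_mul] at hcomm
    rw [← sub_eq_iff_eq_add'.2 hcomm, sub_mul]
    ring!
  refine ((hasDerivAt_eval_div_eval_sub hPQ hQ hd).congr_deriv (by ring)).congr_of_eventuallyEq ?_
  have hcont : Continuous fun t : ℂ => MvPolynomial.eval (fun i => z i - t) Q :=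
    (MvPolynomial.continuous_eval Q).comp (by fun_prop)
  filter_upwards [h, hcont.continuousAt.eventually_ne hQ] with t ht hQt
  exact ht.corr_eq ⟨P, Q, hPQ, hQt, rfl⟩

variable (B) in
/-- `⟨e^{t L_W(-1)*} f, E_W(v_1, z_1 - t; …; v_k, z_k - t; w)⟩`, where `L_W(-1)*` is the transpose;
informally, the matrix element `⟨f, E_W(v_1, z_1; …; v_k, z_k; e^{t L_W(-1)} w)⟩`. -/
def translCorr (v : Fin k → V) (w : W) (z : Fin k → ℂ) (t : ℂ) (f : restrictedDual B.gr) : ℂ :=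
  B.corr v w (fun i => z i - t) (locallyNilpotentExp B.dualLm1 t f)

theorem translCorr_zero (f : restrictedDual B.gr) : B.translCorr v w z 0 f = B.corr v w z f := by
  simp only [translCorr, sub_zero, locallyNilpotentExp_zero]

theorem hasDerivAt_translCorr {s : ℂ} (h : ∀ᶠ t in nhds s, B.IsRegular v w fun i => z i - t)
    (hL : B.IsRegular v (B.Lm1 w) fun i => z i - s) (f : restrictedDual B.gr) :
    HasDerivAt (fun t => B.translCorr v w z t f) (B.translCorr v (B.Lm1 w) z s f) s :=
  hasDerivAt_apply_locallyNilpotentExp (hasDerivAt_corr h hL)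
    (B.exists_dualLm1_pow_eq_zero f).choose_spec

variable (B) in
theorem hasSum_translCorr (v : Fin k → V) (w : W) (hz : Function.Injective z) {t : ℂ}
    (ht : ∀ i, ‖t‖ < ‖z i‖) (f : restrictedDual B.gr) :
    HasSum (fun j : ℕ => t ^ j / (j.factorial : ℂ) * B.corr v ((B.Lm1 ^ j) w) z f)
      (B.translCorr v w z t f) := by
  obtain ⟨r, htr, hrz⟩ : ∃ r : ℝ, ‖t‖ < r ∧ ∀ i, r ≤ ‖z i‖ := by
    rcases isEmpty_or_nonempty (Fin k) with hk | hk
    · exact ⟨‖t‖ + 1, by linarith, fun i => hk.elim i⟩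
    · obtain ⟨i, hi⟩ := Finite.exists_min fun i => ‖z i‖
      exact ⟨‖z i‖, ht i, hi⟩
  have hreg : ∀ s ∈ Metric.ball (0 : ℂ) r, ∀ w, B.IsRegular v w fun i => z i - s := by
    intro s hs w
    refine B.isRegular_of_ne_zero v w (fun i j hij => hz (sub_left_inj.1 hij)) fun i hi => ?_
    rw [mem_ball_zero_iff, ← sub_eq_zero.1 hi] at hs
    exact hs.not_ge (hrz i)
  simpa only [translCorr_zero, ← Module.End.pow_apply] using
    hasSum_taylor_of_hasDerivAt (F := fun w t => B.translCorr v w z t f) (L := B.Lm1)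
      (fun w s hs => hasDerivAt_translCorr
        ((Metric.isOpen_ball.eventually_mem hs).mono fun t ht => hreg t ht w) (hreg s hs _) f) htr w

end GradingRestrictedVertexAlgebra.GeneralizedModule

/-! ## Cochains with one entry are composable -/

theorem homComponent_of_mem {ι : Type*} [DecidableEq ι]
    {gr : ι → Submodule ℂ W} (h : DirectSum.IsInternal gr) {i : ι} {x : W} (hx : x ∈ gr i) (j : ι) :
    homComponent h j x = if i = j then x else 0 := by
  have hsymm : (LinearEquiv.ofBijective (DirectSum.coeLinearMap gr) h).symm x =
      DirectSum.lof ℂ ι (fun i => gr i) i ⟨x, hx⟩ :=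
    (LinearEquiv.symm_apply_eq _).2 (DirectSum.coeLinearMap_lof gr i ⟨x, hx⟩).symm
  rw [homComponent, LinearMap.comp_apply, LinearMap.comp_apply, LinearEquiv.coe_coe, hsymm]
  by_cases hij : i = j
  · subst hij
    rw [if_pos rfl, DirectSum.component.lof_self]
    rfl
  · rw [if_neg hij, DirectSum.component.of, dif_neg hij]
    rfl

section Completion

variable {ι : Type*} {gr : ι → Submodule ℂ W}

/-- The pairing with a fixed element of the completion, as a linear functional on the restricted
dual. -/
def pairWith (x : Completion gr) : restrictedDual gr →ₗ[ℂ] ℂ where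
  toFun f := pair f x
  map_add' f g := finsum_add_distrib (pair_finite f x) (pair_finite g x)
  map_smul' c f := (smul_finsum c fun α => (f : Module.Dual ℂ W) (x.1 α)).symm

theorem pairWith_apply (x : Completion gr) (f : restrictedDual gr) : pairWith x f = pair f x := rfl

theorem hasSum_pair (f : restrictedDual gr) (x : Completion gr) :
    HasSum (fun α => (f : Module.Dual ℂ W) (x.1 α)) (pair f x) := by
  rw [pair, ← tsum_eq_finsum (L := SummationFilter.unconditional _) (pair_finite f x)]
  exact (summable_of_hasFiniteSupport (pair_finite f x)).hasSum

end Completion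

theorem poleDenominator_castSucc {V : Type*} {m : ℕ} (N : V → V → ℕ+) (v : Fin (m + 1) → V)
    (z : Fin (m + 1) → ℂ) :
    poleDenominator N v z =
      (∏ i : Fin m, (z i.castSucc - z (Fin.last m)) ^ (N (v i.castSucc) (v (Fin.last m)) : ℕ)) *
        poleDenominator N (fun i : Fin m => v i.castSucc) fun i => z i.castSucc := by
  induction m with
  | zero => simp [poleDenominator]
  | succ m ih =>
    rw [poleDenominator_succ, ih, poleDenominator_succ N (fun i : Fin (m + 1) => v i.castSucc),
      Fin.prod_univ_castSucc, Fin.prod_univ_succ]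
    simp only [Fin.succ_castSucc, Fin.succ_last, Fin.castSucc_zero]
    ring

theorem poleDenominator_sub {V : Type*} {m : ℕ} (N : V → V → ℕ+) (v : Fin m → V)
    (z : Fin m → ℂ) (t : ℂ) : poleDenominator N v (fun i => z i - t) = poleDenominator N v z := by
  simp [poleDenominator]

theorem eval_bind₁ {σ τ R : Type*} [CommSemiring R] (z : τ → R) (g : σ → MvPolynomial τ R)
    (p : MvPolynomial σ R) : MvPolynomial.eval z (MvPolynomial.bind₁ g p) =
      MvPolynomial.eval (fun i => MvPolynomial.eval z (g i)) p :=
  MvPolynomial.eval₂Hom_bind₁ (RingHom.id R) z g p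

theorem GradingRestrictedVertexAlgebra.expL0_of_mem (A : GradingRestrictedVertexAlgebra V) (a : ℂ)
    {n : ℤ} {v : V} (hv : v ∈ A.gr n) : A.expL0 a v = Complex.exp (a * n) • v := by
  rw [GradingRestrictedVertexAlgebra.expL0, finsum_eq_single _ n]
  · rw [homComponent_of_mem A.internal hv, if_pos rfl]
  · intro m hm
    rw [homComponent_of_mem A.internal hv, if_neg hm.symm, smul_zero]

theorem GradingRestrictedVertexAlgebra.Lm1_one (A : GradingRestrictedVertexAlgebra V) :
    A.Lm1 A.one = 0 := by
  rw [GradingRestrictedVertexAlgebra.Lm1, A.identity, if_neg (by norm_num)]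

namespace GradingRestrictedVertexAlgebra.GeneralizedModule

variable {A : GradingRestrictedVertexAlgebra V} {B : A.GeneralizedModule W}

theorem pair_Lm1Bar (f : restrictedDual B.gr) (x : Completion B.gr) :
    pair f (B.Lm1Bar x) = pair (B.dualLm1 f) x := by
  unfold pair
  exact finsum_comp_equiv (Equiv.subRight (1 : ℂ))
    (f := fun α => (B.dualLm1 f : Module.Dual ℂ W) (x.1 α))

theorem locallyNilpotentExp_dualLm1_apply {K : ℕ} {f : restrictedDual B.gr}
    (hK : (B.dualLm1 ^ K) f = 0) (t : ℂ) (x : W) :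
    (locallyNilpotentExp B.dualLm1 t f).1 x =
      ∑ a ∈ Finset.range K,
        t ^ a / (a.factorial : ℂ) * (f : Module.Dual ℂ W) ((B.Lm1 ^ a) x) := by
  simp [locallyNilpotentExp_eq_sum hK, dualLm1_pow_apply]

theorem eq_zero_of_expL0Component_eq {α β : ℂ} (hαβ : α ≠ β) {x : W} (hx : x ∈ B.gr α)
    (h : ∀ a : ℂ, B.expL0Component a α x = Complex.exp (a * β) • x) : x = 0 := by
  by_contra hx0
  obtain ⟨D, hD⟩ : ∃ D : Module.End ℂ W, D = B.L0 - α • (1 : Module.End ℂ W) := ⟨_, rfl⟩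
  obtain ⟨N, hne, hN⟩ := exists_pow_apply_ne_zero_and_pow_succ_eq_zero hx0
    (hD ▸ B.L0_grading α x hx : ∃ N : ℕ, (D ^ N) x = 0)
  have hexp : ∀ a : ℂ, Complex.exp (a * α) = Complex.exp (a * β) := by
    intro a
    have happly := congrArg (D ^ N) (h a)
    change (D ^ N) (Complex.exp (a * α) • locallyNilpotentExp (B.L0 - α • 1) a x) = _ at happly
    rw [← hD, map_smul, map_smul,
      map_locallyNilpotentExp (D ^ N) (LinearMap.congr_fun (Commute.pow_self D N).eq) hN,
      locallyNilpotentExp_eq_sum (K := 1) (by rwa [← Module.End.mul_apply, ← pow_add, add_comm])]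
      at happly
    exact smul_left_injective ℂ hne (by simpa using happly)
  have hderiv : ∀ c : ℂ, HasDerivAt (fun a => Complex.exp (a * c)) c 0 := fun c => by
    simpa using (hasDerivAt_mul_const (x := (0 : ℂ)) c).cexp
  exact hαβ ((hderiv α).unique (by simpa only [hexp] using hderiv β))

section Cochain

variable {Φ : Cochain B}

theorem IsWValued.component_zero_eq_zero (h : IsWValued B Φ) {n : ℤ} {v : V} (hv : v ∈ A.gr n)
    {α : ℂ} (hα : α ≠ n) : (Φ 0 v).1 α = 0 := by
  refine eq_zero_of_expL0Component_eq (B := B) hα ((Φ 0 v).2 α (Set.mem_univ _)) fun a => ?_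
  have hconj := h.conjugation a v 0 α
  rwa [mul_zero, A.expL0_of_mem a hv, map_smul, Completion.smul_val, Pi.smul_apply] at hconj

theorem IsWValued.finite_support (h : IsWValued B Φ) (v : V) :
    (Function.support (Φ 0 v).1).Finite := by
  induction v using A.induction_homogeneous with
  | hom n v hv =>
    exact (Set.finite_singleton (n : ℂ)).subset fun α hα =>
      not_imp_comm.1 (h.component_zero_eq_zero hv) hα
  | add u v hu hv =>
    rw [map_add, Completion.add_val]
    exact (hu.union hv).subset (Function.support_add _ _)

/-- The value at the origin of a cochain, which lies in the module itself and not only in its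
completion, as a linear map. -/
def IsWValued.atZero (h : IsWValued B Φ) : V →ₗ[ℂ] W where
  toFun v := ∑ᶠ α, (Φ 0 v).1 α
  map_add' u v := by
    rw [map_add, Completion.add_val]
    exact finsum_add_distrib (h.finite_support u) (h.finite_support v)
  map_smul' c v := by
    rw [map_smul, Completion.smul_val, RingHom.id_apply, smul_finsum' _ (h.finite_support v)]
    rfl

theorem IsWValued.atZero_mem (h : IsWValued B Φ) {n : ℤ} {v : V} (hv : v ∈ A.gr n) :
    h.atZero v ∈ B.gr n := by
  have hval : h.atZero v = (Φ 0 v).1 n :=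
    finsum_eq_single _ _ fun _ hα => h.component_zero_eq_zero hv hα
  rw [hval]
  exact (Φ 0 v).2 _ (Set.mem_univ _)

theorem IsWValued.pair_zero_eq (h : IsWValued B Φ) (f : restrictedDual B.gr) (v : V) :
    pair f (Φ 0 v) = (f : Module.Dual ℂ W) (h.atZero v) :=
  (map_finsum (f : Module.Dual ℂ W) (h.finite_support v)).symm

theorem IsWValued.hasDerivAt_pair (h : IsWValued B Φ) (f : restrictedDual B.gr) (v : V) (z : ℂ) :
    HasDerivAt (fun x => pair f (Φ x v)) (pair (B.dualLm1 f) (Φ z v)) z := by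
  rw [← pair_Lm1Bar]
  exact h.derivative_W v f z

theorem IsWValued.pair_add_eq (h : IsWValued B Φ) (f : restrictedDual B.gr) (v : V) (z t : ℂ) :
    pair f (Φ (z + t) v) = pair (locallyNilpotentExp B.dualLm1 t f) (Φ z v) := by
  obtain ⟨K, hK⟩ := B.exists_dualLm1_pow_eq_zero f
  simpa only [add_zero, pairWith_apply] using apply_eq_apply_zero_locallyNilpotentExp
    (g := fun t => pairWith (Φ (z + t) v))
    (fun s f => (h.hasDerivAt_pair f v (z + s)).comp_const_add z s) hK t

theorem IsWValued.pair_eq (h : IsWValued B Φ) (f : restrictedDual B.gr) (v : V) (z : ℂ) :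
    pair f (Φ z v) = (locallyNilpotentExp B.dualLm1 z f).1 (h.atZero v) := by
  rw [← h.pair_zero_eq, ← h.pair_add_eq, zero_add]

/-- A linear functional on `W` restricted to one homogeneous subspace, as an element of the
restricted dual. -/
def componentDual (B : A.GeneralizedModule W) (g : Module.Dual ℂ W) (q : ℂ) :
    restrictedDual B.gr :=
  ⟨g ∘ₗ homComponent B.internal q, by
    refine (Set.finite_singleton q).subset ?_
    rintro α ⟨x, hx, hne⟩
    refine not_imp_comm.1 (fun hα : ¬α = q => ?_) hne
    rw [LinearMap.comp_apply, homComponent_of_mem B.internal hx, if_neg hα, map_zero]⟩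

theorem componentDual_apply (g : Module.Dual ℂ W) (q : ℂ) (x : W) :
    (B.componentDual g q : Module.Dual ℂ W) x = g (homComponent B.internal q x) := rfl

theorem pair_componentDual (g : Module.Dual ℂ W) (q : ℂ) (x : Completion B.gr) :
    pair (B.componentDual g q) x = g (x.1 q) := by
  rw [pair, finsum_eq_single _ q]
  · rw [componentDual_apply, homComponent_of_mem B.internal (x.2 q (Set.mem_univ _)), if_pos rfl]
  · intro α hα
    rw [componentDual_apply, homComponent_of_mem B.internal (x.2 α (Set.mem_univ _)), if_neg hα,
      map_zero]

theorem IsWValued.dual_component (h : IsWValued B Φ) {n : ℤ} {v : V} (hv : v ∈ A.gr n) (z q : ℂ)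
    (g : Module.Dual ℂ W) {K : ℕ} (hK : (B.dualLm1 ^ K) (B.componentDual g q) = 0) :
    g ((Φ z v).1 q) = ∑ a ∈ Finset.range K, z ^ a / (a.factorial : ℂ) *
      if (n : ℂ) + a = q then g ((B.Lm1 ^ a) (h.atZero v)) else 0 := by
  rw [← pair_componentDual, h.pair_eq, locallyNilpotentExp_dualLm1_apply hK]
  refine Finset.sum_congr rfl fun a _ => ?_
  rw [componentDual_apply,
    homComponent_of_mem B.internal (B.pow_Lm1_mem_gr (h.atZero_mem hv) a)]
  split_ifs <;> simp

theorem IsWValued.component_add_natCast (h : IsWValued B Φ) {n : ℤ} {v : V} (hv : v ∈ A.gr n)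
    (z : ℂ) (j : ℕ) :
    (Φ z v).1 (n + j) = (z ^ j / (j.factorial : ℂ)) • (B.Lm1 ^ j) (h.atZero v) := by
  rw [← sub_eq_zero, ← Module.forall_dual_apply_eq_zero_iff ℂ]
  intro g
  obtain ⟨K, hK⟩ := B.exists_dualLm1_pow_eq_zero (B.componentDual g (n + j))
  rw [map_sub, map_smul, smul_eq_mul, sub_eq_zero, h.dual_component hv z _ g (K := j + 1 + K)
    (Module.End.pow_map_zero_of_le (Nat.le_add_left _ _) hK), Finset.sum_eq_single j]
  · rw [if_pos rfl]
  · intro a _ ha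
    rw [if_neg (by simpa using ha), mul_zero]
  · intro hj
    exact absurd (Finset.mem_range.2 (by lia)) hj

theorem IsWValued.component_eq_zero (h : IsWValued B Φ) {n : ℤ} {v : V} (hv : v ∈ A.gr n)
    (z : ℂ) {q : ℂ} (hq : ∀ j : ℕ, (n : ℂ) + j ≠ q) : (Φ z v).1 q = 0 := by
  rw [← Module.forall_dual_apply_eq_zero_iff ℂ]
  intro g
  obtain ⟨K, hK⟩ := B.exists_dualLm1_pow_eq_zero (B.componentDual g q)
  rw [h.dual_component hv z q g hK]
  exact Finset.sum_eq_zero fun a _ => by rw [if_neg (hq a), mul_zero]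

/-- The sum over the weights `q` is the Taylor series of `translCorr`. -/
theorem IsWValued.hasSum_corr (h : IsWValued B Φ) (f : restrictedDual B.gr) {k : ℕ} (v : Fin k → V)
    (u : V) {y : Fin k → ℂ} (hy : Function.Injective y) {t : ℂ} (ht : ∀ i, ‖t‖ < ‖y i‖) :
    HasSum (fun q => B.corr v ((Φ t u).1 q) y f) (B.translCorr v (h.atZero u) y t f) := by
  have hreg : ∀ w, B.IsRegular v w y := fun w =>
    B.isRegular_of_ne_zero v w hy fun i => norm_pos_iff.1 ((norm_nonneg t).trans_lt (ht i))
  have hreg' : ∀ w, B.IsRegular v w fun i => y i - t := fun w =>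
    B.isRegular_of_ne_zero v w (fun i j hij => hy (sub_left_inj.1 hij)) fun i =>
      sub_ne_zero.2 fun hi => (ht i).ne (by rw [hi])
  induction u using A.induction_homogeneous with
  | hom n u hu =>
    have hinj : Function.Injective fun j : ℕ => (n : ℂ) + j := fun a b hab => by simpa using hab
    refine (hinj.hasSum_iff fun q hq => ?_).1 ?_
    · rw [h.component_eq_zero hu t fun j hj => hq ⟨j, hj⟩, corr_zero, LinearMap.zero_apply]
    · refine (B.hasSum_translCorr v (h.atZero u) hy ht f).congr_fun fun j => ?_
      rw [Function.comp_apply, h.component_add_natCast hu, corr_smul _ (hreg _),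
        LinearMap.smul_apply, smul_eq_mul]
  | add u u' hu hu' =>
    rw [map_add h.atZero, translCorr, corr_add (hreg' _) (hreg' _)]
    refine (hu.add hu').congr_fun fun q => ?_
    rw [map_add, Completion.add_val, Pi.add_apply, corr_add (hreg _) (hreg _),
      LinearMap.add_apply]

/-- Bounds the orders of the poles of `⟨w', Y_W(v_1, z_1) ⋯ Y_W(v_m, z_m) Φ(v_{m+1}, z_{m+1})⟩`:
the first summand is for the vertex operators among each other, the second one for a vertex
operator and `Φ`. -/
def IsWValued.poleOrder (h : IsWValued B Φ) (u v : V) : ℕ+ :=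
  (truncOrder A.Y u v + truncOrder B.Y u (h.atZero v)).succPNat

theorem IsWValued.exists_translCorr_eq_div (h : IsWValued B Φ) (f : restrictedDual B.gr)
    {m : ℕ} (v : Fin (m + 1) → V) :
    ∃ P : MvPolynomial (Fin (m + 1)) ℂ, ∀ z : Fin (m + 1) → ℂ, Function.Injective z →
      B.translCorr (fun i : Fin m => v i.castSucc) (h.atZero (v (Fin.last m)))
        (fun i => z i.castSucc) (z (Fin.last m)) f =
      MvPolynomial.eval z P / poleDenominator h.poleOrder v z := by
  obtain ⟨K, hK⟩ := B.exists_dualLm1_pow_eq_zero f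
  have hN : ∀ u v, truncOrder A.Y u v ≤ h.poleOrder u v := fun u v => by
    rw [poleOrder, Nat.succPNat_coe]; lia
  have hM : ∀ (u : V) (n : ℤ), ((h.poleOrder u (v (Fin.last m)) : ℕ) : ℤ) ≤ n →
      mode B.Y u n (h.atZero (v (Fin.last m))) = 0 := fun u n hn =>
    mode_eq_zero_of_truncOrder_le B.Y u _ (by rw [poleOrder, Nat.succPNat_coe] at hn; lia)
  choose P hP using fun a : ℕ => exists_corr_eq_div (B := B) hN
    (M := fun u => (h.poleOrder u (v (Fin.last m)) : ℕ)) hM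
    (fun i : Fin m => v i.castSucc) ((B.dualLm1 ^ a) f)
  refine ⟨∑ a ∈ Finset.range K, MvPolynomial.C (1 / (a.factorial : ℂ)) *
    MvPolynomial.X (Fin.last m) ^ a * MvPolynomial.bind₁ (fun i : Fin m =>
      MvPolynomial.X i.castSucc - MvPolynomial.X (Fin.last m)) (P a), fun z hz => ?_⟩
  have hinj : Function.Injective fun i : Fin m => z i.castSucc - z (Fin.last m) :=
    fun i j hij => Fin.castSucc_injective m (hz (sub_left_inj.1 hij))
  have hne : ∀ i : Fin m, z i.castSucc - z (Fin.last m) ≠ 0 := fun i =>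
    sub_ne_zero.2 (hz.ne (Fin.castSucc_lt_last i).ne)
  rw [translCorr, locallyNilpotentExp_eq_sum hK, map_sum, map_sum, Finset.sum_div]
  refine Finset.sum_congr rfl fun a _ => ?_
  rw [map_smul, (B.isRegular_of_ne_zero _ _ hinj hne).corr_eq (hP a _ hinj fun i => Or.inr (hne i)),
    poleDenominator_sub, ← poleDenominator_castSucc]
  simp only [map_mul, map_pow, map_sub, eval_bind₁, MvPolynomial.eval_C, MvPolynomial.eval_X,
    smul_eq_mul]
  ring

theorem IsWValued.givenByRationalFunction_isSumJ (h : IsWValued B Φ) {m : ℕ}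
    (D : Set (Fin (m + 1) → ℂ)) : GivenByRationalFunction B D (IsSumJ B Φ) := by
  refine ⟨h.poleOrder, fun v f => ?_⟩
  obtain ⟨P, hP⟩ := h.exists_translCorr_eq_div f v
  refine ⟨P, fun z _ hz hlt hpos => ?_⟩
  have hinj : Function.Injective fun i : Fin m => z i.castSucc :=
    hz.comp (Fin.castSucc_injective m)
  refine ⟨fun q => B.corr (fun i : Fin m => v i.castSucc)
    ((Φ (z (Fin.last m)) (v (Fin.last m))).1 q) (fun i => z i.castSucc) f, fun q => ?_, ?_⟩
  · exact (B.isRegular_of_ne_zero _ _ hinj fun i =>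
      norm_pos_iff.1 (hpos.trans (hlt i))).isCorrelatorValue f
  · rw [← hP z hz]
    exact h.hasSum_corr f _ _ hinj hlt

/-- The transpose of the value of a cochain at the origin. -/
def IsWValued.pullback (h : IsWValued B Φ) :
    restrictedDual B.gr →ₗ[ℂ] restrictedDual A.toModule.gr where
  toFun f := ⟨(f : Module.Dual ℂ W) ∘ₗ h.atZero, by
    refine (A.mem_restrictedDual_complex_iff _).2 ?_
    refine Set.Finite.subset (f.2.preimage Int.cast_injective.injOn) ?_
    rintro n ⟨v, hv, hne⟩
    exact ⟨_, h.atZero_mem hv, hne⟩⟩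
  map_add' f g := by ext; simp
  map_smul' c f := by ext; simp

theorem IsWValued.pullback_dualLm1 (h : IsWValued B Φ) (f : restrictedDual B.gr) :
    h.pullback (B.dualLm1 f) = A.toModule.dualLm1 (h.pullback f) := by
  refine Subtype.ext (LinearMap.ext fun v => ?_)
  have hderiv := (h.derivative_W v f 0).unique (h.derivative_V v f 0)
  rwa [pair_Lm1Bar, h.pair_zero_eq, h.pair_zero_eq] at hderiv

theorem exists_vacuum_corr_eq_div {k : ℕ} (v : Fin k → V) (f : restrictedDual A.toModule.gr) :
    ∃ P : MvPolynomial (Fin k) ℂ, ∀ z : Fin k → ℂ, Function.Injective z →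
      IsCorrelatorValue A.toModule v A.one f z
        (MvPolynomial.eval z P / poleDenominator A.poleOrder v z) := by
  obtain ⟨P, hP⟩ := exists_corr_eq_div (B := A.toModule) (N := A.poleOrder)
    (fun u v => Nat.le_succ _) (w := A.one) (M := fun _ => 0) (fun u n hn => A.creation u n hn) v f
  exact ⟨P, fun z hz => by simpa using hP z hz fun i => Or.inl rfl⟩

theorem isRegular_vacuum {k : ℕ} (v : Fin k → V) {z : Fin k → ℂ} (hz : Function.Injective z) :
    A.toModule.IsRegular v A.one z := fun f =>
  let ⟨_, hP⟩ := exists_vacuum_corr_eq_div v f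
  ⟨_, hP z hz⟩

theorem translCorr_vacuum {k : ℕ} (v : Fin k → V) {z : Fin k → ℂ} (hz : Function.Injective z)
    (t : ℂ) (f : restrictedDual A.toModule.gr) :
    A.toModule.translCorr v A.one z t f = A.toModule.corr v A.one z f := by
  have hreg : ∀ s : ℂ, A.toModule.IsRegular v A.one fun i => z i - s := fun s =>
    isRegular_vacuum v fun i j hij => hz (sub_left_inj.1 hij)
  have hL : A.toModule.Lm1 A.one = 0 := A.Lm1_one
  have hderiv : ∀ s g, HasDerivAt (fun t => A.toModule.corr v A.one (fun i => z i - t) g)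
      (-A.toModule.corr v A.one (fun i => z i - s) (A.toModule.dualLm1 g)) s := fun s g =>
    (hasDerivAt_corr (.of_forall hreg) (by rw [hL]; exact isRegular_zero) g).congr_deriv (by
      rw [hL, corr_zero, LinearMap.zero_apply, zero_sub])
  obtain ⟨K, hK⟩ := A.toModule.exists_dualLm1_pow_eq_zero f
  exact (apply_locallyNilpotentExp_eq hderiv hK t).trans (by simp only [sub_zero])

theorem IsWValued.givenByRationalFunction_isSumI (h : IsWValued B Φ) {k : ℕ}
    (D : Set (Fin k → ℂ)) : GivenByRationalFunction B D (IsSumI B Φ) := by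
  refine ⟨A.poleOrder, fun v f => ?_⟩
  obtain ⟨P, hP⟩ := exists_vacuum_corr_eq_div v (h.pullback f)
  refine ⟨P, fun z _ hz ζ x hx => ?_⟩
  set μ := h.pullback (locallyNilpotentExp B.dualLm1 ζ f) with hμ
  have hμA : (μ : Module.Dual ℂ V) ∈ restrictedDual A.gr :=
    (A.mem_restrictedDual_complex_iff _).1 μ.2
  have hvalue : IsCorrelatorValue A.toModule v A.one μ (fun i => z i - ζ) (pair ⟨μ, hμA⟩ x) :=
    hx ⟨μ, hμA⟩
  obtain ⟨K, hK⟩ := B.exists_dualLm1_pow_eq_zero f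
  have hpair : pair (⟨μ, hμA⟩ : restrictedDual A.gr) x =
      MvPolynomial.eval z P / poleDenominator A.poleOrder v z := by
    rw [← (isRegular_vacuum v fun i j hij => hz (sub_left_inj.1 hij)).corr_eq hvalue,
      ← (isRegular_vacuum v hz).corr_eq (hP z hz), ← translCorr_vacuum v hz ζ, translCorr, hμ,
      map_locallyNilpotentExp h.pullback h.pullback_dualLm1 hK]
  rw [← hpair]
  exact (hasSum_pair ⟨μ, hμA⟩ x).congr_fun fun r => h.pair_eq f (x.1 r) ζ

theorem IsWValued.composableOn (h : IsWValued B Φ) {m : ℕ} (D : Set (Fin (m + 1) → ℂ)) :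
    ComposableOn B D Φ :=
  ⟨h.givenByRationalFunction_isSumI D, h.givenByRationalFunction_isSumJ D⟩

end Cochain

end GradingRestrictedVertexAlgebra.GeneralizedModule

/-! ## The two-point connection form -/

/-- A function of two complex variables which is, off the diagonal, the quotient of a polynomial by
a power of the difference of the variables. -/
def IsRationalOffDiagonal (F : ℂ → ℂ → ℂ) : Prop :=
  ∃ (P : MvPolynomial (Fin 2) ℂ) (N : ℕ), ∀ x : Fin 2 → ℂ, x 0 ≠ x 1 →
    F (x 0) (x 1) = MvPolynomial.eval x P / (x 0 - x 1) ^ N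

namespace IsRationalOffDiagonal

variable {F G : ℂ → ℂ → ℂ}

theorem add (hF : IsRationalOffDiagonal F) (hG : IsRationalOffDiagonal G) :
    IsRationalOffDiagonal fun z₁ z₂ => F z₁ z₂ + G z₁ z₂ := by
  obtain ⟨P, N, hP⟩ := hF
  obtain ⟨Q, M, hQ⟩ := hG
  refine ⟨P * (MvPolynomial.X 0 - MvPolynomial.X 1) ^ M +
    Q * (MvPolynomial.X 0 - MvPolynomial.X 1) ^ N, N + M, fun x hx => ?_⟩
  have hne : x 0 - x 1 ≠ 0 := sub_ne_zero.2 hx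
  simp only [hP x hx, hQ x hx, map_add, map_mul, map_pow, map_sub, MvPolynomial.eval_X, pow_add]
  rw [div_add_div _ _ (pow_ne_zero _ hne) (pow_ne_zero _ hne),
    mul_comm (_ ^ N) (MvPolynomial.eval x Q)]

theorem neg (hF : IsRationalOffDiagonal F) : IsRationalOffDiagonal fun z₁ z₂ => -F z₁ z₂ :=
  let ⟨P, N, hP⟩ := hF
  ⟨-P, N, fun x hx => by simp only [hP x hx, map_neg, neg_div]⟩

theorem sub (hF : IsRationalOffDiagonal F) (hG : IsRationalOffDiagonal G) :
    IsRationalOffDiagonal fun z₁ z₂ => F z₁ z₂ - G z₁ z₂ := by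
  simpa only [sub_eq_add_neg] using hF.add hG.neg

theorem swap (hF : IsRationalOffDiagonal F) : IsRationalOffDiagonal fun z₁ z₂ => F z₂ z₁ := by
  obtain ⟨P, N, hP⟩ := hF
  refine ⟨(-1) ^ N * MvPolynomial.rename (Equiv.swap 0 1) P, N, fun x hx => ?_⟩
  have hswap := hP (x ∘ Equiv.swap 0 1) (by simpa using hx.symm)
  simp only [Function.comp_apply, Equiv.swap_apply_left, Equiv.swap_apply_right] at hswap
  simp only [hswap, map_mul, map_pow, map_neg, map_one, MvPolynomial.eval_rename]
  rw [← neg_sub (x 0), neg_pow (x 0 - x 1)]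
  rw [← div_div, div_eq_mul_inv _ ((-1) ^ N), ← inv_pow, inv_neg_one, mul_comm ((-1) ^ N)]

theorem sum {ι : Type*} (s : Finset ι) {F : ι → ℂ → ℂ → ℂ}
    (hF : ∀ i ∈ s, IsRationalOffDiagonal (F i)) :
    IsRationalOffDiagonal fun z₁ z₂ => ∑ i ∈ s, F i z₁ z₂ := by
  classical
  induction s using Finset.induction_on with
  | empty => exact ⟨0, 0, fun x _ => by simp⟩
  | insert i s hi ih =>
    simp only [Finset.sum_insert hi]
    exact (hF i (Finset.mem_insert_self i s)).add
      (ih fun j hj => hF j (Finset.mem_insert_of_mem hj))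

theorem eval_mul_zpow (p : Polynomial ℂ) (n : ℤ) :
    IsRationalOffDiagonal fun z₁ z₂ => p.eval z₂ * (z₁ - z₂) ^ n := by
  have heval (x : Fin 2 → ℂ) :
      MvPolynomial.eval x (Polynomial.aeval (MvPolynomial.X 1) p) = p.eval (x 1) := by
    rw [← Polynomial.coe_aeval_eq_eval, ← MvPolynomial.aeval_eq_eval,
      ← Polynomial.aeval_algHom_apply, MvPolynomial.aeval_X]
  obtain ⟨k, rfl | rfl⟩ := n.eq_nat_or_neg
  · refine ⟨Polynomial.aeval (MvPolynomial.X 1) p *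
      (MvPolynomial.X 0 - MvPolynomial.X 1) ^ k, 0, fun x _ => ?_⟩
    simp only [map_mul, map_pow, map_sub, MvPolynomial.eval_X, heval, zpow_natCast, pow_zero,
      div_one]
  · exact ⟨Polynomial.aeval (MvPolynomial.X 1) p, k, fun x _ => by
      simp only [heval, zpow_neg, zpow_natCast, div_eq_mul_inv]⟩

theorem rationalValue (hF : IsRationalOffDiagonal F) {κ : Type*} {U : Set (Fin 2 → ℂ)}
    {s : κ → (Fin 2 → ℂ) → ℂ} (hU : ∀ x ∈ U, x 0 ≠ x 1)
    (hs : ∀ x ∈ U, HasSum (fun i => s i x) (F (x 0) (x 1))) {z₁ z₂ : ℂ} (hz : z₁ ≠ z₂) :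
    RationalValue U s ![z₁, z₂] (F z₁ z₂) := by
  obtain ⟨P, N, hP⟩ := hF
  refine ⟨P, (MvPolynomial.X 0 - MvPolynomial.X 1) ^ N, ?_⟩
  simp only [map_pow, map_sub, MvPolynomial.eval_X]
  exact ⟨fun x hx => ⟨pow_ne_zero _ (sub_ne_zero.2 (hU x hx)), hP x (hU x hx) ▸ hs x hx⟩,
    pow_ne_zero _ (sub_ne_zero.2 hz), hP ![z₁, z₂] hz⟩

theorem eq_zero_of_infinite (hF : IsRationalOffDiagonal F) {z₀ : ℂ} {s : Set ℂ} (hs : s.Infinite)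
    (hs0 : ∀ z ∈ s, z ≠ z₀ ∧ F z₀ z = 0) {z : ℂ} (hz : z ≠ z₀) : F z₀ z = 0 := by
  obtain ⟨P, N, hP⟩ := hF
  have hF : ∀ z ≠ z₀, F z₀ z = MvPolynomial.eval ![z₀, z] P / (z₀ - z) ^ N := fun z hz =>
    hP ![z₀, z] hz.symm
  set p : Polynomial ℂ := MvPolynomial.aeval ![Polynomial.C z₀, Polynomial.X] P with hp
  have heval : ∀ z, p.eval z = MvPolynomial.eval ![z₀, z] P := by
    intro z
    have hcomp := MvPolynomial.comp_aeval_apply ![Polynomial.C z₀, Polynomial.X]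
      (Polynomial.aeval z) P
    rw [← hp, Polynomial.coe_aeval_eq_eval] at hcomp
    rw [hcomp]
    refine congrArg (fun y => MvPolynomial.eval y P) (funext fun i => ?_)
    fin_cases i <;> simp
  have hp0 : p = 0 := p.eq_zero_of_infinite_isRoot <| hs.mono fun x hx => by
    have hquot := hF x (hs0 x hx).1 ▸ (hs0 x hx).2
    rw [Set.mem_ofPred_eq, Polynomial.IsRoot.def, heval]
    exact (div_eq_zero_iff.1 hquot).resolve_right
      (pow_ne_zero _ (sub_ne_zero.2 (hs0 x hx).1.symm))
  rw [hF z hz, ← heval, hp0, Polynomial.eval_zero, zero_div]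

end IsRationalOffDiagonal

theorem RationalValue.mono {κ : Type*} {k : ℕ} {U U' : Set (Fin k → ℂ)}
    {s : κ → (Fin k → ℂ) → ℂ} {z : Fin k → ℂ} {c : ℂ} (h : RationalValue U s z c) (hU : U' ⊆ U) :
    RationalValue U' s z c :=
  let ⟨P, Q, hPQ, hQ, hc⟩ := h
  ⟨P, Q, fun x hx => hPQ x (hU hx), hQ, hc⟩

theorem apply_zero_ne_apply_one_of_mem_orderedRegion {x : Fin 2 → ℂ} (hx : x ∈ orderedRegion 2) :
    x 0 ≠ x 1 :=
  (injective_of_mem_orderedRegion hx).ne Fin.zero_ne_one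

namespace GradingRestrictedVertexAlgebra.GeneralizedModule

variable {A : GradingRestrictedVertexAlgebra V} {B : A.GeneralizedModule W}

theorem hasSum_corr_singleton (v : V) (w : W) {x : ℂ} (hx : x ≠ 0) (f : restrictedDual B.gr) :
    HasSum (fun n : ℤ => (f : Module.Dual ℂ W) (mode B.Y v n w) * x ^ (-n - 1))
      (B.corr (fun _ : Fin 1 => v) w (fun _ => x) f) := by
  have hreg : B.IsRegular (fun _ : Fin 1 => v) w fun _ => x :=
    B.isRegular_of_ne_zero _ _ (Function.injective_of_subsingleton _) fun _ => hx
  obtain ⟨P, Q, hPQ, -, hval⟩ := hreg.isCorrelatorValue f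
  have hmem : (fun _ => x) ∈ orderedRegion 1 :=
    ⟨fun i j hij => absurd hij (by simp [Subsingleton.elim i j]), fun _ => norm_pos_iff.2 hx⟩
  rw [hval]
  exact ((Equiv.funUnique (Fin 1) ℤ).symm.hasSum_iff.2 (hPQ _ hmem).2).congr_fun fun n => by simp

theorem translCorr_add {k : ℕ} (v : Fin k → V) (w : W) (z : Fin k → ℂ) (s t : ℂ)
    (f : restrictedDual B.gr) :
    B.translCorr v w (fun i => z i + t) (s + t) f =
      B.translCorr v w z s (locallyNilpotentExp B.dualLm1 t f) := by
  obtain ⟨K, hK⟩ := B.exists_dualLm1_pow_eq_zero f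
  simp only [translCorr, add_sub_add_right_eq_sub, locallyNilpotentExp_locallyNilpotentExp hK]

section Cochain

variable {Φ : Cochain B}

/-- The value at `(z₁, z₂)` of the rational function `⟨f, Y_W(v₁, z₁) Φ(v₂, z₂)⟩`. -/
def IsWValued.leftValue (h : IsWValued B Φ) (v₁ v₂ : V) (f : restrictedDual B.gr) (z₁ z₂ : ℂ) : ℂ :=
  B.translCorr (fun _ : Fin 1 => v₁) (h.atZero v₂) (fun _ => z₁) z₂ f

/-- The value at `(z₁, z₂)` of the rational function `⟨f, Φ(Y_V(v₁, z₁ - z₂) v₂, z₂)⟩`. -/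
def middleValue (Φ : Cochain B) (v₁ v₂ : V) (f : restrictedDual B.gr) (z₁ z₂ : ℂ) : ℂ :=
  ∑ᶠ n : ℤ, pair f (Φ z₂ (mode A.Y v₁ n v₂)) * (z₁ - z₂) ^ (-n - 1)

/-- The value at `(z₁, z₂)` of a matrix element of the two-point connection form. -/
def IsWValued.formValue (h : IsWValued B Φ) (v₁ v₂ : V) (f : restrictedDual B.gr) (z₁ z₂ : ℂ) : ℂ :=
  h.leftValue v₁ v₂ f z₁ z₂ - middleValue Φ v₁ v₂ f z₁ z₂ + h.leftValue v₂ v₁ f z₂ z₁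

theorem IsWValued.middleValue_add (h : IsWValued B Φ) (v₁ v₂ : V) (f : restrictedDual B.gr)
    (z₁ z₂ t : ℂ) : middleValue Φ v₁ v₂ f (z₁ + t) (z₂ + t) =
      middleValue Φ v₁ v₂ (locallyNilpotentExp B.dualLm1 t f) z₁ z₂ := by
  simp only [middleValue, h.pair_add_eq, add_sub_add_right_eq_sub]

theorem IsWValued.formValue_add (h : IsWValued B Φ) (v₁ v₂ : V) (f : restrictedDual B.gr)
    (z₁ z₂ t : ℂ) : h.formValue v₁ v₂ f (z₁ + t) (z₂ + t) =
      h.formValue v₁ v₂ (locallyNilpotentExp B.dualLm1 t f) z₁ z₂ := by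
  simp only [formValue, leftValue, h.middleValue_add, ← translCorr_add]

theorem IsWValued.isRationalOffDiagonal_leftValue (h : IsWValued B Φ) (v₁ v₂ : V)
    (f : restrictedDual B.gr) : IsRationalOffDiagonal (h.leftValue v₁ v₂ f) := by
  obtain ⟨P, hP⟩ := h.exists_translCorr_eq_div f (m := 1) ![v₁, v₂]
  refine ⟨P, h.poleOrder v₁ v₂, fun x hx => ?_⟩
  have hinj : Function.Injective x := by
    intro i j hij
    fin_cases i <;> fin_cases j <;> simp_all
  have hv : (fun i : Fin 1 => ![v₁, v₂] i.castSucc) = fun _ => v₁ :=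
    funext fun i => by rw [Subsingleton.elim i 0]; rfl
  have hx0 : (fun i : Fin 1 => x i.castSucc) = fun _ => x 0 :=
    funext fun i => by rw [Subsingleton.elim i 0]; rfl
  have hdiv := hP x hinj
  rw [hv, hx0, poleDenominator_castSucc] at hdiv
  simpa [poleDenominator, leftValue, Fin.last] using hdiv

theorem IsWValued.exists_pair_mode_eq_zero (h : IsWValued B Φ) (v₁ : V)
    (f : restrictedDual B.gr) :
    ∃ lo : ℤ, ∀ n < lo, ∀ (v₂ : V) (z : ℂ), pair f (Φ z (mode A.Y v₁ n v₂)) = 0 := by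
  obtain ⟨K, hK⟩ := B.exists_dualLm1_pow_eq_zero f
  choose lo hlo using fun a : ℕ =>
    A.toModule.exists_dual_mode_eq_zero v₁ (h.pullback ((B.dualLm1 ^ a) f)).2
  obtain ⟨M, hM⟩ := ((Finset.range K).image fun a => -lo a).exists_le
  refine ⟨-M, fun n hn v₂ z => ?_⟩
  rw [h.pair_eq, locallyNilpotentExp_dualLm1_apply hK]
  refine Finset.sum_eq_zero fun a ha => ?_
  have hbound : -lo a ≤ M := hM _ (Finset.mem_image_of_mem _ ha)
  have hmode := hlo a n (by lia) v₂
  rw [← dualLm1_pow_apply]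
  exact mul_eq_zero_of_right _ hmode

theorem IsWValued.exists_finset_pair_mode_eq_zero (h : IsWValued B Φ) (v₁ v₂ : V)
    (f : restrictedDual B.gr) :
    ∃ s : Finset ℤ, ∀ n ∉ s, ∀ z, pair f (Φ z (mode A.Y v₁ n v₂)) = 0 := by
  obtain ⟨lo, hlo⟩ := h.exists_pair_mode_eq_zero v₁ f
  refine ⟨Finset.Ico lo (truncOrder A.Y v₁ v₂), fun n hn z => ?_⟩
  rw [Finset.mem_Ico, not_and_or, not_le, not_lt] at hn
  rcases hn with hn | hn
  · exact hlo n hn v₂ z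
  · rw [mode_eq_zero_of_truncOrder_le A.Y v₁ v₂ hn, map_zero, pair_zero]

theorem IsWValued.isRationalOffDiagonal_middleValue (h : IsWValued B Φ) (v₁ v₂ : V)
    (f : restrictedDual B.gr) : IsRationalOffDiagonal (middleValue Φ v₁ v₂ f) := by
  obtain ⟨s, hs⟩ := h.exists_finset_pair_mode_eq_zero v₁ v₂ f
  choose p hp using fun n : ℤ => h.rational (mode A.Y v₁ n v₂) f
  have hsum : middleValue Φ v₁ v₂ f =
      fun z₁ z₂ => ∑ n ∈ s, (p n).eval z₂ * (z₁ - z₂) ^ (-n - 1) := by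
    funext z₁ z₂
    simp only [middleValue, ← hp]
    refine finsum_eq_sum_of_support_subset _ fun n hn => ?_
    by_contra hns
    exact hn (by simp only [hs n hns, zero_mul])
  rw [hsum]
  exact .sum s fun n _ => .eval_mul_zpow (p n) _

theorem IsWValued.hasSum_middleValue (h : IsWValued B Φ) (v₁ v₂ : V) (f : restrictedDual B.gr)
    (z₁ z₂ : ℂ) : HasSum (fun n : ℤ => pair f (Φ z₂ (mode A.Y v₁ n v₂)) * (z₁ - z₂) ^ (-n - 1))
      (middleValue Φ v₁ v₂ f z₁ z₂) := by
  obtain ⟨s, hs⟩ := h.exists_finset_pair_mode_eq_zero v₁ v₂ f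
  have hfin : (Function.support fun n : ℤ =>
      pair f (Φ z₂ (mode A.Y v₁ n v₂)) * (z₁ - z₂) ^ (-n - 1)).Finite :=
    s.finite_toSet.subset fun n hn => by_contra fun hns => hn (by simp only [hs n hns, zero_mul])
  rw [middleValue, ← tsum_eq_finsum (L := SummationFilter.unconditional _) hfin]
  exact (summable_of_hasFiniteSupport hfin).hasSum

theorem IsWValued.isRationalOffDiagonal_formValue (h : IsWValued B Φ) (v₁ v₂ : V)
    (f : restrictedDual B.gr) : IsRationalOffDiagonal (h.formValue v₁ v₂ f) :=
  ((h.isRationalOffDiagonal_leftValue v₁ v₂ f).sub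
    (h.isRationalOffDiagonal_middleValue v₁ v₂ f)).add
    (h.isRationalOffDiagonal_leftValue v₂ v₁ f).swap

/-- The double series converges at one point only if it converges on the whole region, where it can
be summed first over the modes and then over the weights. -/
theorem IsWValued.isLeftTerm_leftValue (h : IsWValued B Φ) {f : restrictedDual B.gr} {v₁ v₂ : V}
    {y₁ y₂ c : ℂ} (hleft : IsLeftTerm B Φ v₁ v₂ f y₁ y₂ c) {z₁ z₂ : ℂ} (hz : z₁ ≠ z₂) :
    IsLeftTerm B Φ v₁ v₂ f z₁ z₂ (h.leftValue v₁ v₂ f z₁ z₂) := by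
  obtain ⟨P, Q, hPQ, -, -⟩ := hleft
  refine (h.isRationalOffDiagonal_leftValue v₁ v₂ f).rationalValue
    (fun x => apply_zero_ne_apply_one_of_mem_orderedRegion) (fun x hx => ?_) hz
  have hdouble := (hPQ x hx).2
  have hiterated := hdouble.prod_fiberwise fun q =>
    hasSum_corr_singleton v₁ ((Φ (x 1) v₂).1 q) (norm_pos_iff.1 (hx.2 0)) f
  have htaylor := h.hasSum_corr f (fun _ : Fin 1 => v₁) v₂ (y := fun _ => x 0)
    (Function.injective_of_subsingleton _) (t := x 1) fun _ => hx.1 0 1 Fin.zero_lt_one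
  rw [leftValue, ← hiterated.unique htaylor]
  exact hdouble

theorem IsWValued.isMiddleTerm_middleValue (h : IsWValued B Φ) (v₁ v₂ : V)
    (f : restrictedDual B.gr) {z₁ z₂ : ℂ} (hz : z₁ ≠ z₂) :
    IsMiddleTerm B Φ v₁ v₂ f z₁ z₂ (middleValue Φ v₁ v₂ f z₁ z₂) :=
  (h.isRationalOffDiagonal_middleValue v₁ v₂ f).rationalValue (fun _ hx => hx)
    (fun x _ => h.hasSum_middleValue v₁ v₂ f (x 0) (x 1)) hz

theorem FormVanishes.formValue_eq_zero {v₁ v₂ : V} {f : restrictedDual B.gr} {z₁ z₂ : ℂ}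
    (hv : FormVanishes B Φ v₁ v₂ f z₁ z₂) (h : IsWValued B Φ) (hz : z₁ ≠ z₂) :
    h.formValue v₁ v₂ f z₁ z₂ = 0 := by
  obtain ⟨c₁, c₂, c₃, hleft₁, hmiddle, hleft₂, hzero⟩ := hv
  have hsub : orderedRegion 2 ⊆ {x | x 0 ≠ x 1} := fun _ =>
    apply_zero_ne_apply_one_of_mem_orderedRegion
  rw [IsWValued.formValue, ← RationalValue.unique hleft₁ (h.isLeftTerm_leftValue hleft₁ hz),
    ← RationalValue.unique hleft₂ (h.isLeftTerm_leftValue hleft₂ hz.symm),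
    ← RationalValue.unique (RationalValue.mono hmiddle hsub)
      (RationalValue.mono (h.isMiddleTerm_middleValue v₁ v₂ f hz) hsub), hzero]

theorem FormVanishes.of_formValue_eq_zero {v₁ v₂ : V} {f : restrictedDual B.gr} {y₁ y₂ : ℂ}
    (hv : FormVanishes B Φ v₁ v₂ f y₁ y₂) (h : IsWValued B Φ) {z₁ z₂ : ℂ} (hz : z₁ ≠ z₂)
    (hzero : h.formValue v₁ v₂ f z₁ z₂ = 0) : FormVanishes B Φ v₁ v₂ f z₁ z₂ :=
  let ⟨_, _, _, hleft₁, _, hleft₂, _⟩ := hv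
  ⟨_, _, _, h.isLeftTerm_leftValue hleft₁ hz, h.isMiddleTerm_middleValue v₁ v₂ f hz,
    h.isLeftTerm_leftValue hleft₂ hz.symm, hzero⟩

theorem IsWValued.formVanishes_of_mem_nhds (h : IsWValued B Φ) {z₀ : ℂ} {s : Set ℂ}
    (hs : s ∈ nhds z₀)
    (hv : ∀ (v₁ v₂ : V) (f : restrictedDual B.gr), ∀ z ∈ s, z ≠ z₀ →
      FormVanishes B Φ v₁ v₂ f z₀ z)
    (v₁ v₂ : V) (f : restrictedDual B.gr) {z₁ z₂ : ℂ} (hz : z₁ ≠ z₂) :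
    FormVanishes B Φ v₁ v₂ f z₁ z₂ := by
  have hinf : (s \ {z₀}).Infinite := (infinite_of_mem_nhds z₀ hs).sdiff (Set.finite_singleton z₀)
  have hzero : ∀ g z, z ≠ z₀ → h.formValue v₁ v₂ g z₀ z = 0 := fun g _ =>
    (h.isRationalOffDiagonal_formValue v₁ v₂ g).eq_zero_of_infinite hinf fun z hz =>
      ⟨hz.2, (hv v₁ v₂ g z hz.1 hz.2).formValue_eq_zero h (Ne.symm hz.2)⟩
  obtain ⟨y, hys, hy⟩ := hinf.nonempty
  refine (hv v₁ v₂ f y hys hy).of_formValue_eq_zero h hz ?_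
  have htransl := h.formValue_add v₁ v₂ f z₀ (z₂ - (z₁ - z₀)) (z₁ - z₀)
  rwa [add_sub_cancel, sub_add_cancel,
    hzero _ _ fun heq => hz (by linear_combination -heq)] at htransl

end Cochain

theorem delta0_eq_zero (B : A.GeneralizedModule W) : delta0 B = 0 :=
  LinearMap.ext fun _ => funext fun _ => LinearMap.ext fun _ => sub_self _

end GradingRestrictedVertexAlgebra.GeneralizedModule

open GradingRestrictedVertexAlgebra GeneralizedModule

variable {M : Type*} [TopologicalSpace M] [ChartedSpace ℂ M] {F : CodimOneFoliation M}
  (T : F.TransversalBasis) {A : GradingRestrictedVertexAlgebra V} (B : A.GeneralizedModule W)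
  (m r : ℕ) (S : T.sections)

theorem closedCochains_eq_fixedPointConnections {p' : M} (hp' : p' ∈ (T.coord S).source) :
    closedCochains T B m = fixedPointConnections T B m r S p' := by
  refine le_antisymm (fun Φ hΦ => ?_) fun Φ hΦ => ?_
  · have h : IsWValued B Φ := hΦ.1.1
    exact ⟨⟨h, fun _ _ _ _ _ _ => h.composableOn _⟩, fun v₁ v₂ f p hp hne =>
      hΦ.2 v₁ v₂ f _ _ fun heq => hne ((T.coord S).injOn hp' hp heq).symm⟩
  · have h : IsWValued B Φ := hΦ.1.1
    refine ⟨⟨h, fun _ _ _ => h.composableOn _⟩, fun v₁ v₂ f z₁ z₂ =>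
      h.formVanishes_of_mem_nhds ((T.coord S).open_target.mem_nhds ((T.coord S).map_source hp'))
        (fun v₁ v₂ f z hz hne => ?_) v₁ v₂ f⟩
    have hvanish := hΦ.2 v₁ v₂ f _ ((T.coord S).map_target hz) fun heq =>
      hne (by rw [← heq, (T.coord S).right_inv hz])
    rwa [(T.coord S).right_inv hz] at hvanish

end FoliationVertex

end

open FoliationVertex GradingRestrictedVertexAlgebra GeneralizedModule in
theorem mainTheorem1_general {M : Type*} [TopologicalSpace M] [ChartedSpace ℂ M]
    {F : CodimOneFoliation M} (T : F.TransversalBasis) {V W : Type*} [AddCommGroup V] [Module ℂ V]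
    [AddCommGroup W] [Module ℂ W] {A : GradingRestrictedVertexAlgebra V}
    (B : A.GeneralizedModule W) (m r : ℕ) (S : T.sections) {p' : M}
    (hp' : p' ∈ (T.coord S).source) :
    ∃ e : FirstCohomology T B m ≃ₗ[ℂ] fixedPointConnections T B m r S p',
      ∀ Φ : closedCochains T B m, (e (Submodule.Quotient.mk Φ)).1 = Φ.1 := by
  have hbot : (LinearMap.range (delta0 B)).submoduleOf (closedCochains T B m) = ⊥ := by
    rw [delta0_eq_zero, LinearMap.range_zero, Submodule.submoduleOf, Submodule.comap_bot,
      Submodule.ker_subtype]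
  exact ⟨(Submodule.quotEquivOfEqBot _ hbot).trans
    (LinearEquiv.ofEq _ _ (closedCochains_eq_fixedPointConnections T B m r S hp')), fun _ => rfl⟩

open FoliationVertex in
theorem mainTheorem1 {M : Type*} [TopologicalSpace M] [T2Space M] [ChartedSpace ℂ M]
    [IsManifold 𝓘(ℂ, ℂ) ω M] (F : CodimOneFoliation M) (T : F.TransversalBasis)
    {V : Type*} [AddCommGroup V] [Module ℂ V] (A : GradingRestrictedVertexAlgebra V)
    (hA : A.IsQuasiConformal) {W : Type*} [AddCommGroup W] [Module ℂ W]
    (B : A.GeneralizedModule W) (m r : ℕ) (hr : 1 ≤ r) (hrm : r ≤ max 1 m)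
    (S : T.sections) (p' : M) (hp' : p' ∈ (S : Set M)) :
    ∃ e : FirstCohomology T B m ≃ₗ[ℂ] fixedPointConnections T B m r S p',
      ∀ Φ : closedCochains T B m, (e (Submodule.Quotient.mk Φ)).1 = Φ.1 :=
  mainTheorem1_general T B m r S (T.coord_covers S hp')
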